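/- **Model.** Let $s,d,n,k\ge 1$ be integers with $s,k\le d$, $\gamma\in(0,\tfrac12)$, $\sigma>0$. For a symmetric matrix $\mathbf M\in\mathbb R^{d\times d}$ write $\lambda_1(\mathbf M)\ge\dots\ge\lambda_d(\mathbf M)$ for its eigenvalues, and $\lambda_{d+1}(\mathbf M):=0$. Let $\boldsymbol\Sigma\in\mathbb R^{d\times d}$ be positive semidefinite with $\lambda_k(\boldsymbol\Sigma)>0$ and $\lambda_{k+1}(\boldsymbol\Sigma)/\lambda_k(\boldsymbol\Sigma)\le 1-\gamma$, and let $\mathbf v_1,\dots,\mathbf v_k$ be orthonormal vectors that span its top-$k$ eigenspace and satisfy $|\bigcup_{i\le k}\mathrm{supp}(\mathbf v_i)|\le s$. The samples $\mathbf x_1,\dots,\mathbf x_n$ are i.i.d. from a distribution $\mathcal D$ on $\mathbb R^d$ with covariance $\boldsymbol\Sigma$ that is $\sigma$-sub-Gaussian: $\mathbb E\exp(\mathbf u^\top\mathbf x)\le\exp(\tfrac12\sigma^2\|\mathbf u\|_2^2)$ for all $\mathbf u\in\mathbb R^d$. **Algorithm** $\mathsf{RTPM}(\{\mathbf x_i\}_{i\le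 n},r,T)$, for $1\le r\le d$, $T\ge1$. Let $B=\lfloor n/T\rfloor$ and $\widehat{\boldsymbol\Sigma}_t=\frac1B\sum_{B(t-1)<i\le Bt}\mathbf x_i\mathbf x_i^\top$ for $t=1,\dots,T$. For each $i\le d$ set $\mathbf u^{(i)}_0=\mathbf e_i$ and $\mathbf u^{(i)}_t=\mathrm{top}_r(\widehat{\boldsymbol\Sigma}_t\mathbf u^{(i)}_{t-1})/\|\mathrm{top}_r(\widehat{\boldsymbol\Sigma}_t\mathbf u^{(i)}_{t-1})\|_2$ (with the convention $\mathbf 0/0:=\mathbf 0$), where $\mathrm{top}_r$ keeps $r$ entries of largest magnitude and zeroes the others, ties being broken by an arbitrary fixed measurable rule depending only on the vector. Return $\mathbf u^{(i)}_T$ for any $i$ that maximizes $\langle\mathbf u^{(i)}_T,\widehat{\boldsymbol\Sigma}\mathbf u^{(i)}_T\rangle$, where $\widehat{\boldsymbol\Sigma}=\frac1n\sum_{i\le n}\mathbf x_i\mathbf x_i^\top$. **Proposition.** There are universal constants $C_r,C_T,C_{\mathrm{time}}>0$ such that for every $K\ge1$ there is a constant $C_n>0$, depending only on $K$, for which the following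 holds. In the model above let $\delta\in(0,1)$, $\epsilon\in(0,\tfrac12)$, $\beta\in(0,\gamma]$, let $r\le d$ and $$C_r\frac{s^2k^2}{\beta^2}\le r\le K C_r\frac{s^2k^2}{\beta^2},\qquad C_T\frac{k\log(s/\epsilon)}{\beta}\le T\le K C_T\frac{k\log(s/\epsilon)}{\beta},$$ $$n\ge C_n\Big(\frac{\sigma^2}{\lambda_k(\boldsymbol\Sigma)}\Big)^2s^2\Big(\frac{k^5}{\epsilon\beta^5}+\frac{k^2}{\epsilon^2\beta^2}\Big)\log\Big(\frac{dT}{\delta}\Big)\log\Big(\frac s\epsilon\Big).$$ Then: 1. $\mathsf{RTPM}(\{\mathbf x_i\}_{i\le n},r,T)$, for some tie-breaking rule, can be implemented in time at most $C_{\mathrm{time}}\,nd^2$ on every dataset, by one program that does not depend on any parameter, on a random access machine with exact real arithmetic (including square roots and comparisons) at unit cost. 2. For every tie-breaking rule, the returned vector $\mathbf u$ is always $r$-sparse, and with probability at least $1-\delta$ (simultaneously for all maximizing indices) it is a unit vector with $\mathbf u^\top\boldsymbol\Sigma\mathbf u\ge(1-\epsilon-\beta)\lambda_1(\boldsymbol\Sigma)$.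 -/

import Mathlib

open MeasureTheory ProbabilityTheory
open scoped BigOperators Matrix

namespace SparsePCA

/-- Vectors in `ℝ^d` with the Euclidean norm. -/
abbrev Vec (d : ℕ) := EuclideanSpace ℝ (Fin d)

/-- Real `d × d` matrices. -/
abbrev Mat (d : ℕ) := Matrix (Fin d) (Fin d) ℝ

/-- The number of nonzero entries of a vector. -/
noncomputable def nnz {d : ℕ} (u : Vec d) : ℕ :=
  (Finset.univ.filter (fun j => u j ≠ 0)).card

/-- The quadratic form `uᵀ M u`. -/
noncomputable def quadForm {d : ℕ} (M : Mat d) (u : Vec d) : ℝ :=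
  ∑ i, ∑ j, u i * M i j * u j

/-- The `i`-th largest eigenvalue `λ_i(M)`, with multiplicity, `1 ≤ i ≤ d`
(and `0` for `i` out of that range, so that `λ_{d+1} = 0`). -/
noncomputable def eigval {d : ℕ} {M : Mat d} (hM : M.IsHermitian) (i : ℕ) : ℝ :=
  if h : 1 ≤ i ∧ i ≤ d then
    hM.eigenvalues₀ ⟨i - 1, by rw [Fintype.card_fin]; omega⟩
  else 0

/-- The top-`k` eigenspace: the sum of the eigenspaces for all eigenvalues `≥ λ_k(M)`.
It has dimension `k` when `λ_{k+1}(M) < λ_k(M)`. -/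
noncomputable def topEigenspace {d : ℕ} {M : Mat d} (hM : M.IsHermitian) (k : ℕ) :
    Submodule ℝ (Vec d) :=
  ⨆ (μ : ℝ) (_ : eigval hM k ≤ μ), Module.End.eigenspace (Matrix.toEuclideanLin M) μ

/-- `σ`-sub-Gaussian distributions on `ℝ^d`: `E exp(uᵀx) ≤ exp(σ²‖u‖²/2)` for all `u`. -/
def IsSubGaussian {d : ℕ} (σ : ℝ) (D : Measure (Vec d)) : Prop :=
  ∀ u : Vec d, Integrable (fun x => Real.exp (inner ℝ u x)) D ∧
    ∫ x, Real.exp (inner ℝ u x) ∂D ≤ Real.exp (1 / 2 * σ ^ 2 * ‖u‖ ^ 2)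

/-- `D` has covariance matrix `M`. -/
def HasCovariance {d : ℕ} (D : Measure (Vec d)) (M : Mat d) : Prop :=
  ∀ i j : Fin d, covariance (fun x : Vec d => x i) (fun x : Vec d => x j) D = M i j

/-- The general sparse `k`-PCA model, for the law `D` of one sample. -/
structure GeneralSparseKPCA {d : ℕ} (s k : ℕ) (γ σ : ℝ) (M : Mat d) (hM : M.PosSemidef)
    (v : Fin k → Vec d) (D : Measure (Vec d)) : Prop where
  one_le_s : 1 ≤ s
  s_le_d : s ≤ d
  one_le_k : 1 ≤ k
  k_le_d : k ≤ d
  gamma_pos : 0 < γ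
  gamma_lt : γ < 1 / 2
  sigma_pos : 0 < σ
  orthonormal : Orthonormal ℝ v
  span_eq : Submodule.span ℝ (Set.range v) = topEigenspace hM.isHermitian k
  eigval_pos : 0 < eigval hM.isHermitian k
  gap : eigval hM.isHermitian (k + 1) / eigval hM.isHermitian k ≤ 1 - γ
  support : (Finset.univ.filter (fun j : Fin d => ∃ i, v i j ≠ 0)).card ≤ s
  subGaussian : IsSubGaussian σ D
  covariance : HasCovariance D M

/-! ### The restarted truncated power method -/

/-- A rule that selects, for each vector, the (indices of the) `r` entries of largest magnitude;
ties are broken in an arbitrary, measurable way. -/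
structure TopRule (d r : ℕ) where
  select : Vec d → Finset (Fin d)
  card_select : ∀ v, (select v).card = min r d
  le_of_mem : ∀ v, ∀ i ∈ select v, ∀ j ∉ select v, |v j| ≤ |v i|
  measurable_select : ∀ S, MeasurableSet {v | select v = S}

/-- `top_r(v)`: zero out all but the selected `r` entries of `v`. -/
noncomputable def TopRule.top {d r : ℕ} (τ : TopRule d r) (v : Vec d) : Vec d :=
  WithLp.toLp 2 (fun j => if j ∈ τ.select v then v j else 0)

/-- The sample covariance `(1/n) ∑ x_i x_iᵀ` of the whole dataset. -/
noncomputable def empCov {d n : ℕ} (x : Fin n → Vec d) : Mat d :=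
  fun a b => (1 / (n : ℝ)) * ∑ i, x i a * x i b

/-- The sample covariance of the `t`-th batch (`t = 0, 1, …`) of size `B`, made of the samples with
(zero-based) index in `[B t, B (t + 1))`. -/
noncomputable def batchCov {d n : ℕ} (x : Fin n → Vec d) (B t : ℕ) : Mat d :=
  fun a b => (1 / (B : ℝ)) *
    ∑ i ∈ Finset.univ.filter (fun i : Fin n => B * t ≤ i.val ∧ i.val < B * (t + 1)),
      x i a * x i b

/-- One iteration of the truncated power method: `top_r(A u) / ‖top_r(A u)‖`. -/
noncomputable def tpmStep {d r : ℕ} (τ : TopRule d r) (A : Mat d) (u : Vec d) : Vec d :=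
  ‖τ.top (Matrix.toEuclideanLin A u)‖⁻¹ • τ.top (Matrix.toEuclideanLin A u)

/-- The iterates, with batch size `B`, from the restart at the basis vector `e_i`. -/
noncomputable def iterate {d n r : ℕ} (τ : TopRule d r) (x : Fin n → Vec d) (B : ℕ) (i : Fin d) :
    ℕ → Vec d
  | 0 => EuclideanSpace.single i 1
  | t + 1 => tpmStep τ (batchCov x B t) (iterate τ x B i t)

/-- `u` is an output of `RTPM({x_i}, r, T)`: the last iterate of some restart for which the
quadratic form of the sample covariance is largest. -/
def IsRTPMOutput {d n r : ℕ} (τ : TopRule d r) (T : ℕ) (x : Fin n → Vec d) (u : Vec d) : Prop :=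
  ∃ i : Fin d,
    (∀ j : Fin d, quadForm (empCov x) (iterate τ x (n / T) j T) ≤
      quadForm (empCov x) (iterate τ x (n / T) i T)) ∧
    u = iterate τ x (n / T) i T

/-! ### Running time: programs for a real random access machine -/

/-- Index expressions, over registers that hold natural numbers. -/
inductive NatExp where
  | const (c : ℕ)
  | reg (x : ℕ)
  | add (e f : NatExp)
  | sub (e f : NatExp)

/-- Real expressions; `read a i j` is the cell `(i, j)` of the two-dimensional array `a`. -/
inductive RealExp where
  | const (q : ℚ)
  | read (a : ℕ) (i j : NatExp)
  | add (e f : RealExp)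
  | sub (e f : RealExp)
  | mul (e f : RealExp)
  | div (e f : RealExp)
  | sqrt (e : RealExp)

/-- Programs. `loop x e c` runs `c` for `x = 0, 1, …, e - 1`. -/
inductive Cmd where
  | skip
  | setNat (x : ℕ) (e : NatExp)
  | setReal (a : ℕ) (i j : NatExp) (e : RealExp)
  | seq (c₁ c₂ : Cmd)
  | ifNatLt (e f : NatExp) (c₁ c₂ : Cmd)
  | ifRealLt (e f : RealExp) (c₁ c₂ : Cmd)
  | loop (x : ℕ) (e : NatExp) (c : Cmd)

/-- A machine state: the registers, the arrays of reals, and the number of steps made so far. -/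
structure Machine where
  reg : ℕ → ℕ
  mem : ℕ → ℕ → ℕ → ℝ
  steps : ℕ

namespace Machine

/-- Count `c` further steps. -/
def tick (m : Machine) (c : ℕ) : Machine := { m with steps := m.steps + c }

/-- Write a register. -/
def setReg (m : Machine) (x v : ℕ) : Machine :=
  { m with reg := fun y => if y = x then v else m.reg y }

/-- Write a cell of an array. -/
noncomputable def setMem (m : Machine) (a i j : ℕ) (v : ℝ) : Machine :=
  { m with mem := fun a' i' j' => if a' = a ∧ i' = i ∧ j' = j then v else m.mem a' i' j' }

end Machine

/-- Value of an index expression. -/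
def NatExp.eval (m : Machine) : NatExp → ℕ
  | .const c => c
  | .reg x => m.reg x
  | .add e f => e.eval m + f.eval m
  | .sub e f => e.eval m - f.eval m

/-- Cost of an index expression: one step per operation. -/
def NatExp.cost : NatExp → ℕ
  | .const _ => 1
  | .reg _ => 1
  | .add e f => e.cost + f.cost + 1
  | .sub e f => e.cost + f.cost + 1

/-- Value of a real expression. -/
noncomputable def RealExp.eval (m : Machine) : RealExp → ℝ
  | .const q => (q : ℝ)
  | .read a i j => m.mem a (i.eval m) (j.eval m)
  | .add e f => e.eval m + f.eval m
  | .sub e f => e.eval m - f.eval m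
  | .mul e f => e.eval m * f.eval m
  | .div e f => e.eval m / f.eval m
  | .sqrt e => Real.sqrt (e.eval m)

/-- Cost of a real expression: one step per operation (exact real arithmetic at unit cost). -/
def RealExp.cost : RealExp → ℕ
  | .const _ => 1
  | .read _ i j => i.cost + j.cost + 1
  | .add e f => e.cost + f.cost + 1
  | .sub e f => e.cost + f.cost + 1
  | .mul e f => e.cost + f.cost + 1
  | .div e f => e.cost + f.cost + 1
  | .sqrt e => e.cost + 1

open Classical in
/-- Run a program, counting one step for each operation, assignment, test and loop pass. -/
noncomputable def Cmd.exec : Cmd → Machine → Machine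
  | .skip, m => m.tick 1
  | .setNat x e, m => (m.setReg x (e.eval m)).tick (e.cost + 1)
  | .setReal a i j e, m =>
      (m.setMem a (i.eval m) (j.eval m) (e.eval m)).tick (i.cost + j.cost + e.cost + 1)
  | .seq c₁ c₂, m => c₂.exec (c₁.exec m)
  | .ifNatLt e f c₁ c₂, m =>
      if e.eval m < f.eval m then c₁.exec (m.tick (e.cost + f.cost + 1))
      else c₂.exec (m.tick (e.cost + f.cost + 1))
  | .ifRealLt e f c₁ c₂, m =>
      if e.eval m < f.eval m then c₁.exec (m.tick (e.cost + f.cost + 1))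
      else c₂.exec (m.tick (e.cost + f.cost + 1))
  | .loop x e c, m =>
      (List.range (e.eval m)).foldl (fun m' i => c.exec ((m'.setReg x i).tick 1))
        (m.tick (e.cost + 1))

/-- The initial state for the input `({x_i}, r, T)`: registers `0, 1, 2, 3` hold `n, d, r, T`,
row `i` of array `0` holds `x_i`, everything else is zero. -/
noncomputable def initial {d n : ℕ} (r T : ℕ) (x : Fin n → Vec d) : Machine where
  reg := fun y => if y = 0 then n else if y = 1 then d else if y = 2 then r else
    if y = 3 then T else 0
  mem := fun a i j =>
    if h : a = 0 ∧ i < n ∧ j < d then x ⟨i, h.2.1⟩ ⟨j, h.2.2⟩ else 0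
  steps := 0

/-- The output vector in `ℝ^d`: row `0` of array `1`. -/
def output (d : ℕ) (m : Machine) : Vec d := WithLp.toLp 2 (fun j : Fin d => m.mem 1 0 j.val)

end SparsePCA

/-! Choice of subspace. If every λ_i with i ≤ k and λ_i ≥ (1-β)λ₁ were followed by an eigenvalue
above (1-β/k)λ_i, the losses would add up to less than β and give λ_{k+1} > (1-β)λ₁, against λ_{k+1}
≤ (1-γ)λ_k. So some i ≤ k has both λ_i ≥ (1-β)λ₁ and a relative gap g = β/k below it
(`exists_eigval_gap`). The space V of eigenvectors with eigenvalue at least λ_i lies in the top-k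
eigenspace, so its vectors all live on one set S of at most s coordinates, and a unit vector close
to V has a quadratic form close to λ_i or larger.

Convergence. Let P be the projection on V. An exact power step multiplies the tangent ‖u - Pu‖ /
‖Pu‖ by at most 1-g. Truncation does harm only through discarded coordinates in S. Each of them is
dominated by at least r-s kept coordinates outside S, where V contributes nothing, so the loss is at
most about √(s/r) times the part of the product that does not come from V (`truncated_mul_bounds`).
Some basis vector has ‖P e_i‖ ≥ 1/√s, so its restart begins with tangent at most √s. While the
tangent stays below √s, ‖Pu‖ is at least of order 1/√s, and r of order s²/g² makes the loss a small
fraction of g‖Pu‖. The tangent then shrinks by 1-g/2 per step down to √ε/2 (`contraction_of_bounds`,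
`truncated_power_converges`), which takes T of order log(s/ε)/g.

Noise. Batch t is independent of the iterate it multiplies, so for this restart it is enough to
control d coordinates at T fixed vectors. Bernstein's inequality for squares of sub-Gaussian
variables and polarization do this (`IsSubGaussian.measure_iterate_deviation_le`). The error enters
on at most 2r coordinates, hence with a factor √(2r); this produces the term k⁵/(εβ⁵). The final
maximization reuses all the samples and may pick any restart, so it needs concentration uniform over
r-sparse vectors, obtained from a net of at most (3d)^(4r) points
(`IsSubGaussian.measure_exists_sparse_deviation_le`); this produces k²/(ε²β²). The deterministic
conclusion is `exists_start_forall_output_good`.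

Time. No covariance matrix is formed. A product with a batch covariance costs O(Bd) and a selection
by repeated scans O(rd). Over T steps and d restarts, with the scores, this is O((n + Tr + T)d²),
and the sample size forces Tr ≤ n and T ≤ n (`rtpmCmd_exec`). -/

namespace SparsePCA

/-! ### Exponential moments of squares of sub-Gaussian variables, and Bernstein's inequality. -/

section Moments

variable {Ω : Type*} [MeasurableSpace Ω] {μ : Measure Ω} [IsProbabilityMeasure μ] {X : Ω → ℝ} {v : ℝ}

/-- The standard Gaussian density times exp(g²/4) is √2 times the density of N(0, 2); the cruder
factor 2 is enough. -/
lemma lintegral_exp_sq_div_four_gaussianReal :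
    ∫⁻ g : ℝ, ENNReal.ofReal (Real.exp (g ^ 2 / 4)) ∂(gaussianReal 0 1) ≤ 2 := by
  have hpt : ∀ g : ℝ, gaussianPDF 0 1 g * ENNReal.ofReal (Real.exp (g ^ 2 / 4)) ≤
      2 * gaussianPDF 0 2 g := by
    intro g
    rw [gaussianPDF, gaussianPDF, ← ENNReal.ofReal_mul (gaussianPDFReal_nonneg _ _ _),
      show (2 : ENNReal) = ENNReal.ofReal 2 by simp, ← ENNReal.ofReal_mul (by norm_num)]
    apply ENNReal.ofReal_le_ofReal
    simp only [gaussianPDFReal, sub_zero, NNReal.coe_one, mul_one, NNReal.coe_ofNat]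
    rw [mul_assoc, ← Real.exp_add, ← mul_assoc]
    have e1 : -g ^ 2 / 2 + g ^ 2 / 4 = -g ^ 2 / (2 * 2) := by ring
    rw [e1]
    apply mul_le_mul_of_nonneg_right _ (Real.exp_pos _).le
    have h1 : √(2 * Real.pi * 2) ≤ 2 * √(2 * Real.pi) := by
      rw [Real.sqrt_mul (by positivity), mul_comm]
      apply mul_le_mul_of_nonneg_right _ (Real.sqrt_nonneg _)
      rw [Real.sqrt_le_left (by norm_num)]; norm_num
    have h2 : 0 < √(2 * Real.pi) := by positivity
    have h3 : 0 < √(2 * Real.pi * 2) := by positivity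
    rw [← div_eq_mul_inv, inv_eq_one_div, div_le_div_iff₀ h2 h3]
    linarith
  rw [gaussianReal_of_var_ne_zero _ (one_ne_zero),
    lintegral_withDensity_eq_lintegral_mul _ (measurable_gaussianPDF _ _) (by fun_prop)]
  calc ∫⁻ g : ℝ, (gaussianPDF 0 1 * fun g => ENNReal.ofReal (Real.exp (g ^ 2 / 4))) g
      ≤ ∫⁻ g : ℝ, 2 * gaussianPDF 0 2 g := lintegral_mono hpt
    _ = 2 := by
      rw [lintegral_const_mul _ (measurable_gaussianPDF _ _),
        lintegral_gaussianPDF_eq_one _ two_ne_zero, mul_one]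

/-- An auxiliary standard Gaussian g linearizes the square: exp(X²/(4v)) is the mean over g of
exp(Xg/√(2v)). After exchanging the integrals, the sub-Gaussian bound leaves the Gaussian mean of
exp(g²/4). -/
lemma lintegral_exp_sq_le (hX : Measurable X) (hv : 0 < v)
    (hint : ∀ t : ℝ, Integrable (fun ω => Real.exp (t * X ω)) μ)
    (hle : ∀ t : ℝ, ∫ ω, Real.exp (t * X ω) ∂μ ≤ Real.exp (v * t ^ 2 / 2)) :
    ∫⁻ ω, ENNReal.ofReal (Real.exp (X ω ^ 2 / (4 * v))) ∂μ ≤ 2 := by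
  have hs : 0 < √(2 * v) := by positivity
  have hss : √(2 * v) ^ 2 = 2 * v := Real.sq_sqrt (by positivity)
  have key : ∀ ω, ENNReal.ofReal (Real.exp (X ω ^ 2 / (4 * v))) =
      ∫⁻ g : ℝ, ENNReal.ofReal (Real.exp (X ω / √(2 * v) * g)) ∂(gaussianReal 0 1) := by
    intro ω
    have h := congrFun (mgf_id_gaussianReal (μ := 0) (v := 1)) (X ω / √(2 * v))
    rw [← ofReal_integral_eq_lintegral_ofReal (integrable_exp_mul_gaussianReal _)
      (Filter.Eventually.of_forall fun _ => (Real.exp_pos _).le)]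
    simp only [mgf, id] at h
    rw [h, div_pow, hss]
    congr 2
    simp only [NNReal.coe_one]
    field_simp
    ring
  simp_rw [key]
  rw [lintegral_lintegral_swap (by apply Measurable.aemeasurable; fun_prop)]
  refine le_trans (lintegral_mono fun g => ?_) lintegral_exp_sq_div_four_gaussianReal
  have e : ∀ ω, X ω / √(2 * v) * g = g / √(2 * v) * X ω := fun ω => by ring
  simp_rw [e]
  rw [← ofReal_integral_eq_lintegral_ofReal (hint _)
    (Filter.Eventually.of_forall fun _ => (Real.exp_pos _).le)]
  apply ENNReal.ofReal_le_ofReal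
  refine (hle _).trans (le_of_eq ?_)
  rw [div_pow, hss]
  congr 1
  field_simp
  ring

lemma integrable_exp_sq (hX : Measurable X) (hv : 0 < v)
    (hint : ∀ t : ℝ, Integrable (fun ω => Real.exp (t * X ω)) μ)
    (hle : ∀ t : ℝ, ∫ ω, Real.exp (t * X ω) ∂μ ≤ Real.exp (v * t ^ 2 / 2)) :
    Integrable (fun ω => Real.exp (X ω ^ 2 / (4 * v))) μ ∧
      ∫ ω, Real.exp (X ω ^ 2 / (4 * v)) ∂μ ≤ 2 := by
  have h := lintegral_exp_sq_le hX hv hint hle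
  have hi : Integrable (fun ω => Real.exp (X ω ^ 2 / (4 * v))) μ := by
    refine ⟨by apply Measurable.aestronglyMeasurable; fun_prop, ?_⟩
    rw [hasFiniteIntegral_iff_ofReal (Filter.Eventually.of_forall fun _ => (Real.exp_pos _).le)]
    exact lt_of_le_of_lt h (by simp)
  refine ⟨hi, ?_⟩
  rw [← ofReal_integral_eq_lintegral_ofReal hi
    (Filter.Eventually.of_forall fun _ => (Real.exp_pos _).le),
    show (2 : ENNReal) = ENNReal.ofReal 2 by simp] at h
  exact (ENNReal.ofReal_le_ofReal_iff (by norm_num)).1 h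

lemma exp_le_one_add_add_sq_mul_exp_abs (y : ℝ) :
    Real.exp y ≤ 1 + y + y ^ 2 * Real.exp |y| := by
  have h := Complex.norm_exp_sub_sum_le_norm_mul_exp (y : ℂ) 2
  simp only [Finset.sum_range_succ, Finset.sum_range_zero, pow_zero, Nat.factorial,
    Complex.norm_real, Real.norm_eq_abs, sq_abs] at h
  have e : Complex.exp (y : ℂ) - (0 + 1 / ((1 : ℕ) : ℂ) + (y : ℂ) ^ 1 / ((0 + 1) * 1 : ℕ)) =
      ((Real.exp y - (1 + y) : ℝ) : ℂ) := by push_cast; simp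
  rw [e, Complex.norm_real, Real.norm_eq_abs] at h
  linarith [le_abs_self (Real.exp y - (1 + y))]

lemma integrable_sq_of_subgaussian (hX : Measurable X) (hv : 0 < v)
    (hint : ∀ t : ℝ, Integrable (fun ω => Real.exp (t * X ω)) μ)
    (hle : ∀ t : ℝ, ∫ ω, Real.exp (t * X ω) ∂μ ≤ Real.exp (v * t ^ 2 / 2)) :
    Integrable (fun ω => X ω ^ 2) μ ∧ ∫ ω, X ω ^ 2 ∂μ ≤ 8 * v := by
  obtain ⟨hi, hb⟩ := integrable_exp_sq hX hv hint hle
  have hpt : ∀ ω, X ω ^ 2 ≤ 4 * v * Real.exp (X ω ^ 2 / (4 * v)) := by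
    intro ω
    have := Real.add_one_le_exp (X ω ^ 2 / (4 * v))
    have h2 : X ω ^ 2 / (4 * v) ≤ Real.exp (X ω ^ 2 / (4 * v)) := by linarith
    rw [div_le_iff₀ (by positivity)] at h2
    linarith
  have hi2 : Integrable (fun ω => X ω ^ 2) μ := by
    refine (hi.const_mul (4 * v)).mono' (by apply Measurable.aestronglyMeasurable; fun_prop) ?_
    exact Filter.Eventually.of_forall fun ω => by
      rw [Real.norm_of_nonneg (sq_nonneg _)]; exact hpt ω
  refine ⟨hi2, (integral_mono hi2 (hi.const_mul _) hpt).trans ?_⟩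
  rw [integral_const_mul]
  nlinarith

/-- The square of a sub-Gaussian variable is sub-exponential. -/
lemma integral_exp_mul_sq_le (hX : Measurable X) (hv : 0 < v)
    (hint : ∀ t : ℝ, Integrable (fun ω => Real.exp (t * X ω)) μ)
    (hle : ∀ t : ℝ, ∫ ω, Real.exp (t * X ω) ∂μ ≤ Real.exp (v * t ^ 2 / 2))
    {θ : ℝ} (hθ : |θ| ≤ 1 / (8 * v)) :
    Integrable (fun ω => Real.exp (θ * X ω ^ 2)) μ ∧
      ∫ ω, Real.exp (θ * X ω ^ 2) ∂μ ≤ Real.exp (θ * ∫ ω, X ω ^ 2 ∂μ + 256 * θ ^ 2 * v ^ 2) := by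
  obtain ⟨hi, hb⟩ := integrable_exp_sq hX hv hint hle
  obtain ⟨hi2, -⟩ := integrable_sq_of_subgaussian hX hv hint hle
  have hpt : ∀ ω, Real.exp (θ * X ω ^ 2) ≤
      1 + θ * X ω ^ 2 + 128 * θ ^ 2 * v ^ 2 * Real.exp (X ω ^ 2 / (4 * v)) := by
    intro ω
    -- exp(X²/(4v)) is the product of two factors exp z: one bounds the exponential in the Taylor
    -- remainder, the other its squared prefactor.
    set z := X ω ^ 2 / (8 * v) with hz
    have hz0 : 0 ≤ z := by positivity
    have hXz : X ω ^ 2 = 8 * v * z := by rw [hz]; field_simp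
    have h1 := exp_le_one_add_add_sq_mul_exp_abs (θ * X ω ^ 2)
    have h2 : |θ * X ω ^ 2| ≤ z := by
      rw [abs_mul, abs_of_nonneg (sq_nonneg (X ω)), hz, div_eq_inv_mul, ← one_div]
      exact mul_le_mul_of_nonneg_right hθ (sq_nonneg _)
    have h3 : Real.exp |θ * X ω ^ 2| ≤ Real.exp z := Real.exp_le_exp.2 h2
    have h4 : z ^ 2 ≤ 2 * Real.exp z := by
      linarith [Real.quadratic_le_exp_of_nonneg hz0]
    have h5 : Real.exp (X ω ^ 2 / (4 * v)) = Real.exp z * Real.exp z := by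
      rw [← Real.exp_add, hz]; congr 1; field_simp; ring
    have h6 : (θ * X ω ^ 2) ^ 2 * Real.exp |θ * X ω ^ 2| ≤
        128 * θ ^ 2 * v ^ 2 * (Real.exp z * Real.exp z) := by
      calc (θ * X ω ^ 2) ^ 2 * Real.exp |θ * X ω ^ 2| ≤ (θ * X ω ^ 2) ^ 2 * Real.exp z :=
            mul_le_mul_of_nonneg_left h3 (sq_nonneg _)
        _ = 64 * θ ^ 2 * v ^ 2 * Real.exp z * z ^ 2 := by rw [hXz]; ring
        _ ≤ 64 * θ ^ 2 * v ^ 2 * Real.exp z * (2 * Real.exp z) :=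
            mul_le_mul_of_nonneg_left h4 (by positivity)
        _ = _ := by ring
    rw [h5]; linarith
  have hi3 : Integrable (fun ω => 1 + θ * X ω ^ 2 +
      128 * θ ^ 2 * v ^ 2 * Real.exp (X ω ^ 2 / (4 * v))) μ :=
    ((integrable_const _).add (hi2.const_mul _)).add (hi.const_mul _)
  have hi4 : Integrable (fun ω => Real.exp (θ * X ω ^ 2)) μ := by
    refine hi3.mono' (by apply Measurable.aestronglyMeasurable; fun_prop) ?_
    exact Filter.Eventually.of_forall fun ω => by
      rw [Real.norm_of_nonneg (Real.exp_pos _).le]; exact hpt ω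
  refine ⟨hi4, (integral_mono hi4 hi3 hpt).trans ?_⟩
  have hi5 : Integrable (fun ω => 1 + θ * X ω ^ 2) μ := (integrable_const _).add (hi2.const_mul _)
  rw [integral_add hi5 (hi.const_mul _),
    integral_add (integrable_const _) (hi2.const_mul _), integral_const_mul, integral_const_mul]
  simp only [integral_const, probReal_univ, smul_eq_mul, mul_one]
  have := Real.add_one_le_exp (θ * ∫ ω, X ω ^ 2 ∂μ + 256 * θ ^ 2 * v ^ 2)
  have h7 : 128 * θ ^ 2 * v ^ 2 * ∫ ω, Real.exp (X ω ^ 2 / (4 * v)) ∂μ ≤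
      128 * θ ^ 2 * v ^ 2 * 2 := mul_le_mul_of_nonneg_left hb (by positivity)
  linarith

/-- The moment generating function and its upper bound both equal 1 at t = 0, so their difference
has a minimum there. Its derivative vanishes, and this derivative is minus the mean. -/
lemma integral_eq_zero_of_subgaussian
    (hint : ∀ t : ℝ, Integrable (fun ω => Real.exp (t * X ω)) μ)
    (hle : ∀ t : ℝ, ∫ ω, Real.exp (t * X ω) ∂μ ≤ Real.exp (v * t ^ 2 / 2)) :
    ∫ ω, X ω ∂μ = 0 := by
  have hset : integrableExpSet X μ = Set.univ := by
    ext t; simpa [integrableExpSet] using hint t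
  have h1 : HasDerivAt (mgf X μ) (∫ ω, X ω ∂μ) 0 := by
    have := hasDerivAt_mgf (X := X) (μ := μ) (t := 0) (by simp [hset])
    simpa using this
  have h2 : HasDerivAt (fun t : ℝ => Real.exp (v * t ^ 2 / 2)) 0 0 := by
    have h := (((hasDerivAt_pow 2 (0 : ℝ)).const_mul v).div_const 2).exp
    simpa using h
  have h3 := h2.sub h1
  have h4 : IsLocalMin ((fun t : ℝ => Real.exp (v * t ^ 2 / 2)) - mgf X μ) 0 := by
    apply Filter.Eventually.of_forall
    intro t
    simp only [Pi.sub_apply]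
    have e0 : mgf X μ 0 = 1 := by simp
    rw [e0]
    have : mgf X μ t ≤ Real.exp (v * t ^ 2 / 2) := hle t
    simp
    linarith
  have := h4.hasDerivAt_eq_zero h3
  linarith

/-- Bernstein's inequality for the squares of independent copies of a sub-Gaussian variable. -/
lemma measure_pi_sum_sq_deviation_le {ι : Type*} [Fintype ι] [DecidableEq ι]
    (hX : Measurable X) (hv : 0 < v)
    (hint : ∀ t : ℝ, Integrable (fun ω => Real.exp (t * X ω)) μ)
    (hle : ∀ t : ℝ, ∫ ω, Real.exp (t * X ω) ∂μ ≤ Real.exp (v * t ^ 2 / 2))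
    (S : Finset ι) {τ : ℝ} (hτ : 0 < τ) (hτ1 : τ ≤ 1) :
    (Measure.pi fun _ : ι => μ) {x | (S.card : ℝ) * (τ * v) <
        |∑ i ∈ S, X (x i) ^ 2 - (S.card : ℝ) * ∫ ω, X ω ^ 2 ∂μ|} ≤
      ENNReal.ofReal (2 * Real.exp (-(S.card * τ ^ 2 / 1024))) := by
  set m := ∫ ω, X ω ^ 2 ∂μ with hm
  set N : ℝ := (S.card : ℝ) with hN
  set Z : (ι → Ω) → ℝ := fun x => ∑ i ∈ S, X (x i) ^ 2 with hZ
  have key : ∀ θ : ℝ, |θ| ≤ 1 / (8 * v) →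
      Integrable (fun x => Real.exp (θ * Z x)) (Measure.pi fun _ : ι => μ) ∧
      mgf Z (Measure.pi fun _ : ι => μ) θ ≤ Real.exp (N * (θ * m + 256 * θ ^ 2 * v ^ 2)) := by
    intro θ hθ
    obtain ⟨h1, h2⟩ := integral_exp_mul_sq_le hX hv hint hle hθ
    have e : ∀ x : ι → Ω, Real.exp (θ * Z x) =
        ∏ i, (if i ∈ S then Real.exp (θ * X (x i) ^ 2) else 1) := by
      intro x
      rw [hZ, Finset.mul_sum, Real.exp_sum, Finset.prod_ite_mem, Finset.univ_inter]
    constructor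
    · simp_rw [e]
      refine Integrable.fintype_prod (f := fun i ω => if i ∈ S then Real.exp (θ * X ω ^ 2) else 1) ?_
      intro i
      by_cases hi : i ∈ S
      · simpa [hi] using h1
      · simp [hi]
    · rw [mgf]
      simp_rw [e]
      rw [integral_fintype_prod_eq_prod
        (f := fun i ω => if i ∈ S then Real.exp (θ * X ω ^ 2) else 1)]
      have e2 : ∀ i, (∫ ω, (if i ∈ S then Real.exp (θ * X ω ^ 2) else 1) ∂μ) =
          if i ∈ S then ∫ ω, Real.exp (θ * X ω ^ 2) ∂μ else 1 := by
        intro i; split_ifs <;> simp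
      simp_rw [e2]
      rw [Finset.prod_ite_mem, Finset.univ_inter, Finset.prod_const, Real.exp_nat_mul]
      exact pow_le_pow_left₀ (integral_nonneg fun _ => (Real.exp_pos _).le) h2 _
  -- The minimizer of 256θ²v² - θvτ, with value -τ²/1024; τ ≤ 1 keeps it in the range where the
  -- exponential moment is controlled.
  set θ := τ / (512 * v) with hθ
  have hθ0 : 0 < θ := by positivity
  have hθ1 : |θ| ≤ 1 / (8 * v) := by
    rw [abs_of_pos hθ0, hθ, div_le_div_iff₀ (by positivity) (by positivity)]
    nlinarith
  have hθv : θ * v = τ / 512 := by rw [hθ]; field_simp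
  obtain ⟨a1, a2⟩ := key θ hθ1
  obtain ⟨b1, b2⟩ := key (-θ) (by rwa [abs_neg])
  have hup := (measure_ge_le_exp_mul_mgf (N * m + N * (τ * v)) hθ0.le a1).trans
    (mul_le_mul_of_nonneg_left a2 (Real.exp_pos _).le)
  have hlo := (measure_le_le_exp_mul_mgf (N * m - N * (τ * v)) (neg_nonpos.2 hθ0.le) b1).trans
    (mul_le_mul_of_nonneg_left b2 (Real.exp_pos _).le)
  rw [← Real.exp_add] at hup hlo
  have q1 : 256 * θ ^ 2 * v ^ 2 - θ * v * τ = -(τ ^ 2 / 1024) := by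
    have : θ ^ 2 * v ^ 2 = (τ / 512) ^ 2 := by rw [← hθv]; ring
    rw [mul_assoc, this, hθv]; ring
  have e1 : -θ * (N * m + N * (τ * v)) + N * (θ * m + 256 * θ ^ 2 * v ^ 2) =
      -(N * τ ^ 2 / 1024) := by linear_combination N * q1
  have e2 : - -θ * (N * m - N * (τ * v)) + N * (-θ * m + 256 * (-θ) ^ 2 * v ^ 2) =
      -(N * τ ^ 2 / 1024) := by linear_combination N * q1
  rw [e1] at hup
  rw [e2] at hlo
  have hsub : {x : ι → Ω | N * (τ * v) < |Z x - N * m|} ⊆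
      {x | N * m + N * (τ * v) ≤ Z x} ∪ {x | Z x ≤ N * m - N * (τ * v)} := by
    intro x hx
    simp only [Set.mem_ofPred_eq, Set.mem_union, lt_abs] at hx ⊢
    rcases hx with h | h
    · left; linarith
    · right; linarith
  refine (measure_mono hsub).trans ((measure_union_le _ _).trans ?_)
  rw [two_mul, ENNReal.ofReal_add (Real.exp_pos _).le (Real.exp_pos _).le]
  refine add_le_add ?_ ?_
  · rw [← ofReal_measureReal]; exact ENNReal.ofReal_le_ofReal hup
  · rw [← ofReal_measureReal]; exact ENNReal.ofReal_le_ofReal hlo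

end Moments

/-! ### Resampling some coordinates of a product measure, as a substitute for conditioning. -/

section Resampling

variable {ι Ω : Type*} [Fintype ι] [DecidableEq ι] [MeasurableSpace Ω] (μ : Measure Ω)
  [IsProbabilityMeasure μ]

/-- Resampling the coordinates in `S` preserves a product measure. -/
lemma measurePreserving_piecewise (S : Finset ι) :
    MeasurePreserving (fun p : (ι → Ω) × (ι → Ω) => fun i => if i ∈ S then p.2 i else p.1 i)
      ((Measure.pi fun _ : ι => μ).prod (Measure.pi fun _ : ι => μ))
      (Measure.pi fun _ : ι => μ) := by
  have hmeas : Measurable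
      (fun p : (ι → Ω) × (ι → Ω) => fun i => if i ∈ S then p.2 i else p.1 i) := by
    refine measurable_pi_lambda _ fun i => ?_
    by_cases hi : i ∈ S <;> simp only [hi, if_true, if_false] <;> fun_prop
  refine ⟨hmeas, (Measure.pi_eq fun s hs => ?_).symm⟩
  rw [Measure.map_apply hmeas (MeasurableSet.univ_pi hs)]
  -- Boxes determine a product measure. The preimage of a box is a product of two boxes, with each
  -- coordinate constrained in exactly one of them.
  have : (fun p : (ι → Ω) × (ι → Ω) => fun i => if i ∈ S then p.2 i else p.1 i) ⁻¹'
      (Set.univ.pi s) = (Set.univ.pi fun i => if i ∈ S then Set.univ else s i) ×ˢ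
        (Set.univ.pi fun i => if i ∈ S then s i else Set.univ) := by
    ext p
    simp only [Set.mem_preimage, Set.mem_univ_pi, Set.mem_prod]
    constructor
    · intro h
      constructor <;> intro i <;> have := h i <;> by_cases hi : i ∈ S <;> simp_all
    · rintro ⟨h1, h2⟩ i
      have := h1 i; have := h2 i
      by_cases hi : i ∈ S <;> simp_all
  rw [this, Measure.prod_prod, Measure.pi_pi, Measure.pi_pi, ← Finset.prod_mul_distrib]
  refine Finset.prod_congr rfl fun i _ => ?_
  by_cases hi : i ∈ S <;> simp [hi]

/-- An event which has probability at most `p` after resampling the coordinates in `S`, whatever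
the others are, has probability at most `p`. -/
lemma measure_pi_le_of_resample (S : Finset ι) {A : Set (ι → Ω)} (hA : MeasurableSet A)
    {p : ENNReal} (h : ∀ x : ι → Ω, (Measure.pi fun _ : ι => μ)
      {y | (fun i => if i ∈ S then y i else x i) ∈ A} ≤ p) :
    (Measure.pi fun _ : ι => μ) A ≤ p := by
  have hp := measurePreserving_piecewise μ S
  rw [← hp.measure_preimage hA.nullMeasurableSet, Measure.prod_apply (hp.measurable hA)]
  calc _ ≤ ∫⁻ _ : ι → Ω, p ∂(Measure.pi fun _ : ι => μ) := lintegral_mono fun x => h x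
    _ = p := by simp

end Resampling

/-! ### Concentration of empirical quadratic forms and of products with a fixed vector. -/

section Samples

variable {d : ℕ} {σ : ℝ} {D : Measure (Vec d)} {M : Mat d}

lemma IsSubGaussian.integrable_exp_mul (h : IsSubGaussian σ D) (a : Vec d) (t : ℝ) :
    Integrable (fun x => Real.exp (t * inner ℝ a x)) D := by
  simpa [inner_smul_left] using (h (t • a)).1

/-- A bound ρ stands in for ‖a‖ so that the variance proxy σ²ρ² stays positive when a = 0, which
happens for the differences used in polarization. -/
lemma IsSubGaussian.integral_exp_mul_le (h : IsSubGaussian σ D) {a : Vec d} {ρ : ℝ}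
    (ha : ‖a‖ ≤ ρ) (t : ℝ) :
    ∫ x, Real.exp (t * inner ℝ a x) ∂D ≤ Real.exp (σ ^ 2 * ρ ^ 2 * t ^ 2 / 2) := by
  have h1 := (h (t • a)).2
  simp only [inner_smul_left, RCLike.conj_to_real, norm_smul, mul_pow, Real.norm_eq_abs,
    sq_abs] at h1
  refine h1.trans (Real.exp_le_exp.2 ?_)
  have : ‖a‖ ^ 2 ≤ ρ ^ 2 := pow_le_pow_left₀ (norm_nonneg _) ha 2
  have h2 : 1 / 2 * σ ^ 2 * t ^ 2 * ‖a‖ ^ 2 ≤ 1 / 2 * σ ^ 2 * t ^ 2 * ρ ^ 2 :=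
    mul_le_mul_of_nonneg_left this (by positivity)
  linarith

variable [IsProbabilityMeasure D]

lemma measurable_inner_right_vec (a : Vec d) : Measurable (fun x : Vec d => (inner ℝ a x : ℝ)) :=
  (continuous_const.inner continuous_id).measurable

lemma inner_vec_eq_sum (a x : Vec d) : (inner ℝ a x : ℝ) = ∑ i, a i * x i := by
  simp [PiLp.inner_apply, mul_comm]

lemma inner_single_one_vec (j : Fin d) (x : Vec d) :
    (inner ℝ (EuclideanSpace.single j (1 : ℝ)) x : ℝ) = x j := by
  simp [EuclideanSpace.inner_single_left]

/-- The sub-Gaussian bound forces mean zero, so covariances are second moments, which is what the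
uncentred averages of the algorithm estimate. -/
lemma IsSubGaussian.integral_mul_eq (h : IsSubGaussian σ D) (hσ : 0 < σ) (hM : HasCovariance D M)
    (i j : Fin d) : Integrable (fun x : Vec d => x i * x j) D ∧ ∫ x, x i * x j ∂D = M i j := by
  have hsq : ∀ a : Vec d, ‖a‖ ≤ 2 → Integrable (fun x : Vec d => (inner ℝ a x : ℝ) ^ 2) D :=
    fun a ha => (integrable_sq_of_subgaussian (measurable_inner_right_vec a)
      (v := σ ^ 2 * 2 ^ 2) (by positivity) (h.integrable_exp_mul a) (h.integral_exp_mul_le ha)).1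
  have hcoord : ∀ i : Fin d, MemLp (fun x : Vec d => x i) 2 D ∧ ∫ x : Vec d, x i ∂D = 0 := by
    intro i
    have hn : ‖(EuclideanSpace.single i (1 : ℝ) : Vec d)‖ ≤ 2 := by simp
    have h1 := hsq _ hn
    have h2 := integral_eq_zero_of_subgaussian (h.integrable_exp_mul _) (h.integral_exp_mul_le hn)
    simp only [inner_single_one_vec] at h1 h2
    refine ⟨?_, h2⟩
    have hm := measurable_inner_right_vec (EuclideanSpace.single i (1 : ℝ))
    simp only [inner_single_one_vec] at hm
    exact (memLp_two_iff_integrable_sq hm.aestronglyMeasurable).2 h1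
  refine ⟨(hcoord i).1.integrable_mul (hcoord j).1, ?_⟩
  have h3 := hM i j
  rw [covariance_eq_sub (hcoord i).1 (hcoord j).1, (hcoord i).2, (hcoord j).2] at h3
  simpa using h3

lemma IsSubGaussian.integral_inner_sq (h : IsSubGaussian σ D) (hσ : 0 < σ)
    (hM : HasCovariance D M) (a : Vec d) : ∫ x, (inner ℝ a x : ℝ) ^ 2 ∂D = quadForm M a := by
  have e : ∀ x : Vec d, (inner ℝ a x : ℝ) ^ 2 = ∑ i, ∑ j, a i * a j * (x i * x j) := by
    intro x
    rw [inner_vec_eq_sum, sq, Finset.sum_mul_sum]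
    exact Finset.sum_congr rfl fun i _ => Finset.sum_congr rfl fun j _ => by ring
  have hi := h.integral_mul_eq hσ hM
  simp_rw [e]
  rw [integral_finsetSum _ fun i _ => integrable_finsetSum _ fun j _ => (hi i j).1.const_mul _]
  refine Finset.sum_congr rfl fun i _ => ?_
  rw [integral_finsetSum _ fun j _ => (hi i j).1.const_mul _]
  refine Finset.sum_congr rfl fun j _ => ?_
  rw [integral_const_mul, (hi i j).2]; ring

/-- Variances of a sub-Gaussian law are at most of the order of `σ²`. -/
lemma IsSubGaussian.quadForm_le (h : IsSubGaussian σ D) (hσ : 0 < σ)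
    (hM : HasCovariance D M) {a : Vec d} (ha : ‖a‖ ≤ 1) : quadForm M a ≤ 8 * σ ^ 2 := by
  rw [← h.integral_inner_sq hσ hM]
  have := (integrable_sq_of_subgaussian (measurable_inner_right_vec a)
      (v := σ ^ 2 * 1 ^ 2) (by positivity) (h.integrable_exp_mul a) (h.integral_exp_mul_le ha)).2
  simpa using this

variable {ι : Type*} [Fintype ι] [DecidableEq ι]

lemma IsSubGaussian.measure_quadForm_deviation_le (h : IsSubGaussian σ D) (hσ : 0 < σ)
    (hM : HasCovariance D M) {a : Vec d} {ρ : ℝ} (hρ : 0 < ρ) (ha : ‖a‖ ≤ ρ) (S : Finset ι)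
    {τ : ℝ} (hτ : 0 < τ) (hτ1 : τ ≤ 1) :
    (Measure.pi fun _ : ι => D) {x | (S.card : ℝ) * (τ * (σ ^ 2 * ρ ^ 2)) <
        |∑ i ∈ S, (inner ℝ a (x i) : ℝ) ^ 2 - (S.card : ℝ) * quadForm M a|} ≤
      ENNReal.ofReal (2 * Real.exp (-(S.card * τ ^ 2 / 1024))) := by
  rw [← h.integral_inner_sq hσ hM a]
  exact measure_pi_sum_sq_deviation_le (measurable_inner_right_vec a) (by positivity)
    (h.integrable_exp_mul a) (h.integral_exp_mul_le ha) S hτ hτ1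

lemma toEuclideanLin_apply_coord (A : Mat d) (u : Vec d) (j : Fin d) :
    Matrix.toEuclideanLin A u j = ∑ i, A j i * u i := by
  simp [Matrix.toLpLin_apply, Matrix.mulVec, dotProduct]

lemma quadForm_eq_inner (A : Mat d) (u : Vec d) :
    quadForm A u = inner ℝ u (Matrix.toEuclideanLin A u) := by
  rw [inner_vec_eq_sum, quadForm]
  refine Finset.sum_congr rfl fun i _ => ?_
  rw [toEuclideanLin_apply_coord, Finset.mul_sum]
  exact Finset.sum_congr rfl fun j _ => by ring

lemma inner_toEuclideanLin_comm {A : Mat d} (hA : A.IsHermitian) (u w : Vec d) :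
    (inner ℝ u (Matrix.toEuclideanLin A w) : ℝ) = inner ℝ w (Matrix.toEuclideanLin A u) := by
  have h := (Matrix.isSymmetric_toEuclideanLin_iff.2 hA) u w
  rw [← h, real_inner_comm]

lemma quadForm_add_sub_quadForm_sub {A : Mat d} (hA : A.IsHermitian) (u w : Vec d) :
    quadForm A (u + w) - quadForm A (u - w) = 4 * inner ℝ w (Matrix.toEuclideanLin A u) := by
  simp only [quadForm_eq_inner, map_add, map_sub, inner_add_left, inner_add_right, inner_sub_left,
    inner_sub_right, inner_toEuclideanLin_comm hA u w]
  ring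

/-- For a fixed `u`, every coordinate of the empirical version of `M u` concentrates. -/
lemma IsSubGaussian.measure_coord_deviation_le (h : IsSubGaussian σ D) (hσ : 0 < σ)
    (hM : HasCovariance D M) (hMs : M.IsHermitian) {u : Vec d} (hu : ‖u‖ ≤ 1) (j : Fin d)
    (S : Finset ι) {τ : ℝ} (hτ : 0 < τ) (hτ1 : τ ≤ 1) :
    (Measure.pi fun _ : ι => D) {x | (S.card : ℝ) * (2 * τ * σ ^ 2) <
        |∑ i ∈ S, (inner ℝ u (x i) : ℝ) * x i j -
          (S.card : ℝ) * Matrix.toEuclideanLin M u j|} ≤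
      ENNReal.ofReal (4 * Real.exp (-(S.card * τ ^ 2 / 1024))) := by
  -- Polarization with u + e and u - e, both of norm at most 2. Each form deviates by at most 4τσ²
  -- per sample, and a quarter of the difference by at most 2τσ².
  set e : Vec d := EuclideanSpace.single j (1 : ℝ) with he
  have hen : ‖e‖ = 1 := by simp [he]
  have h1 := h.measure_quadForm_deviation_le hσ hM (a := u + e) (ρ := 2) two_pos
    ((norm_add_le _ _).trans (by linarith)) S hτ hτ1
  have h2 := h.measure_quadForm_deviation_le hσ hM (a := u - e) (ρ := 2) two_pos
    ((norm_sub_le _ _).trans (by linarith)) S hτ hτ1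
  have hM4 := quadForm_add_sub_quadForm_sub hMs u e
  rw [inner_single_one_vec] at hM4
  have hsub : {x : ι → Vec d | (S.card : ℝ) * (2 * τ * σ ^ 2) <
        |∑ i ∈ S, (inner ℝ u (x i) : ℝ) * x i j -
          (S.card : ℝ) * Matrix.toEuclideanLin M u j|} ⊆
      {x | (S.card : ℝ) * (τ * (σ ^ 2 * 2 ^ 2)) <
        |∑ i ∈ S, (inner ℝ (u + e) (x i) : ℝ) ^ 2 - (S.card : ℝ) * quadForm M (u + e)|} ∪
      {x | (S.card : ℝ) * (τ * (σ ^ 2 * 2 ^ 2)) <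
        |∑ i ∈ S, (inner ℝ (u - e) (x i) : ℝ) ^ 2 - (S.card : ℝ) * quadForm M (u - e)|} := by
    intro x hx
    by_contra hcon
    simp only [Set.mem_union, Set.mem_ofPred_eq, not_or, not_lt] at hcon hx
    obtain ⟨c1, c2⟩ := hcon
    have hs : ∑ i ∈ S, (inner ℝ u (x i) : ℝ) * x i j = 1 / 4 *
        (∑ i ∈ S, (inner ℝ (u + e) (x i) : ℝ) ^ 2 - ∑ i ∈ S, (inner ℝ (u - e) (x i) : ℝ) ^ 2) := by
      rw [← Finset.sum_sub_distrib, Finset.mul_sum]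
      refine Finset.sum_congr rfl fun i _ => ?_
      rw [inner_add_left, inner_sub_left, inner_single_one_vec]; ring
    rw [hs] at hx
    rw [abs_le] at c1 c2
    rw [lt_abs] at hx
    have hq : (S.card : ℝ) * Matrix.toEuclideanLin M u j =
        1 / 4 * (S.card * quadForm M (u + e) - S.card * quadForm M (u - e)) := by
      rw [← mul_sub, hM4]; ring
    rw [hq] at hx
    rcases hx with hx | hx <;> linarith [c1.1, c1.2, c2.1, c2.2]
  refine (measure_mono hsub).trans ((measure_union_le _ _).trans ((add_le_add h1 h2).trans ?_))
  rw [← ENNReal.ofReal_add (by positivity) (by positivity)]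
  exact ENNReal.ofReal_le_ofReal (by linarith)

end Samples

/-! ### Measurability of the iterates and their independence of the next batch. -/

section Iterates

variable {d n r : ℕ}

lemma TopRule.top_apply (τ : TopRule d r) (v : Vec d) (j : Fin d) :
    τ.top v j = if j ∈ τ.select v then v j else 0 := rfl

lemma measurable_vec_iff {α : Type*} [MeasurableSpace α] {f : α → Vec d} :
    Measurable f ↔ ∀ j, Measurable fun a => f a j := by
  constructor
  · intro hf j
    have := (measurable_inner_right_vec (EuclideanSpace.single j (1 : ℝ))).comp hf
    simpa only [Function.comp_def, inner_single_one_vec] using this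
  · intro hf
    exact (WithLp.measurable_toLp 2 _).comp (measurable_pi_lambda _ hf)

lemma measurable_vec_coord (j : Fin d) : Measurable fun v : Vec d => v j :=
  measurable_vec_iff.1 measurable_id j

lemma TopRule.measurable_top (τ : TopRule d r) : Measurable τ.top := by
  rw [measurable_vec_iff]
  intro j
  simp only [TopRule.top_apply]
  refine Measurable.ite ?_ (measurable_vec_coord j) measurable_const
  have : {v | j ∈ τ.select v} = ⋃ S ∈ {S : Finset (Fin d) | j ∈ S}, {v | τ.select v = S} := by
    ext v; simp
  rw [this]
  exact MeasurableSet.biUnion (Set.to_countable _) fun S _ => τ.measurable_select S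

lemma measurable_batchCov (B t : ℕ) (a b : Fin d) :
    Measurable fun x : Fin n → Vec d => batchCov x B t a b := by
  unfold batchCov
  have hx : ∀ (i : Fin n) (a : Fin d), Measurable fun x : Fin n → Vec d => x i a :=
    fun i a => (measurable_vec_coord a).comp (measurable_pi_apply i)
  exact measurable_const.mul (Finset.measurable_sum _ fun i _ => (hx i a).mul (hx i b))

lemma measurable_iterate (τ : TopRule d r) (B : ℕ) (i : Fin d) (t : ℕ) :
    Measurable fun x : Fin n → Vec d => iterate τ x B i t := by
  induction t with
  | zero => exact measurable_const
  | succ t ih =>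
    have h1 : Measurable fun x : Fin n → Vec d =>
        Matrix.toEuclideanLin (batchCov x B t) (iterate τ x B i t) := by
      rw [measurable_vec_iff]
      intro j
      simp only [toEuclideanLin_apply_coord]
      exact Finset.measurable_sum _ fun b _ =>
        (measurable_batchCov B t j b).mul (measurable_vec_iff.1 ih b)
    have h2 := τ.measurable_top.comp h1
    exact h2.norm.inv.smul h2

/-- The t-th iterate uses only the batches before the t-th one; this is what makes it independent of
the batch that multiplies it. -/
lemma iterate_congr (τ : TopRule d r) {x y : Fin n → Vec d} (B : ℕ) (i : Fin d) (t : ℕ)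
    (h : ∀ l : Fin n, l.val < B * t → x l = y l) : iterate τ x B i t = iterate τ y B i t := by
  induction t with
  | zero => rfl
  | succ t ih =>
    have h1 := ih fun l hl => h l (lt_of_lt_of_le hl (Nat.mul_le_mul_left _ (Nat.le_succ t)))
    have h2 : batchCov x B t = batchCov y B t := by
      ext a b
      unfold batchCov
      congr 1
      refine Finset.sum_congr rfl fun l hl => ?_
      rw [h l (Finset.mem_filter.1 hl).2.2]
    simp only [iterate, h1, h2]

lemma norm_tpmStep_le (τ : TopRule d r) (A : Mat d) (u : Vec d) : ‖tpmStep τ A u‖ ≤ 1 := by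
  rw [tpmStep, norm_smul, norm_inv, norm_norm]
  exact inv_mul_le_one

lemma norm_iterate_le (τ : TopRule d r) (x : Fin n → Vec d) (B : ℕ) (i : Fin d) (t : ℕ) :
    ‖iterate τ x B i t‖ ≤ 1 := by
  cases t with
  | zero => simp [iterate]
  | succ t => exact norm_tpmStep_le _ _ _

/-- The (zero-based) indices of the samples of the `t`-th batch. -/
def batch (n B t : ℕ) : Finset (Fin n) :=
  Finset.univ.filter (fun i : Fin n => B * t ≤ i.val ∧ i.val < B * (t + 1))

lemma sum_batch {β : Type*} [AddCommMonoid β] {B t : ℕ} (h : B * (t + 1) ≤ n) (f : ℕ → β) :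
    ∑ i ∈ batch n B t, f i.val = ∑ b ∈ Finset.range B, f (B * t + b) := by
  have hB : B * (t + 1) = B * t + B := by ring
  symm
  refine Finset.sum_bij' (fun b hb => (⟨B * t + b, by
      have := Finset.mem_range.1 hb; omega⟩ : Fin n)) (fun i _ => i.val - B * t) ?_ ?_ ?_ ?_ ?_
  · intro b hb
    have := Finset.mem_range.1 hb
    simp only [batch, Finset.mem_filter, Finset.mem_univ, true_and]
    omega
  · intro i hi
    simp only [batch, Finset.mem_filter, Finset.mem_univ, true_and] at hi
    rw [Finset.mem_range]; omega
  · intro b hb; simp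
  · intro i hi
    simp only [batch, Finset.mem_filter, Finset.mem_univ, true_and] at hi
    ext; simp only []; omega
  · intro b hb; rfl

lemma card_batch {B t : ℕ} (h : B * (t + 1) ≤ n) : (batch n B t).card = B := by
  have := sum_batch (n := n) h (fun _ => (1 : ℕ))
  simpa using this

lemma toEuclideanLin_batchCov (x : Fin n → Vec d) (B t : ℕ) (u : Vec d) (j : Fin d) :
    Matrix.toEuclideanLin (batchCov x B t) u j =
      (1 / (B : ℝ)) * ∑ i ∈ batch n B t, (inner ℝ u (x i) : ℝ) * x i j := by
  rw [toEuclideanLin_apply_coord]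
  simp only [batchCov, inner_vec_eq_sum, Finset.sum_mul, Finset.mul_sum, batch]
  rw [Finset.sum_comm]
  exact Finset.sum_congr rfl fun i _ => Finset.sum_congr rfl fun b _ => by ring

/-- The error of the `t`-th batch along the `t`-th iterate is small, since they are independent. -/
lemma IsSubGaussian.measure_iterate_deviation_le {σ : ℝ} {D : Measure (Vec d)}
    [IsProbabilityMeasure D] {M : Mat d} (h : IsSubGaussian σ D) (hσ : 0 < σ)
    (hM : HasCovariance D M) (hMs : M.IsHermitian) (τ : TopRule d r) (i j : Fin d) {B t : ℕ}
    (hB : 0 < B) (hBt : B * (t + 1) ≤ n) {ζ : ℝ} (hζ : 0 < ζ) (hζ1 : ζ ≤ 1) :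
    (Measure.pi fun _ : Fin n => D) {x | 2 * ζ * σ ^ 2 <
        |Matrix.toEuclideanLin (batchCov x B t) (iterate τ x B i t) j -
          Matrix.toEuclideanLin M (iterate τ x B i t) j|} ≤
      ENNReal.ofReal (4 * Real.exp (-(B * ζ ^ 2 / 1024))) := by
  have hit := measurable_iterate (n := n) τ B i t
  refine measure_pi_le_of_resample D (batch n B t) ?_ fun x => ?_
  · have h1 : Measurable fun x : Fin n → Vec d =>
        Matrix.toEuclideanLin (batchCov x B t) (iterate τ x B i t) j := by
      simp only [toEuclideanLin_apply_coord]
      exact Finset.measurable_sum _ fun b _ =>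
        (measurable_batchCov B t j b).mul (measurable_vec_iff.1 hit b)
    have h2 : Measurable fun x : Fin n → Vec d =>
        Matrix.toEuclideanLin M (iterate τ x B i t) j := by
      simp only [toEuclideanLin_apply_coord]
      exact Finset.measurable_sum _ fun b _ => measurable_const.mul (measurable_vec_iff.1 hit b)
    exact measurableSet_lt measurable_const (h1.sub h2).abs
  · have hlaw := h.measure_coord_deviation_le hσ hM hMs (norm_iterate_le τ x B i t) j
      (batch n B t) hζ hζ1
    rw [card_batch hBt] at hlaw
    refine le_trans (measure_mono ?_) hlaw
    intro y hy
    -- Resampling batch t leaves the t-th iterate unchanged, so the concentration bound for a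
    -- deterministic vector applies.
    have hc : iterate τ (fun l => if l ∈ batch n B t then y l else x l) B i t =
        iterate τ x B i t := by
      apply iterate_congr
      intro l hl
      have : l ∉ batch n B t := by
        simp only [batch, Finset.mem_filter, Finset.mem_univ, true_and]; omega
      simp [this]
    simp only [Set.mem_ofPred_eq, hc, toEuclideanLin_batchCov] at hy ⊢
    have hs : ∑ l ∈ batch n B t, (inner ℝ (iterate τ x B i t)
          (if l ∈ batch n B t then y l else x l) : ℝ) * (if l ∈ batch n B t then y l else x l) j =
        ∑ l ∈ batch n B t, (inner ℝ (iterate τ x B i t) (y l) : ℝ) * y l j :=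
      Finset.sum_congr rfl fun l hl => by simp [hl]
    rw [hs] at hy
    have hB' : (0 : ℝ) < B := by exact_mod_cast hB
    set Z := ∑ l ∈ batch n B t, (inner ℝ (iterate τ x B i t) (y l) : ℝ) * y l j
    have e : Z - B * Matrix.toEuclideanLin M (iterate τ x B i t) j =
        B * (1 / (B : ℝ) * Z - Matrix.toEuclideanLin M (iterate τ x B i t) j) := by
      field_simp
    rw [e, abs_mul, abs_of_pos hB']
    exact mul_lt_mul_of_pos_left hy hB'

end Iterates

/-! ### A net of the sparse unit ball and uniform concentration over it. -/

section Net

variable {d : ℕ}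

/-- The sum of `m` vectors, each of them `0` or a signed basis vector. -/
def signedSum {d m : ℕ} (φ : Fin m → Fin d × Fin 3) : Fin d → ℤ :=
  ∑ l, Pi.single (φ l).1 (((φ l).2 : ℕ) - 1 : ℤ)

/-- Each summand removes one unit from the ℓ¹ norm of the target until nothing is left. -/
lemma exists_signedSum_eq (hd : 0 < d) (m : ℕ) (z : Fin d → ℤ) (hz : ∑ j, |z j| ≤ m) :
    ∃ φ : Fin m → Fin d × Fin 3, signedSum φ = z := by
  induction m generalizing z with
  | zero =>
    refine ⟨Fin.elim0, ?_⟩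
    have h0 : ∑ j, |z j| = 0 := le_antisymm (by simpa using hz)
      (Finset.sum_nonneg fun _ _ => abs_nonneg _)
    rw [Finset.sum_eq_zero_iff_of_nonneg fun _ _ => abs_nonneg _] at h0
    ext j
    have := abs_eq_zero.1 (h0 j (Finset.mem_univ _))
    simp [signedSum, this]
  | succ m ih =>
    have step : ∃ (i : Fin d) (c : Fin 3), ∑ j, |(z - Pi.single i (((c : ℕ) : ℤ) - 1) : Fin d → ℤ) j| ≤ m := by
      by_cases h0 : ∀ j, z j = 0
      -- The element 1 of `Fin 3` encodes the coefficient 0, so surplus summands contribute nothing.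
      · refine ⟨⟨0, hd⟩, 1, ?_⟩
        simp [h0]
      · push Not at h0
        obtain ⟨i, hi⟩ := h0
        obtain ⟨c, hc⟩ : ∃ c : Fin 3, |z i - (((c : ℕ) : ℤ) - 1)| = |z i| - 1 := by
          rcases lt_or_gt_of_ne hi with h | h
          · refine ⟨0, ?_⟩
            rw [abs_of_neg h, Fin.val_zero, abs_of_nonpos (by push_cast; omega)]; push_cast; ring
          · refine ⟨2, ?_⟩
            rw [abs_of_pos h, Fin.val_two, abs_of_nonneg (by push_cast; omega)]; push_cast; ring
        refine ⟨i, c, ?_⟩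
        rw [← Finset.add_sum_erase _ _ (Finset.mem_univ i)] at hz ⊢
        have e : ∑ j ∈ Finset.univ.erase i, |(z - Pi.single i (((c : ℕ) : ℤ) - 1) : Fin d → ℤ) j| =
            ∑ j ∈ Finset.univ.erase i, |z j| := by
          refine Finset.sum_congr rfl fun j hj => ?_
          simp [Pi.single_eq_of_ne (Finset.ne_of_mem_erase hj)]
        rw [e, Pi.sub_apply, Pi.single_eq_same, hc]
        push_cast at hz; linarith
    obtain ⟨i, c, hic⟩ := step
    obtain ⟨φ, hφ⟩ := ih _ hic
    refine ⟨Fin.cons (i, c) φ, ?_⟩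
    rw [signedSum, Fin.sum_univ_succ]
    simp only [Fin.cons_zero, Fin.cons_succ]
    rw [← signedSum, hφ]; abel

/-- A net of the sparse unit vectors. -/
noncomputable def netPoint {d m : ℕ} (L : ℝ) (φ : Fin m → Fin d × Fin 3) : Vec d :=
  WithLp.toLp 2 fun j => (signedSum φ j : ℝ) / L

lemma norm_sq_eq_sum (u : Vec d) : ‖u‖ ^ 2 = ∑ j, u j ^ 2 := by
  simp [EuclideanSpace.norm_sq_eq]

lemma sum_abs_le_sqrt_mul_norm (u : Vec d) {r : ℕ} (hu : nnz u ≤ r) :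
    ∑ j, |u j| ≤ √r * ‖u‖ := by
  have h1 : ∑ j, |u j| = ∑ j ∈ Finset.univ.filter (fun j => u j ≠ 0), |u j| := by
    symm; apply Finset.sum_filter_of_ne; intro j _ h; exact abs_ne_zero.1 h
  have h2 := sq_sum_le_card_mul_sum_sq (s := Finset.univ.filter (fun j => u j ≠ 0))
    (f := fun j => |u j|)
  rw [← h1] at h2
  have h3 : ∑ j ∈ Finset.univ.filter (fun j => u j ≠ 0), |u j| ^ 2 ≤ ‖u‖ ^ 2 := by
    rw [norm_sq_eq_sum]
    simp only [sq_abs]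
    exact Finset.sum_le_sum_of_subset_of_nonneg (Finset.filter_subset _ _)
      fun _ _ _ => sq_nonneg _
  apply le_of_sq_le_sq _ (by positivity)
  rw [mul_pow, Real.sq_sqrt (Nat.cast_nonneg _)]
  refine h2.trans (mul_le_mul (Nat.cast_le.2 hu) h3 (Finset.sum_nonneg fun _ _ => by positivity)
    (Nat.cast_nonneg _))

/-- Rounding towards `0`. -/
lemma exists_int_near (a : ℝ) : ∃ z : ℤ, |(z : ℝ)| ≤ |a| ∧ |a - z| ≤ 1 ∧ (a = 0 → z = 0) := by
  rcases le_total 0 a with h | h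
  · refine ⟨⌊a⌋, ?_, ?_, fun h0 => by simp [h0]⟩
    · have : (0 : ℝ) ≤ ⌊a⌋ := by exact_mod_cast Int.floor_nonneg.2 h
      rw [abs_of_nonneg this, abs_of_nonneg h]; exact Int.floor_le a
    · rw [abs_le]; constructor <;> linarith [Int.floor_le a, Int.lt_floor_add_one a]
  · refine ⟨⌈a⌉, ?_, ?_, fun h0 => by simp [h0]⟩
    · have : (⌈a⌉ : ℝ) ≤ 0 := by exact_mod_cast Int.ceil_nonpos.2 h
      rw [abs_of_nonpos this, abs_of_nonpos h]; linarith [Int.le_ceil a]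
    · rw [abs_le]; constructor <;> linarith [Int.le_ceil a, Int.ceil_lt_add_one a]

/-- Round 4√r · u coordinatewise towards 0. Its ℓ¹ norm is at most 4r, so 4r signed basis vectors
suffice. At most r coordinates move, each by at most 1/(4√r), for a total of at most 1/4. Rounding
towards 0 enlarges neither the support nor the norm. -/
lemma exists_netPoint_near {r : ℕ} (hd : 0 < d) (hr : 0 < r) {u : Vec d} (hu : ‖u‖ ≤ 1)
    (hs : nnz u ≤ r) : ∃ φ : Fin (4 * r) → Fin d × Fin 3,
      ‖netPoint (4 * √r) φ‖ ≤ 1 ∧ ‖u - netPoint (4 * √r) φ‖ ≤ 1 / 4 ∧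
      ∀ j, u j = 0 → netPoint (4 * √r) φ j = 0 := by
  have hr' : 0 < √(r : ℝ) := Real.sqrt_pos.2 (by exact_mod_cast hr)
  have hrr : √(r : ℝ) * √r = r := Real.mul_self_sqrt (Nat.cast_nonneg _)
  set L := 4 * √(r : ℝ) with hL
  have hL0 : 0 < L := by positivity
  choose z hz1 hz2 hz3 using fun j => exists_int_near (L * u j)
  have hsum : ∑ j, |z j| ≤ ((4 * r : ℕ) : ℤ) := by
    have : ∑ j, |(z j : ℝ)| ≤ 4 * r := by
      calc ∑ j, |(z j : ℝ)| ≤ ∑ j, L * |u j| := Finset.sum_le_sum fun j _ => by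
            refine (hz1 j).trans (le_of_eq ?_); rw [abs_mul, abs_of_pos hL0]
        _ = L * ∑ j, |u j| := by rw [Finset.mul_sum]
        _ ≤ L * (√r * ‖u‖) := mul_le_mul_of_nonneg_left (sum_abs_le_sqrt_mul_norm u hs) hL0.le
        _ ≤ L * (√r * 1) := by gcongr
        _ = 4 * r := by rw [hL, mul_one, mul_assoc, hrr]
    exact_mod_cast this
  obtain ⟨φ, hφ⟩ := exists_signedSum_eq hd (4 * r) z hsum
  have hp : ∀ j, netPoint L φ j = z j / L := fun j => by rw [← hφ]; rfl
  have habs : ∀ j, |z j / L| ≤ |u j| := fun j => by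
    rw [abs_div, abs_of_pos hL0, div_le_iff₀ hL0]
    refine (hz1 j).trans (le_of_eq ?_); rw [abs_mul, abs_of_pos hL0, mul_comm]
  have hzero : ∀ j, u j = 0 → netPoint L φ j = 0 := fun j hj => by
    rw [hp, hz3 j (by rw [hj, mul_zero])]; simp
  refine ⟨φ, ?_, ?_, hzero⟩
  · rw [← sq_le_one_iff₀ (norm_nonneg _), norm_sq_eq_sum]
    refine le_trans (Finset.sum_le_sum fun j _ => ?_)
      ((norm_sq_eq_sum u).symm.le.trans ((sq_le_one_iff₀ (norm_nonneg _)).2 hu))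
    rw [hp]; exact sq_le_sq.2 (habs j)
  · rw [← pow_le_pow_iff_left₀ (norm_nonneg _) (by norm_num) two_ne_zero, norm_sq_eq_sum]
    have h1 : ∀ j, (u - netPoint L φ) j ^ 2 ≤ if u j ≠ 0 then 1 / L ^ 2 else 0 := by
      intro j
      rw [PiLp.sub_apply]
      split_ifs with h
      · have e : u j - netPoint L φ j = (L * u j - z j) / L := by rw [hp]; field_simp
        rw [e, div_pow]
        gcongr
        exact (sq_le_one_iff_abs_le_one _).2 (hz2 j)
      · rw [hzero j (not_not.1 h), not_not.1 h]; simp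
    refine (Finset.sum_le_sum fun j _ => h1 j).trans ?_
    rw [← Finset.sum_filter, Finset.sum_const, nsmul_eq_mul]
    have h2 : ((Finset.univ.filter (fun j => u j ≠ 0)).card : ℝ) ≤ r := Nat.cast_le.2 hs
    have h3 : L ^ 2 = 16 * r := by rw [hL, mul_pow, sq (√(r : ℝ)), hrr]; norm_num
    have h4 : (0 : ℝ) < r := by exact_mod_cast hr
    rw [h3, mul_one_div, div_le_iff₀ (by positivity)]
    linarith

/-- A quadratic form that is small on the net is small on all sparse unit vectors. -/
lemma abs_quadForm_le_of_net {r : ℕ} (hd : 0 < d) (hr : 0 < r) {E : Mat d} (hE : E.IsHermitian)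
    {κ : ℝ} (hκ : ∀ φ : Fin (4 * r) → Fin d × Fin 3, ‖netPoint (4 * √r) φ‖ ≤ 1 →
      |quadForm E (netPoint (4 * √r) φ)| ≤ κ) {u : Vec d} (hu : ‖u‖ ≤ 1) (hs : nnz u ≤ r) :
    |quadForm E u| ≤ 2 * κ := by
  -- Fixing the support of u makes the competitors a linear space. The maximum m over its unit ball
  -- then also controls the rounding error, and the bound on m closes on itself.
  set K : Set (Vec d) := {w | ∀ j, u j = 0 → w j = 0} ∩ Metric.closedBall 0 1 with hK
  have hcl : IsClosed {w : Vec d | ∀ j, u j = 0 → w j = 0} := by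
    simp only [Set.ofPred_forall]
    refine isClosed_iInter fun j => isClosed_iInter fun _ => ?_
    exact isClosed_eq (by fun_prop) continuous_const
  have hKc : IsCompact K := (isCompact_closedBall (0 : Vec d) 1).inter_left hcl
  have hQc : Continuous fun w : Vec d => |quadForm E w| := by
    unfold quadForm; fun_prop
  obtain ⟨w, hwK, hmax⟩ := hKc.exists_isMaxOn ⟨u, fun _ h => h, by simpa using hu⟩ hQc.continuousOn
  set m := |quadForm E w| with hm
  have hsmul : ∀ (c : ℝ) (y : Vec d), quadForm E (c • y) = c ^ 2 * quadForm E y := by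
    intro c y
    rw [quadForm_eq_inner, quadForm_eq_inner, map_smul, inner_smul_left, inner_smul_right]
    simp; ring
  have hhom : ∀ y : Vec d, (∀ j, u j = 0 → y j = 0) → |quadForm E y| ≤ m * ‖y‖ ^ 2 := by
    intro y hy
    rcases eq_or_ne y 0 with rfl | hy0
    · simp [quadForm]
    · have hn : ‖y‖ ≠ 0 := norm_ne_zero_iff.2 hy0
      have h1 : ‖y‖⁻¹ • y ∈ K := by
        refine ⟨fun j hj => by simp [hy j hj], ?_⟩
        simp [norm_smul, hn]
      have h2 : |quadForm E (‖y‖⁻¹ • y)| ≤ m := hmax h1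
      rw [hsmul, abs_mul, abs_of_nonneg (sq_nonneg _), inv_pow, inv_mul_le_iff₀ (by positivity)] at h2
      linarith
  have hwn : ‖w‖ ≤ 1 := by simpa using hwK.2
  have hws : nnz w ≤ r := by
    refine le_trans (Finset.card_le_card fun j hj => ?_) hs
    simp only [Finset.mem_filter, Finset.mem_univ, true_and] at hj ⊢
    exact fun h => hj (hwK.1 j h)
  obtain ⟨φ, h1, h2, h3⟩ := exists_netPoint_near hd hr hwn hws
  set z := netPoint (4 * √(r : ℝ)) φ with hz
  have hzs : ∀ j, u j = 0 → z j = 0 := fun j hj => h3 j (hwK.1 j hj)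
  -- The factor 8 balances w - z with w + z: both then have norm at most 2. The parallelogram law
  -- gives total squared norm 16, and polarization divides by 32, so the difference is at most m/2.
  have hdiff : quadForm E w - quadForm E z =
      1 / 8 * inner ℝ (w + z) (Matrix.toEuclideanLin E ((8 : ℝ) • (w - z))) := by
    simp only [quadForm_eq_inner, map_smul, map_sub, inner_smul_right, inner_add_left,
      inner_sub_right, inner_toEuclideanLin_comm hE z w]
    ring
  have hpol := quadForm_add_sub_quadForm_sub hE ((8 : ℝ) • (w - z)) (w + z)
  have hb1 := hhom ((8 : ℝ) • (w - z) + (w + z)) fun j hj => by simp [hwK.1 j hj, hzs j hj]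
  have hb2 := hhom ((8 : ℝ) • (w - z) - (w + z)) fun j hj => by simp [hwK.1 j hj, hzs j hj]
  have hpar := parallelogram_law_with_norm ℝ ((8 : ℝ) • (w - z)) (w + z)
  have hn1 : ‖(8 : ℝ) • (w - z)‖ ≤ 2 := by
    rw [norm_smul]; simp only [Real.norm_ofNat]; linarith
  have hn2 : ‖w + z‖ ≤ 2 := (norm_add_le _ _).trans (by linarith)
  have hm0 : 0 ≤ m := abs_nonneg _
  have hsq : ‖(8 : ℝ) • (w - z) + (w + z)‖ ^ 2 + ‖(8 : ℝ) • (w - z) - (w + z)‖ ^ 2 ≤ 16 := by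
    nlinarith [norm_nonneg ((8 : ℝ) • (w - z)), norm_nonneg (w + z)]
  have h16 := mul_le_mul_of_nonneg_left hsq hm0
  have hmz : m ≤ κ + m / 2 := by
    have hk := abs_le.1 (hκ φ h1)
    rw [abs_le] at hb1 hb2
    have : |quadForm E w| ≤ κ + m / 2 := by
      rw [abs_le]
      constructor <;> linarith [hb1.1, hb1.2, hb2.1, hb2.2, hk.1, hk.2]
    exact this
  have hum : |quadForm E u| ≤ m := hmax (⟨fun _ h => h, by simpa using hu⟩ : u ∈ K)
  linarith

variable {n r : ℕ}

lemma quadForm_empCov (x : Fin n → Vec d) (u : Vec d) :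
    quadForm (empCov x) u = (1 / (n : ℝ)) * ∑ i, (inner ℝ u (x i) : ℝ) ^ 2 := by
  have e : ∀ i, (inner ℝ u (x i) : ℝ) ^ 2 = ∑ a, ∑ b, u a * x i a * (u b * x i b) := fun i => by
    rw [inner_vec_eq_sum, sq, Finset.sum_mul_sum]
  simp_rw [e, quadForm, empCov, Finset.mul_sum, Finset.sum_mul]
  symm
  rw [Finset.sum_comm]
  refine Finset.sum_congr rfl fun a _ => ?_
  rw [Finset.sum_comm]
  exact Finset.sum_congr rfl fun b _ => Finset.sum_congr rfl fun i _ => by ring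

lemma isHermitian_empCov (x : Fin n → Vec d) : (empCov x).IsHermitian := by
  ext a b
  simp [empCov, Matrix.conjTranspose_apply, mul_comm]

/-- The sample covariance concentrates uniformly over all sparse vectors. -/
lemma IsSubGaussian.measure_exists_sparse_deviation_le {σ : ℝ} {D : Measure (Vec d)}
    [IsProbabilityMeasure D] {M : Mat d} (h : IsSubGaussian σ D) (hσ : 0 < σ)
    (hM : HasCovariance D M) (hMs : M.IsHermitian) (hd : 0 < d) (hr : 0 < r) (hn : 0 < n)
    {ζ : ℝ} (hζ : 0 < ζ) (hζ1 : ζ ≤ 1) :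
    (Measure.pi fun _ : Fin n => D) {x | ∃ u : Vec d, nnz u ≤ r ∧ ‖u‖ ≤ 1 ∧
        2 * (ζ * σ ^ 2) < |quadForm (empCov x) u - quadForm M u|} ≤
      ENNReal.ofReal ((3 * d : ℝ) ^ (4 * r) * (2 * Real.exp (-(n * ζ ^ 2 / 1024)))) := by
  have hn' : (0 : ℝ) < n := by exact_mod_cast hn
  set bad : (Fin (4 * r) → Fin d × Fin 3) → Set (Fin n → Vec d) := fun φ =>
    {x | ‖netPoint (4 * √r) φ‖ ≤ 1 ∧ ζ * σ ^ 2 <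
      |quadForm (empCov x) (netPoint (4 * √r) φ) - quadForm M (netPoint (4 * √r) φ)|} with hbad
  have hbound : ∀ φ, (Measure.pi fun _ : Fin n => D) (bad φ) ≤
      ENNReal.ofReal (2 * Real.exp (-(n * ζ ^ 2 / 1024))) := by
    intro φ
    by_cases hφ : ‖netPoint (4 * √r) φ‖ ≤ 1
    · have := h.measure_quadForm_deviation_le hσ hM one_pos hφ (Finset.univ : Finset (Fin n)) hζ hζ1
      simp only [Finset.card_univ, Fintype.card_fin, one_pow, mul_one] at this
      refine le_trans (measure_mono fun x hx => ?_) this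
      have hx2 := hx.2
      simp only [Set.mem_ofPred_eq]
      rw [quadForm_empCov] at hx2
      set Z := ∑ i, (inner ℝ (netPoint (4 * √r) φ) (x i) : ℝ) ^ 2
      have e : Z - n * quadForm M (netPoint (4 * √r) φ) =
          n * (1 / (n : ℝ) * Z - quadForm M (netPoint (4 * √r) φ)) := by field_simp
      rw [e, abs_mul, abs_of_pos hn']
      exact mul_lt_mul_of_pos_left hx2 hn'
    · simp [hbad, hφ]
  have hsub : {x : Fin n → Vec d | ∃ u : Vec d, nnz u ≤ r ∧ ‖u‖ ≤ 1 ∧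
        2 * (ζ * σ ^ 2) < |quadForm (empCov x) u - quadForm M u|} ⊆ ⋃ φ, bad φ := by
    rintro x ⟨u, hs, hu, hx⟩
    by_contra hcon
    simp only [Set.mem_iUnion, not_exists, hbad, Set.mem_ofPred_eq, not_and, not_lt] at hcon
    have hq : ∀ w : Vec d, quadForm (empCov x - M) w = quadForm (empCov x) w - quadForm M w := by
      intro w; simp [quadForm_eq_inner, inner_sub_right]
    have := abs_quadForm_le_of_net hd hr (E := empCov x - M) ((isHermitian_empCov x).sub hMs)
      (κ := ζ * σ ^ 2) (fun φ hφ => by rw [hq]; exact hcon φ hφ) hu hs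
    rw [hq] at this
    linarith
  refine (measure_mono hsub).trans ((measure_iUnion_fintype_le _ _).trans
    ((Finset.sum_le_sum fun φ _ => hbound φ).trans ?_))
  rw [Finset.sum_const, nsmul_eq_mul, Finset.card_univ, ENNReal.ofReal_mul (p := (3 * d : ℝ) ^ (4 * r)) (by positivity)]
  refine mul_le_mul' ?_ le_rfl
  simp only [Fintype.card_fun, Fintype.card_prod, Fintype.card_fin]
  rw [← ENNReal.ofReal_natCast]
  apply ENNReal.ofReal_le_ofReal
  push_cast
  rw [mul_comm (d : ℝ)]

end Net

/-! ### Restriction of vectors to sets of coordinates, and the mass lost by truncation. -/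

section Restriction

variable {d : ℕ}

/-- Zero out the entries outside `F`. -/
noncomputable def restrict (F : Finset (Fin d)) (w : Vec d) : Vec d :=
  WithLp.toLp 2 fun j => if j ∈ F then w j else 0

lemma restrict_apply (F : Finset (Fin d)) (w : Vec d) (j : Fin d) :
    restrict F w j = if j ∈ F then w j else 0 := rfl

lemma restrict_add (F : Finset (Fin d)) (w w' : Vec d) :
    restrict F (w + w') = restrict F w + restrict F w' := by
  ext j; simp only [restrict_apply, PiLp.add_apply]; split_ifs <;> simp

lemma norm_sq_restrict (F : Finset (Fin d)) (w : Vec d) :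
    ‖restrict F w‖ ^ 2 = ∑ j ∈ F, w j ^ 2 := by
  rw [norm_sq_eq_sum, ← Finset.sum_filter_add_sum_filter_not Finset.univ (· ∈ F)]
  rw [Finset.filter_mem_eq_inter, Finset.univ_inter]
  have h1 : ∑ j ∈ F, restrict F w j ^ 2 = ∑ j ∈ F, w j ^ 2 :=
    Finset.sum_congr rfl fun j hj => by simp [restrict_apply, hj]
  have h2 : ∑ j with j ∉ F, restrict F w j ^ 2 = 0 :=
    Finset.sum_eq_zero fun j hj => by simp [restrict_apply, (Finset.mem_filter.1 hj).2]
  rw [h1, h2, add_zero]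

lemma norm_restrict_le (F : Finset (Fin d)) (w : Vec d) : ‖restrict F w‖ ≤ ‖w‖ := by
  rw [← pow_le_pow_iff_left₀ (norm_nonneg _) (norm_nonneg _) two_ne_zero, norm_sq_restrict,
    norm_sq_eq_sum]
  exact Finset.sum_le_sum_of_subset_of_nonneg (Finset.subset_univ _) fun _ _ _ => sq_nonneg _

lemma norm_restrict_le_sqrt_mul (F : Finset (Fin d)) {w : Vec d} {η : ℝ} (hη : 0 ≤ η)
    (hw : ∀ j, |w j| ≤ η) {c : ℝ} (hc : (F.card : ℝ) ≤ c) : ‖restrict F w‖ ≤ √c * η := by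
  have hc0 : 0 ≤ c := (Nat.cast_nonneg _).trans hc
  rw [← pow_le_pow_iff_left₀ (norm_nonneg _) (by positivity) two_ne_zero, norm_sq_restrict,
    mul_pow, Real.sq_sqrt hc0]
  calc ∑ j ∈ F, w j ^ 2 ≤ ∑ _j ∈ F, η ^ 2 :=
        Finset.sum_le_sum fun j _ => sq_le_sq' (abs_le.1 (hw j)).1 (abs_le.1 (hw j)).2
    _ = F.card * η ^ 2 := by rw [Finset.sum_const, nsmul_eq_mul]
    _ ≤ c * η ^ 2 := by gcongr

lemma restrict_eq_self {F : Finset (Fin d)} {w : Vec d} (h : ∀ j ∉ F, w j = 0) :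
    restrict F w = w := by
  ext j; rw [restrict_apply]; split_ifs with hj
  · rfl
  · rw [h j hj]

/-- If the entries of `w` on `F` dominate those off `F`, little mass is lost on `S` by restricting
to `F`, compared with the mass on `F \ S`. -/
lemma norm_restrict_sdiff_le {F S : Finset (Fin d)} {w : Vec d} {r s : ℕ} {ω : ℝ} (hω : 0 ≤ ω)
    (hF : F.card = r) (hS : S.card ≤ s) (hsr : s < r)
    (hdom : ∀ i ∈ F, ∀ j ∉ F, |w j| ≤ |w i|) (hωs : (s : ℝ) ≤ ω ^ 2 * (r - s)) :
    ‖restrict (S \ F) w‖ ≤ ω * ‖restrict (F \ S) w‖ := by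
  rw [← pow_le_pow_iff_left₀ (norm_nonneg _) (by positivity) two_ne_zero, mul_pow,
    norm_sq_restrict, norm_sq_restrict]
  set a := ∑ j ∈ S \ F, w j ^ 2
  set b := ∑ i ∈ F \ S, w i ^ 2
  have hb : 0 ≤ b := Finset.sum_nonneg fun _ _ => sq_nonneg _
  have ha : 0 ≤ a := Finset.sum_nonneg fun _ _ => sq_nonneg _
  -- Sum the pairwise domination over (F \ S) × (S \ F); the first set has at least r - s elements,
  -- the second at most s.
  have hpair : ((F \ S).card : ℝ) * a ≤ ((S \ F).card : ℝ) * b := by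
    calc ((F \ S).card : ℝ) * a = ∑ _i ∈ F \ S, ∑ j ∈ S \ F, w j ^ 2 := by
          rw [Finset.sum_const, nsmul_eq_mul]
      _ ≤ ∑ i ∈ F \ S, ∑ _j ∈ S \ F, w i ^ 2 :=
          Finset.sum_le_sum fun i hi => Finset.sum_le_sum fun j hj =>
            sq_le_sq.2 (hdom i (Finset.mem_sdiff.1 hi).1 j (Finset.mem_sdiff.1 hj).2)
      _ = ((S \ F).card : ℝ) * b := by
          simp only [Finset.sum_const, nsmul_eq_mul]; rw [Finset.mul_sum]
  have h1 : (r : ℝ) - s ≤ (F \ S).card := by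
    have : F.card ≤ (F \ S).card + S.card := by
      rw [← Finset.card_sdiff_add_card_inter F S]
      exact Nat.add_le_add_left (Finset.card_le_card Finset.inter_subset_right) _
    have h2 : (r : ℝ) ≤ (F \ S).card + s := by exact_mod_cast (by omega : r ≤ (F \ S).card + s)
    linarith
  have h2 : ((S \ F).card : ℝ) ≤ s := by
    exact_mod_cast (Finset.card_le_card Finset.sdiff_subset).trans hS
  have hrs : (0 : ℝ) < r - s := by
    have : (s : ℝ) < r := by exact_mod_cast hsr
    linarith
  have h3 : ((r : ℝ) - s) * a ≤ ((r : ℝ) - s) * (ω ^ 2 * b) := by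
    calc ((r : ℝ) - s) * a ≤ (F \ S).card * a := by gcongr
      _ ≤ (S \ F).card * b := hpair
      _ ≤ s * b := by gcongr
      _ ≤ ω ^ 2 * (r - s) * b := by gcongr
      _ = _ := by ring
  exact le_of_mul_le_mul_left h3 hrs

variable {V : Submodule ℝ (Vec d)} {S : Finset (Fin d)}

lemma starProjection_eq_zero_of_vanish (hVS : ∀ y ∈ V, ∀ j ∉ S, y j = 0) {f : Vec d}
    (hf : ∀ j ∈ S, f j = 0) : V.starProjection f = 0 := by
  rw [Submodule.starProjection_apply_eq_zero_iff, Submodule.mem_orthogonal]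
  intro y hy
  rw [inner_vec_eq_sum]
  refine Finset.sum_eq_zero fun j _ => ?_
  by_cases hj : j ∈ S
  · rw [hf j hj, mul_zero]
  · rw [hVS y hy j hj, zero_mul]

/-- Vectors of V live on S, so the projection on V does not see what happens outside S. -/
lemma starProjection_restrict (hVS : ∀ y ∈ V, ∀ j ∉ S, y j = 0) {G : Finset (Fin d)} (hG : S ⊆ G)
    (f : Vec d) : V.starProjection (restrict G f) = V.starProjection f := by
  rw [← sub_eq_zero, ← map_sub]
  refine starProjection_eq_zero_of_vanish hVS fun j hj => ?_
  rw [PiLp.sub_apply, restrict_apply, if_pos (hG hj), sub_self]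

end Restriction

/-! ### One noisy truncated power step, and the convergence of the iteration. -/

section Step

variable {d r : ℕ} {V : Submodule ℝ (Vec d)} {S : Finset (Fin d)} {M : Mat d}

lemma norm_starProjection_le (V : Submodule ℝ (Vec d)) (x : Vec d) : ‖V.starProjection x‖ ≤ ‖x‖ :=
  V.norm_starProjection_apply_le x

lemma norm_sub_starProjection_le (V : Submodule ℝ (Vec d)) (x : Vec d) :
    ‖x - V.starProjection x‖ ≤ ‖x‖ := by
  have := Vᗮ.norm_starProjection_apply_le x
  rwa [Submodule.starProjection_orthogonal_val] at this

lemma norm_sq_starProjection_add (V : Submodule ℝ (Vec d)) (x : Vec d) :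
    ‖V.starProjection x‖ ^ 2 + ‖x - V.starProjection x‖ ^ 2 = ‖x‖ ^ 2 := by
  have h := Submodule.norm_sq_eq_add_norm_sq_starProjection x V
  rw [Submodule.starProjection_orthogonal_val] at h
  exact h.symm

/-- The components along `V` and `Vᗮ` of a truncated noisy product. -/
lemma truncated_mul_bounds (hVS : ∀ y ∈ V, ∀ j ∉ S, y j = 0) {s : ℕ} (hS : S.card ≤ s) (hsr : s < r)
    (hrd : r ≤ d) (τ : TopRule d r) {lam g η h ω : ℝ} (hlam : 0 < lam) (hg : 0 ≤ g) (hη : 0 ≤ η)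
    (hω : 0 ≤ ω) (hV : ∀ y ∈ V, Matrix.toEuclideanLin M y ∈ V ∧
      lam * ‖y‖ ≤ ‖Matrix.toEuclideanLin M y‖)
    (hVo : ∀ z ∈ Vᗮ, Matrix.toEuclideanLin M z ∈ Vᗮ ∧
      ‖Matrix.toEuclideanLin M z‖ ≤ (1 - g) * lam * ‖z‖)
    (hωs : (s : ℝ) ≤ ω ^ 2 * (r - s)) (hh : √(2 * r) * η ≤ h * lam) (u w : Vec d)
    (hw : ∀ j, |w j - Matrix.toEuclideanLin M u j| ≤ η) :
    lam * (‖V.starProjection u‖ - ω * (‖u - V.starProjection u‖ + 2 * h)) ≤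
        ‖V.starProjection (τ.top w)‖ ∧
      ‖τ.top w - V.starProjection (τ.top w)‖ ≤ lam * ((1 - g) * ‖u - V.starProjection u‖ + h +
        ω * (‖u - V.starProjection u‖ + h)) := by
  set P := V.starProjection with hP
  set F := τ.select w with hF
  have hFc : F.card = r := by rw [hF, τ.card_select, min_eq_left hrd]
  set y := P u
  set z := u - P u with hz
  have hy : y ∈ V := V.starProjection_apply_mem u
  have hzo : z ∈ Vᗮ := V.sub_starProjection_mem_orthogonal u
  obtain ⟨hAy, hAyn⟩ := hV y hy
  obtain ⟨hAz, hAzn⟩ := hVo z hzo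
  set Ay := Matrix.toEuclideanLin M y
  set Az := Matrix.toEuclideanLin M z
  set e := w - Matrix.toEuclideanLin M u with he
  have hwe : w = Ay + Az + e := by
    rw [he, ← map_add, hz]; simp [y]
  have hej : ∀ j, |e j| ≤ η := hw
  set ρ := restrict (S \ F) w with hρ
  have hAyS : ∀ j ∉ S, Ay j = 0 := hVS _ hAy
  -- Keeping F amounts to keeping F ∪ S and then removing S \ F. On F ∪ S the signal `Ay`, which
  -- lives on S, survives intact, so ρ is the whole harm done to it.
  have hx : τ.top w = Ay + restrict (F ∪ S) Az + restrict (F ∪ S) e - ρ := by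
    have h1 : restrict (F ∪ S) w = Ay + restrict (F ∪ S) Az + restrict (F ∪ S) e := by
      rw [hwe, restrict_add, restrict_add,
        restrict_eq_self fun j hj => hAyS j fun h => hj (Finset.mem_union_right _ h)]
    rw [← h1]
    ext j
    simp only [TopRule.top_apply, hρ, PiLp.sub_apply, restrict_apply, Finset.mem_union,
      Finset.mem_sdiff, ← hF]
    by_cases h1 : j ∈ F <;> by_cases h2 : j ∈ S <;> simp [h1, h2]
  have hPAy : P Ay = Ay := Submodule.starProjection_eq_self_iff.2 hAy
  have hPAz : P (restrict (F ∪ S) Az) = 0 := by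
    rw [starProjection_restrict hVS Finset.subset_union_right,
      Submodule.starProjection_apply_eq_zero_iff]
    exact hAz
  have hPe : P (restrict (F ∪ S) e) = P (restrict S e) := by
    rw [starProjection_restrict hVS Finset.subset_union_right,
      starProjection_restrict hVS subset_rfl]
  have hrs : (s : ℝ) < r := by exact_mod_cast hsr
  have hq : (1 - g) * lam * ‖z‖ ≤ lam * ‖z‖ := by
    nlinarith [mul_nonneg (mul_nonneg hg hlam.le) (norm_nonneg z)]
  have hη2 : ∀ G : Finset (Fin d), (G.card : ℝ) ≤ 2 * r → ‖restrict G e‖ ≤ h * lam := fun G hG =>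
    (norm_restrict_le_sqrt_mul G hη hej hG).trans hh
  have hρn : ‖ρ‖ ≤ ω * (lam * ‖z‖ + h * lam) := by
    refine (norm_restrict_sdiff_le hω hFc hS hsr (τ.le_of_mem w) hωs).trans
      (mul_le_mul_of_nonneg_left ?_ hω)
    -- The comparison set F \ S misses the signal, so the truncation loss is measured against the
    -- orthogonal part and the noise only.
    have h1 : restrict (F \ S) w = restrict (F \ S) Az + restrict (F \ S) e := by
      have : restrict (F \ S) Ay = 0 := by
        ext j; rw [restrict_apply]; split_ifs with hj
        · exact hAyS j (Finset.mem_sdiff.1 hj).2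
        · rfl
      rw [hwe, restrict_add, restrict_add, this, zero_add]
    rw [h1]
    refine (norm_add_le _ _).trans (add_le_add ((norm_restrict_le _ _).trans (hAzn.trans hq))
      (hη2 _ ?_))
    have : ((F \ S).card : ℝ) ≤ r := by
      exact_mod_cast (Finset.card_le_card Finset.sdiff_subset).trans hFc.le
    linarith [(Nat.cast_nonneg s : (0 : ℝ) ≤ s)]
  -- The noise visible to V lives on at most s ≤ ω²(r - s) ≤ ω² · 2r coordinates, hence the factor ω
  -- relative to the bound on 2r coordinates.
  have hSe : ‖restrict S e‖ ≤ ω * (h * lam) := by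
    refine (norm_restrict_le_sqrt_mul S hη hej (c := ω ^ 2 * (2 * r)) ?_).trans ?_
    · refine (Nat.cast_le.2 hS).trans (hωs.trans (mul_le_mul_of_nonneg_left ?_ (sq_nonneg _)))
      linarith [(Nat.cast_nonneg s : (0 : ℝ) ≤ s), (Nat.cast_nonneg r : (0 : ℝ) ≤ r)]
    · rw [Real.sqrt_mul (sq_nonneg _), Real.sqrt_sq hω, mul_assoc]
      exact mul_le_mul_of_nonneg_left hh hω
  have hPx : P (τ.top w) = Ay + P (restrict S e) - P ρ := by
    rw [hx, map_sub, map_add, map_add, hPAy, hPAz, hPe, add_zero]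
  constructor
  · have h1 : ‖Ay‖ ≤ ‖P (τ.top w)‖ + ‖P (restrict S e)‖ + ‖P ρ‖ := by
      have : Ay = P (τ.top w) - P (restrict S e) + P ρ := by rw [hPx]; abel
      calc ‖Ay‖ = ‖P (τ.top w) - P (restrict S e) + P ρ‖ := by rw [← this]
        _ ≤ _ := (norm_add_le _ _).trans (add_le_add_left (norm_sub_le _ _) _)
    have h2 := norm_starProjection_le V (restrict S e)
    have h3 := norm_starProjection_le V ρ
    rw [← hP] at h2 h3
    linarith
  · have h1 : τ.top w - P (τ.top w) = restrict (F ∪ S) Az +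
        (restrict (F ∪ S) e - P (restrict (F ∪ S) e)) - (ρ - P ρ) := by
      rw [hPx, hPe, hx]; abel
    rw [h1]
    have h2 := norm_sub_starProjection_le V (restrict (F ∪ S) e)
    have h3 := norm_sub_starProjection_le V ρ
    rw [← hP] at h2 h3
    have h4 : ‖restrict (F ∪ S) e‖ ≤ h * lam := by
      apply hη2
      have : (F ∪ S).card ≤ r + s := (Finset.card_union_le _ _).trans (by omega)
      have : ((F ∪ S).card : ℝ) ≤ r + s := by exact_mod_cast this
      linarith
    have h5 := (norm_restrict_le (F ∪ S) Az).trans hAzn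
    refine (norm_sub_le _ _).trans ?_
    have h6 := norm_add_le (restrict (F ∪ S) Az) (restrict (F ∪ S) e - P (restrict (F ∪ S) e))
    linarith

/-- Here p and q are the norms of the parts of a unit iterate in V and orthogonal to it, and θ
bounds the tangent q/p. From θ ≤ √s comes p ≥ 2/(3√s), so losses of size ω are a small multiple of
gp. The floor θ ≥ √ε/2 makes the noise h at most gθp/8. All the losses fit into half of the gap. -/
lemma contraction_of_bounds {s p q lam g h ω ε θ α b : ℝ} (hs : 1 ≤ s) (hlam : 0 < lam)
    (hg0 : 0 < g) (hg1 : g ≤ 1) (hε0 : 0 < ε) (hε1 : ε ≤ 1 / 2) (hp : 0 ≤ p) (hq : 0 ≤ q)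
    (hpq : p ^ 2 + q ^ 2 = 1) (hω0 : 0 ≤ ω) (hω : ω * √s ≤ g / 32) (hh0 : 0 ≤ h)
    (hh : h ≤ g * √ε / 32) (hθ0 : √ε / 2 ≤ θ) (hθ1 : θ ≤ √s) (hqp : q ≤ θ * p)
    (hα : lam * (p - ω * (q + 2 * h)) ≤ α) (hb : b ≤ lam * ((1 - g) * q + h + ω * (q + h))) :
    0 < α ∧ b ≤ (1 - g / 2) * θ * α := by
  have hsε : 0 < √ε := Real.sqrt_pos.2 hε0
  have hsε1 : √ε ≤ 3 / 4 := by
    rw [Real.sqrt_le_left (by norm_num)]; linarith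
  have hss : √s ^ 2 = s := Real.sq_sqrt (by linarith)
  have hs1 : 1 ≤ √s := by rw [Real.one_le_sqrt]; exact hs
  have hθpos : 0 < θ := lt_of_lt_of_le (by positivity) hθ0
  have hq1 : q ≤ 1 := by nlinarith only [hpq, sq_nonneg p, hq]
  -- √s · p is at least p and at least q, and p² + q² = 1, so its square is at least 1/2.
  have hp2 : 2 / 3 ≤ √s * p := by
    have h1 : q ≤ √s * p := hqp.trans (mul_le_mul_of_nonneg_right hθ1 hp)
    have h2 : p ≤ √s * p := le_mul_of_one_le_left hp hs1
    nlinarith only [h1, h2, hpq, hp, hq]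
  have hω1 : ω ≤ g / 32 := (le_mul_of_one_le_right hω0 hs1).trans hω
  have hh1 : h ≤ 1 / 32 := by
    have : g * √ε ≤ 1 := mul_le_one₀ hg1 hsε.le (by linarith)
    linarith
  have hωp : ω ≤ g / 32 * (3 / 2 * p) := by
    have h1 : ω * (2 / 3) ≤ ω * (√s * p) := mul_le_mul_of_nonneg_left hp2 hω0
    have h2 := mul_le_mul_of_nonneg_right hω hp
    linarith
  have hgp : 0 ≤ g * p := mul_nonneg hg0.le hp
  have hα2 : lam * (p * (1 - g / 16)) ≤ α := by
    refine le_trans (mul_le_mul_of_nonneg_left ?_ hlam.le) hα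
    have : ω * (q + 2 * h) ≤ g / 32 * (3 / 2 * p) * (17 / 16) :=
      mul_le_mul hωp (by linarith) (by positivity) (by linarith)
    linarith
  have hppos : 0 < p := by
    rcases hp.lt_or_eq with h | h
    · exact h
    · rw [← h, mul_zero] at hp2; norm_num at hp2
  have hαpos : 0 < α := lt_of_lt_of_le
    (mul_pos hlam (mul_pos hppos (by linarith))) hα2
  refine ⟨hαpos, ?_⟩
  -- If p ≥ 1/2, the floor on θ gives it. Otherwise q ≥ 3/4 ≥ √ε, while θp ≥ q.
  have hεθ : √ε ≤ 4 * (θ * p) := by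
    rcases le_total (1 / 2) p with h | h
    · have := mul_le_mul hθ0 h (by norm_num) hθpos.le
      linarith
    · have : 3 / 4 ≤ q := by nlinarith only [h, hpq, hp, hq]
      linarith
  have hθp : 0 ≤ θ * p := by positivity
  have hb2 : (1 - g) * q + h + ω * (q + h) ≤ (1 - g + g / 32 + 8 * g / 32) * (θ * p) := by
    have e1 : (1 - g) * q ≤ (1 - g) * (θ * p) := mul_le_mul_of_nonneg_left hqp (by linarith)
    have e2 : ω * q ≤ g / 32 * (θ * p) := mul_le_mul hω1 hqp hq (by linarith)
    have e3 : g * √ε ≤ g * (4 * (θ * p)) := mul_le_mul_of_nonneg_left hεθ hg0.le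
    have e4 : ω * h ≤ h := mul_le_of_le_one_left hh0 (by linarith)
    linarith
  have hb3 : b ≤ lam * ((1 - g + g / 32 + 8 * g / 32) * (θ * p)) :=
    hb.trans (mul_le_mul_of_nonneg_left hb2 hlam.le)
  refine hb3.trans ?_
  calc lam * ((1 - g + g / 32 + 8 * g / 32) * (θ * p))
      ≤ lam * ((1 - g / 2) * (1 - g / 16) * (θ * p)) := by
        refine mul_le_mul_of_nonneg_left (mul_le_mul_of_nonneg_right ?_ hθp) hlam.le
        nlinarith only [hg0]
    _ = (1 - g / 2) * θ * (lam * (p * (1 - g / 16))) := by ring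
    _ ≤ _ := mul_le_mul_of_nonneg_left hα2 (mul_nonneg (by linarith) hθpos.le)

/-- Convergence of the truncated power method with perturbations. -/
lemma truncated_power_converges (hVS : ∀ y ∈ V, ∀ j ∉ S, y j = 0) {s : ℕ} (hs : 1 ≤ s)
    (hS : S.card ≤ s) (hsr : s < r) (hrd : r ≤ d) (τ : TopRule d r) {lam g η ω ε : ℝ}
    (hlam : 0 < lam) (hg0 : 0 < g) (hg1 : g ≤ 1) (hε0 : 0 < ε) (hε1 : ε ≤ 1 / 2) (hη : 0 ≤ η)
    (hω : 0 ≤ ω)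
    (hV : ∀ y ∈ V, Matrix.toEuclideanLin M y ∈ V ∧ lam * ‖y‖ ≤ ‖Matrix.toEuclideanLin M y‖)
    (hVo : ∀ z ∈ Vᗮ, Matrix.toEuclideanLin M z ∈ Vᗮ ∧
      ‖Matrix.toEuclideanLin M z‖ ≤ (1 - g) * lam * ‖z‖)
    (hωs : (s : ℝ) ≤ ω ^ 2 * (r - s)) (hω1 : ω * √s ≤ g / 32)
    (hh : √(2 * r) * η ≤ g * √ε / 32 * lam)
    (A : ℕ → Mat d) (u : ℕ → Vec d) (hu0 : ‖u 0‖ = 1)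
    (hu0V : ‖u 0 - V.starProjection (u 0)‖ ≤ √s * ‖V.starProjection (u 0)‖)
    (hu : ∀ t, u (t + 1) = tpmStep τ (A t) (u t)) (T : ℕ)
    (hA : ∀ t < T, ∀ j,
      |Matrix.toEuclideanLin (A t) (u t) j - Matrix.toEuclideanLin M (u t) j| ≤ η) :
    ‖u T‖ = 1 ∧ ‖u T - V.starProjection (u T)‖ ≤
      max ((1 - g / 2) ^ T * √s) (√ε / 2) * ‖V.starProjection (u T)‖ := by
  have hs' : (1 : ℝ) ≤ s := by exact_mod_cast hs
  have hs1 : 1 ≤ √(s : ℝ) := by rw [Real.one_le_sqrt]; exact hs'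
  have hε2 : √ε / 2 ≤ √(s : ℝ) := by
    have : √ε ≤ √(s : ℝ) := Real.sqrt_le_sqrt (by linarith)
    linarith [Real.sqrt_nonneg ε]
  induction T with
  | zero =>
    refine ⟨hu0, hu0V.trans (mul_le_mul_of_nonneg_right ?_ (norm_nonneg _))⟩
    simp
  | succ T ih =>
    obtain ⟨hn, hq⟩ := ih fun t ht => hA t (by omega)
    set θ := max ((1 - g / 2) ^ T * √(s : ℝ)) (√ε / 2) with hθ
    have hpow : (1 - g / 2) ^ T ≤ 1 := pow_le_one₀ (by linarith) (by linarith)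
    have hθ1 : θ ≤ √(s : ℝ) := max_le (by nlinarith) hε2
    have hpq := norm_sq_starProjection_add V (u T)
    rw [hn, one_pow] at hpq
    obtain ⟨h1, h2⟩ := truncated_mul_bounds hVS hS hsr hrd τ hlam hg0.le hη hω hV hVo hωs hh (u T)
      (Matrix.toEuclideanLin (A T) (u T)) (hA T (by omega))
    obtain ⟨hα, hb⟩ := contraction_of_bounds hs' hlam hg0 hg1 hε0 hε1 (norm_nonneg _)
      (norm_nonneg _) hpq hω hω1 (by positivity) le_rfl (le_max_right _ _) hθ1 hq h1 h2
    set x := τ.top (Matrix.toEuclideanLin (A T) (u T)) with hx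
    have hxn : 0 < ‖x‖ := lt_of_lt_of_le hα (norm_starProjection_le V x)
    have hux : u (T + 1) = ‖x‖⁻¹ • x := hu T
    refine ⟨?_, ?_⟩
    · rw [hux, norm_smul, norm_inv, norm_norm, inv_mul_cancel₀ hxn.ne']
    · rw [hux, map_smul, ← smul_sub, norm_smul, norm_smul, norm_inv, norm_norm, mul_left_comm]
      refine mul_le_mul_of_nonneg_left (hb.trans ?_) (by positivity)
      refine mul_le_mul_of_nonneg_right ?_ (norm_nonneg _)
      rw [mul_max_of_nonneg _ _ (by linarith)]
      refine max_le_max (le_of_eq (by ring)) ?_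
      nlinarith [Real.sqrt_nonneg ε]

end Step

/-! ### Choosing the eigenvalue gap, the spectral subspace and a correlated starting vector. -/

section Spectrum

variable {d : ℕ} {M : Mat d}

lemma eigval_of_mem {hM : M.IsHermitian} {i : ℕ} (h1 : 1 ≤ i) (h2 : i ≤ d) :
    eigval hM i = hM.eigenvalues₀ ⟨i - 1, by rw [Fintype.card_fin]; omega⟩ :=
  dif_pos ⟨h1, h2⟩

lemma eigenvalues₀_nonneg (hM : M.PosSemidef) (i : Fin (Fintype.card (Fin d))) :
    0 ≤ hM.isHermitian.eigenvalues₀ i := by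
  have := hM.eigenvalues_nonneg (Fintype.equivOfCardEq (Fintype.card_fin _) i)
  simpa [Matrix.IsHermitian.eigenvalues] using this

lemma eigval_nonneg (hM : M.PosSemidef) (i : ℕ) : 0 ≤ eigval hM.isHermitian i := by
  unfold eigval
  split_ifs
  · exact eigenvalues₀_nonneg hM _
  · exact le_rfl

lemma eigval_anti (hM : M.PosSemidef) {i j : ℕ} (hi : 1 ≤ i) (hij : i ≤ j) :
    eigval hM.isHermitian j ≤ eigval hM.isHermitian i := by
  by_cases hj : j ≤ d
  · rw [eigval_of_mem hi (hij.trans hj), eigval_of_mem (hi.trans hij) hj]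
    apply hM.isHermitian.eigenvalues₀_antitone
    simp only [Fin.mk_le_mk]; omega
  -- Past d the default value 0 continues the decreasing sequence, because the eigenvalues are
  -- nonnegative; k = d needs this.
  · have : eigval hM.isHermitian j = 0 := dif_neg fun h => hj h.2
    rw [this]; exact eigval_nonneg hM i

/-- Somewhere among the top eigenvalues there is a gap. -/
lemma exists_eigval_gap (hM : M.PosSemidef) {k : ℕ} (hk : 1 ≤ k) {β γ : ℝ} (hβ : 0 < β)
    (hβγ : β ≤ γ) (hγ : γ < 1 / 2) (hpos : 0 < eigval hM.isHermitian k)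
    (hgap : eigval hM.isHermitian (k + 1) / eigval hM.isHermitian k ≤ 1 - γ) :
    ∃ i, 1 ≤ i ∧ i ≤ k ∧ (1 - β) * eigval hM.isHermitian 1 ≤ eigval hM.isHermitian i ∧
      eigval hM.isHermitian (i + 1) ≤ (1 - β / k) * eigval hM.isHermitian i := by
  by_contra hcon
  push Not at hcon
  set e := eigval hM.isHermitian with he
  have hk' : (1 : ℝ) ≤ k := by exact_mod_cast hk
  set g := β / k with hg
  have hg0 : 0 < g := by positivity
  have hkg : k * g = β := by rw [hg]; field_simp
  have hg1 : g ≤ β := by rw [hg]; exact div_le_self hβ.le hk'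
  have he1 : 0 < e 1 := lt_of_lt_of_le hpos (eigval_anti hM le_rfl hk)
  -- Each step loses at most gλ₁, since (1 - g)(1 - ig) ≥ 1 - (i + 1)g. With i ≤ k the eigenvalue is
  -- still at least (1 - β)λ₁, so the negated conclusion applies once more.
  have key : ∀ i : ℕ, i + 1 ≤ k → (1 - i * g) * e 1 ≤ e (i + 1) ∧
      (1 - (i + 1 : ℕ) * g) * e 1 < e (i + 2) := by
    have step : ∀ i : ℕ, i + 1 ≤ k → (1 - i * g) * e 1 ≤ e (i + 1) →
        (1 - (i + 1 : ℕ) * g) * e 1 < e (i + 2) := by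
      intro i hi h1
      have hik : (i : ℝ) ≤ k := by exact_mod_cast (by omega : i ≤ k)
      have h2 : (1 - β) * e 1 ≤ e (i + 1) := by
        refine le_trans (mul_le_mul_of_nonneg_right ?_ he1.le) h1
        nlinarith
      have h3 := hcon (i + 1) (by omega) hi h2
      refine lt_of_le_of_lt ?_ h3
      have h4 := mul_le_mul_of_nonneg_left h1 (by linarith : (0 : ℝ) ≤ 1 - g)
      refine le_trans ?_ h4
      push_cast
      have : 0 ≤ (i : ℝ) * g * g * e 1 := by positivity
      nlinarith
    intro i
    induction i with
    | zero =>
      intro hi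
      have : (1 - ((0 : ℕ) : ℝ) * g) * e 1 ≤ e (0 + 1) := by simp
      exact ⟨this, step 0 hi this⟩
    | succ i ih =>
      intro hi
      have := (ih (by omega)).2.le
      exact ⟨this, step (i + 1) hi this⟩
  have h1 := (key (k - 1) (by omega)).2
  rw [show k - 1 + 1 = k by omega, show k - 1 + 2 = k + 1 by omega, hkg] at h1
  rw [div_le_iff₀ hpos] at hgap
  have h2 : e k ≤ e 1 := eigval_anti hM le_rfl hk
  have h3 : (1 - γ) * e k ≤ (1 - β) * e 1 :=
    mul_le_mul (by linarith) h2 hpos.le (by linarith)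
  linarith

lemma toEuclideanLin_eigenvectorBasis (hM : M.IsHermitian) (j : Fin d) :
    Matrix.toEuclideanLin M (hM.eigenvectorBasis j) =
      hM.eigenvalues j • hM.eigenvectorBasis j := by
  have h := hM.mulVec_eigenvectorBasis j
  ext l
  simpa [Matrix.toLpLin_apply] using congrFun h l

lemma inner_eigenvectorBasis_mul (hM : M.IsHermitian) (j : Fin d) (u : Vec d) :
    (inner ℝ (hM.eigenvectorBasis j) (Matrix.toEuclideanLin M u) : ℝ) =
      hM.eigenvalues j * inner ℝ (hM.eigenvectorBasis j) u := by
  rw [inner_toEuclideanLin_comm hM, toEuclideanLin_eigenvectorBasis, inner_smul_right,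
    real_inner_comm]

lemma norm_sq_eq_sum_inner (hM : M.IsHermitian) (u : Vec d) :
    ‖u‖ ^ 2 = ∑ j, (inner ℝ (hM.eigenvectorBasis j) u : ℝ) ^ 2 := by
  rw [← hM.eigenvectorBasis.sum_sq_norm_inner_right u]
  simp

lemma norm_sq_mul_eq_sum_inner (hM : M.IsHermitian) (u : Vec d) :
    ‖Matrix.toEuclideanLin M u‖ ^ 2 =
      ∑ j, hM.eigenvalues j ^ 2 * (inner ℝ (hM.eigenvectorBasis j) u : ℝ) ^ 2 := by
  rw [norm_sq_eq_sum_inner hM]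
  simp only [inner_eigenvectorBasis_mul, mul_pow]

lemma quadForm_eq_sum_inner (hM : M.IsHermitian) (u : Vec d) :
    quadForm M u = ∑ j, hM.eigenvalues j * (inner ℝ (hM.eigenvectorBasis j) u : ℝ) ^ 2 := by
  rw [quadForm_eq_inner, ← hM.eigenvectorBasis.sum_inner_mul_inner]
  refine Finset.sum_congr rfl fun j _ => ?_
  rw [inner_eigenvectorBasis_mul, real_inner_comm]; ring

lemma quadForm_nonneg (hM : M.PosSemidef) (u : Vec d) : 0 ≤ quadForm M u := by
  rw [quadForm_eq_sum_inner hM.isHermitian]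
  exact Finset.sum_nonneg fun j _ => mul_nonneg (hM.eigenvalues_nonneg j) (sq_nonneg _)

/-- The span of the eigenvectors with eigenvalue at least `lam`. -/
def upperSpace (hM : M.IsHermitian) (lam : ℝ) : Submodule ℝ (Vec d) where
  carrier := {u | ∀ j, hM.eigenvalues j < lam → (inner ℝ (hM.eigenvectorBasis j) u : ℝ) = 0}
  add_mem' := fun ha hb j hj => by rw [inner_add_right, ha j hj, hb j hj, add_zero]
  zero_mem' := fun j _ => inner_zero_right _
  smul_mem' := fun c u hu j hj => by rw [inner_smul_right, hu j hj, mul_zero]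

lemma eigenvectorBasis_mem_upperSpace {hM : M.IsHermitian} {lam : ℝ} {j : Fin d}
    (hj : lam ≤ hM.eigenvalues j) : hM.eigenvectorBasis j ∈ upperSpace hM lam := by
  intro i hi
  exact hM.eigenvectorBasis.orthonormal.2 (fun h => by rw [h] at hi; linarith)

lemma mem_upperSpace_orthogonal_iff {hM : M.IsHermitian} {lam : ℝ} {z : Vec d} :
    z ∈ (upperSpace hM lam)ᗮ ↔
      ∀ j, lam ≤ hM.eigenvalues j → (inner ℝ (hM.eigenvectorBasis j) z : ℝ) = 0 := by
  rw [Submodule.mem_orthogonal]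
  constructor
  · exact fun h j hj => h _ (eigenvectorBasis_mem_upperSpace hj)
  · intro h y hy
    rw [← hM.eigenvectorBasis.sum_inner_mul_inner]
    refine Finset.sum_eq_zero fun j _ => ?_
    rcases lt_or_ge (hM.eigenvalues j) lam with hj | hj
    · rw [real_inner_comm, hy j hj, zero_mul]
    · rw [h j hj, mul_zero]

lemma upperSpace_mul {hM : M.IsHermitian} {lam : ℝ} (hlam : 0 ≤ lam) {y : Vec d}
    (hy : y ∈ upperSpace hM lam) : Matrix.toEuclideanLin M y ∈ upperSpace hM lam ∧
      lam * ‖y‖ ≤ ‖Matrix.toEuclideanLin M y‖ := by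
  constructor
  · intro j hj
    rw [inner_eigenvectorBasis_mul, hy j hj, mul_zero]
  · rw [← pow_le_pow_iff_left₀ (by positivity) (norm_nonneg _) two_ne_zero, mul_pow,
      norm_sq_mul_eq_sum_inner hM, norm_sq_eq_sum_inner hM, Finset.mul_sum]
    refine Finset.sum_le_sum fun j _ => ?_
    rcases lt_or_ge (hM.eigenvalues j) lam with hj | hj
    · rw [hy j hj]; simp
    · gcongr

lemma upperSpace_quadForm {hM : M.IsHermitian} {lam : ℝ} {y : Vec d}
    (hy : y ∈ upperSpace hM lam) : lam * ‖y‖ ^ 2 ≤ quadForm M y := by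
  rw [quadForm_eq_sum_inner hM, norm_sq_eq_sum_inner hM, Finset.mul_sum]
  refine Finset.sum_le_sum fun j _ => ?_
  rcases lt_or_ge (hM.eigenvalues j) lam with hj | hj
  · rw [hy j hj]; simp
  · gcongr

lemma upperSpace_orthogonal_mul {hM : M.PosSemidef} {lam c : ℝ} (hc : 0 ≤ c)
    (hgap : ∀ j, hM.isHermitian.eigenvalues j < lam → hM.isHermitian.eigenvalues j ≤ c) {z : Vec d}
    (hz : z ∈ (upperSpace hM.isHermitian lam)ᗮ) :
    Matrix.toEuclideanLin M z ∈ (upperSpace hM.isHermitian lam)ᗮ ∧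
      ‖Matrix.toEuclideanLin M z‖ ≤ c * ‖z‖ := by
  rw [mem_upperSpace_orthogonal_iff] at hz ⊢
  constructor
  · intro j hj
    rw [inner_eigenvectorBasis_mul, hz j hj, mul_zero]
  · rw [← pow_le_pow_iff_left₀ (norm_nonneg _) (by positivity) two_ne_zero, mul_pow,
      norm_sq_mul_eq_sum_inner hM.isHermitian, norm_sq_eq_sum_inner hM.isHermitian,
      Finset.mul_sum]
    refine Finset.sum_le_sum fun j _ => ?_
    rcases lt_or_ge (hM.isHermitian.eigenvalues j) lam with hj | hj
    · exact mul_le_mul_of_nonneg_right (pow_le_pow_left₀ (hM.eigenvalues_nonneg j) (hgap j hj) 2)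
        (sq_nonneg _)
    · rw [hz j hj]; simp

/-- M is block diagonal for V and its complement, and the block on the complement is nonnegative, so
it can be dropped. -/
lemma quadForm_ge_of_upperSpace (hM : M.PosSemidef) {lam : ℝ} (u : Vec d) :
    lam * ‖(upperSpace hM.isHermitian lam).starProjection u‖ ^ 2 ≤ quadForm M u := by
  set V := upperSpace hM.isHermitian lam
  have hy : V.starProjection u ∈ V := V.starProjection_apply_mem u
  have hz : u - V.starProjection u ∈ Vᗮ := V.sub_starProjection_mem_orthogonal u
  set y := V.starProjection u
  set z := u - y with hzd
  have hu : u = y + z := by rw [hzd]; abel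
  have hsum : quadForm M u = quadForm M y + quadForm M z := by
    rw [quadForm_eq_sum_inner hM.isHermitian, quadForm_eq_sum_inner hM.isHermitian,
      quadForm_eq_sum_inner hM.isHermitian, ← Finset.sum_add_distrib]
    refine Finset.sum_congr rfl fun j _ => ?_
    rw [hu, inner_add_right]
    rcases lt_or_ge (hM.isHermitian.eigenvalues j) lam with hj | hj
    · rw [hy j hj]; ring
    · rw [mem_upperSpace_orthogonal_iff.1 hz j hj]; ring
  rw [hsum]
  linarith [upperSpace_quadForm hy, quadForm_nonneg hM z]

/-- This carries sparsity over: the top-k eigenspace is spanned by vectors on a common small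
support, and the chosen subspace inherits that support. -/
lemma upperSpace_le_topEigenspace {hM : M.IsHermitian} {lam : ℝ} {k : ℕ}
    (hk : eigval hM k ≤ lam) : upperSpace hM lam ≤ topEigenspace hM k := by
  intro y hy
  rw [← hM.eigenvectorBasis.sum_repr' y]
  refine Submodule.sum_mem _ fun j _ => ?_
  rcases lt_or_ge (hM.eigenvalues j) lam with hj | hj
  · rw [hy j hj, zero_smul]; exact Submodule.zero_mem _
  · refine Submodule.smul_mem _ _ ?_
    have h1 : hM.eigenvectorBasis j ∈
        Module.End.eigenspace (Matrix.toEuclideanLin M) (hM.eigenvalues j) := by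
      rw [Module.End.mem_eigenspace_iff]; exact toEuclideanLin_eigenvectorBasis hM j
    exact Submodule.mem_iSup_of_mem _ (Submodule.mem_iSup_of_mem (hk.trans hj) h1)

/-- The eigenvalues are counted with multiplicity in decreasing order, so one strictly below the
i-th has a later position. This places the gap below the chosen subspace without computing its
dimension. -/
lemma eigenvalues_le_of_lt {hM : M.PosSemidef} {i : ℕ} (hi : 1 ≤ i) (hid : i ≤ d) (j : Fin d)
    (hj : hM.isHermitian.eigenvalues j < eigval hM.isHermitian i) :
    hM.isHermitian.eigenvalues j ≤ eigval hM.isHermitian (i + 1) := by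
  rw [eigval_of_mem hi hid] at hj
  unfold Matrix.IsHermitian.eigenvalues at hj ⊢
  set l := (Fintype.equivOfCardEq (Fintype.card_fin _) :
    Fin (Fintype.card (Fin d)) ≃ Fin d).symm j with hl
  have hli : i ≤ l.val := by
    by_contra hcon
    have : l ≤ ⟨i - 1, by rw [Fintype.card_fin]; omega⟩ := by
      rw [Fin.le_def]; simp only []; omega
    exact absurd (hM.isHermitian.eigenvalues₀_antitone this) (not_le.2 hj)
  have hld : l.val < d := lt_of_lt_of_eq l.isLt (Fintype.card_fin d)
  rw [eigval_of_mem (by omega) (by omega)]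
  apply hM.isHermitian.eigenvalues₀_antitone
  rw [Fin.le_def]; simp only []; omega

lemma exists_eigenvalues_eq_eigval {hM : M.IsHermitian} {i : ℕ} (hi : 1 ≤ i) (hid : i ≤ d) :
    ∃ j, hM.eigenvalues j = eigval hM i := by
  refine ⟨Fintype.equivOfCardEq (Fintype.card_fin _) ⟨i - 1, by rw [Fintype.card_fin]; omega⟩, ?_⟩
  rw [eigval_of_mem hi hid, Matrix.IsHermitian.eigenvalues, Equiv.symm_apply_apply]

/-- Some basis vector is correlated with a subspace of sparse vectors. -/
lemma exists_single_correlated {V : Submodule ℝ (Vec d)} {S : Finset (Fin d)} {s : ℕ}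
    (hVS : ∀ y ∈ V, ∀ j ∉ S, y j = 0) (hS : S.card ≤ s) {b : Vec d} (hb : b ∈ V)
    (hb1 : ‖b‖ = 1) : ∃ i : Fin d,
      ‖(EuclideanSpace.single i (1 : ℝ) : Vec d) -
        V.starProjection (EuclideanSpace.single i (1 : ℝ))‖ ≤
      √s * ‖V.starProjection (EuclideanSpace.single i (1 : ℝ))‖ := by
  have hsum : ∑ j ∈ S, b j ^ 2 = 1 := by
    rw [← norm_sq_restrict, restrict_eq_self (hVS b hb), hb1, one_pow]
  -- The unit mass of b is spread over at most s coordinates, so one of them carries at least 1/s.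
  -- As b lies in V, the projection of that basis vector has norm at least |b i|.
  obtain ⟨i, -, hi⟩ : ∃ i ∈ S, 1 ≤ s * b i ^ 2 := by
    by_contra hcon
    push Not at hcon
    have hne : S.Nonempty := by
      rw [Finset.nonempty_iff_ne_empty]; rintro rfl; simp at hsum
    have h1 : ∑ j ∈ S, (s * b j ^ 2) < ∑ _j ∈ S, (1 : ℝ) := Finset.sum_lt_sum_of_nonempty hne hcon
    rw [← Finset.mul_sum, hsum, Finset.sum_const, nsmul_eq_mul] at h1
    have : (S.card : ℝ) ≤ s := by exact_mod_cast hS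
    linarith
  refine ⟨i, (norm_sub_starProjection_le V _).trans ?_⟩
  have hone : ‖(EuclideanSpace.single i (1 : ℝ) : Vec d)‖ = 1 := by simp
  rw [hone]
  set P := V.starProjection (EuclideanSpace.single i (1 : ℝ)) with hP
  have h1 : b i = inner ℝ P b := by
    rw [hP, Submodule.inner_starProjection_left_eq_right, Submodule.starProjection_eq_self_iff.2 hb,
      inner_single_one_vec]
  have h2 : |b i| ≤ ‖P‖ := by
    rw [h1]; refine (abs_real_inner_le_norm _ _).trans ?_
    rw [hb1, mul_one]
  rw [← one_le_sq_iff₀ (by positivity), mul_pow, Real.sq_sqrt (Nat.cast_nonneg _)]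
  refine hi.trans (mul_le_mul_of_nonneg_left ?_ (Nat.cast_nonneg _))
  rw [← sq_abs]; exact pow_le_pow_left₀ (abs_nonneg _) h2 2

end Spectrum

/-! ### From small noise to good outputs, and the union bound. -/

section Output

variable {d n r : ℕ}

lemma nnz_tpmStep_le (τ : TopRule d r) (A : Mat d) (u : Vec d) : nnz (tpmStep τ A u) ≤ r := by
  refine (Finset.card_le_card (t := τ.select (Matrix.toEuclideanLin A u)) fun j hj => ?_).trans
    ((τ.card_select _).le.trans (min_le_left _ _))
  by_contra hcon
  refine (Finset.mem_filter.1 hj).2 ?_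
  rw [tpmStep, PiLp.smul_apply, TopRule.top_apply, if_neg hcon, smul_zero]

lemma norm_tpmStep_eq_one {τ : TopRule d r} {A : Mat d} {u : Vec d} (h : tpmStep τ A u ≠ 0) :
    ‖tpmStep τ A u‖ = 1 := by
  rw [tpmStep] at h ⊢
  have : τ.top (Matrix.toEuclideanLin A u) ≠ 0 := fun h0 => h (by rw [h0, smul_zero])
  rw [norm_smul, norm_inv, norm_norm, inv_mul_cancel₀ (norm_ne_zero_iff.2 this)]

lemma nnz_le_of_isRTPMOutput {τ : TopRule d r} {T : ℕ} (hT : 0 < T) {x : Fin n → Vec d} {u : Vec d}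
    (h : IsRTPMOutput τ T x u) : nnz u ≤ r := by
  obtain ⟨i, -, rfl⟩ := h
  obtain ⟨t, rfl⟩ := Nat.exists_eq_succ_of_ne_zero hT.ne'
  exact nnz_tpmStep_le _ _ _

/-- The bound on T makes the contraction factor at most (ε/s)². This absorbs the initial tangent √s,
and the remaining ε² is at most √ε/2. -/
lemma pow_mul_sqrt_le {s T : ℕ} (hs : 1 ≤ s) {g ε : ℝ} (hg1 : g ≤ 1) (hε0 : 0 < ε)
    (hε1 : ε < 1 / 2) (hT : 4 * Real.log (s / ε) ≤ g * T) :
    (1 - g / 2) ^ T * √s ≤ √ε / 2 := by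
  have hs' : (1 : ℝ) ≤ s := by exact_mod_cast hs
  have h1 : (1 - g / 2) ^ T ≤ (ε / s) ^ 2 := by
    have e1 : 1 - g / 2 ≤ Real.exp (-(g / 2)) := by
      have := Real.add_one_le_exp (-(g / 2)); linarith
    calc (1 - g / 2) ^ T ≤ Real.exp (-(g / 2)) ^ T := pow_le_pow_left₀ (by linarith) e1 T
      _ = Real.exp (T * -(g / 2)) := (Real.exp_nat_mul _ _).symm
      _ ≤ Real.exp ((2 : ℕ) * -Real.log (s / ε)) := Real.exp_le_exp.2 (by push_cast; linarith)
      _ = (ε / s) ^ 2 := by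
        rw [Real.exp_nat_mul, Real.exp_neg, Real.exp_log (by positivity), inv_div]
  have h2 : √(s : ℝ) ≤ s := by
    rw [Real.sqrt_le_left (by linarith)]; nlinarith
  have h3 : (ε / s) ^ 2 * √(s : ℝ) ≤ ε ^ 2 := by
    calc (ε / s) ^ 2 * √(s : ℝ) ≤ (ε / s) ^ 2 * (s * s) :=
          mul_le_mul_of_nonneg_left (h2.trans (by nlinarith)) (sq_nonneg _)
      _ = ε ^ 2 := by field_simp
  have h4 : ε ^ 2 ≤ √ε / 2 := by
    have hx : √ε ^ 2 = ε := Real.sq_sqrt hε0.le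
    have hx0 : 0 ≤ √ε := Real.sqrt_nonneg _
    have hx1 : √ε ≤ 1 := by rw [Real.sqrt_le_one]; linarith
    have h5 : ε * √ε ≤ 1 / 2 := by nlinarith
    calc ε ^ 2 = ε * √ε * √ε := by rw [mul_assoc, ← sq, hx]; ring
      _ ≤ 1 / 2 * √ε := mul_le_mul_of_nonneg_right h5 hx0
      _ = _ := by ring
  exact (mul_le_mul_of_nonneg_right h1 (Real.sqrt_nonneg _)).trans (h3.trans h4)

/-- On the event that the noise is small, every output of the algorithm is good. -/
lemma exists_start_forall_output_good {s k T : ℕ} {γ σ ε β η η' : ℝ} {M : Mat d}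
    {hM : M.PosSemidef} {v : Fin k → Vec d} {D : Measure (Vec d)}
    (hmod : GeneralSparseKPCA s k γ σ M hM v D) (hε0 : 0 < ε) (hε1 : ε < 1 / 2) (hβ0 : 0 < β)
    (hβγ : β ≤ γ) (hrd : r ≤ d) (hr : 1025 * ((s : ℝ) ^ 2 * (k : ℝ) ^ 2 / β ^ 2) ≤ r)
    (hT : 4 * ((k : ℝ) * Real.log (s / ε) / β) ≤ T) (hT0 : 0 < T) (hη0 : 0 ≤ η)
    (hη : √(2 * r) * η ≤ β / k * √ε / 32 * eigval hM.isHermitian k)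
    (hη' : η' ≤ ε / 4 * eigval hM.isHermitian k) :
    ∃ i₀ : Fin d, ∀ (τ : TopRule d r) (x : Fin n → Vec d),
      (∀ t < T, ∀ j, |Matrix.toEuclideanLin (batchCov x (n / T) t) (iterate τ x (n / T) i₀ t) j -
          Matrix.toEuclideanLin M (iterate τ x (n / T) i₀ t) j| ≤ η) →
      (∀ u : Vec d, nnz u ≤ r → ‖u‖ ≤ 1 → |quadForm (empCov x) u - quadForm M u| ≤ η') →
      ∀ u, IsRTPMOutput τ T x u → ‖u‖ = 1 ∧
        (1 - ε - β) * eigval hM.isHermitian 1 ≤ quadForm M u := by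
  have hk' : (1 : ℝ) ≤ k := by exact_mod_cast hmod.one_le_k
  have hs' : (1 : ℝ) ≤ s := by exact_mod_cast hmod.one_le_s
  obtain ⟨i, hi1, hik, hlam1, hgap⟩ := exists_eigval_gap hM hmod.one_le_k hβ0 hβγ hmod.gamma_lt
    hmod.eigval_pos hmod.gap
  set e := eigval hM.isHermitian with he
  set lam := e i with hlam
  set g := β / k with hg
  have hγ := hmod.gamma_lt
  have hg0 : 0 < g := by positivity
  have hg1 : g ≤ 1 := (div_le_self hβ0.le hk').trans (by linarith)
  have hkd := hmod.k_le_d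
  have hlk : e k ≤ lam := eigval_anti hM hi1 hik
  have hk0 : 0 < e k := hmod.eigval_pos
  have hlam0 : 0 < lam := lt_of_lt_of_le hk0 hlk
  have hl1 : lam ≤ e 1 := eigval_anti hM le_rfl hi1
  set V := upperSpace hM.isHermitian lam with hV
  set S := Finset.univ.filter (fun j : Fin d => ∃ i, v i j ≠ 0) with hS
  have hVS : ∀ y ∈ V, ∀ j ∉ S, y j = 0 := by
    intro y hy j hj
    have h1 : y ∈ Submodule.span ℝ (Set.range v) := by
      rw [hmod.span_eq]; exact upperSpace_le_topEigenspace hlk hy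
    have hj' : ∀ i, v i j = 0 := by simpa [hS] using hj
    refine Submodule.span_induction (p := fun y _ => y j = 0) ?_ ?_ ?_ ?_ h1
    · rintro _ ⟨l, rfl⟩; exact hj' l
    · rfl
    · intro a b _ _ ha hb; rw [PiLp.add_apply, ha, hb, add_zero]
    · intro c a _ ha; rw [PiLp.smul_apply, ha, smul_zero]
  obtain ⟨j1, hj1⟩ := exists_eigenvalues_eq_eigval (hM := hM.isHermitian) le_rfl
    (hmod.one_le_k.trans hkd)
  obtain ⟨i₀, hi₀⟩ := exists_single_correlated hVS hmod.support
    (b := hM.isHermitian.eigenvectorBasis j1)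
    (eigenvectorBasis_mem_upperSpace (by rw [hj1]; exact hl1))
    (hM.isHermitian.eigenvectorBasis.orthonormal.1 j1)
  -- The start is fixed before the samples and the tie-breaking rule, so the noise along this single
  -- restart is all that the convergence needs.
  refine ⟨i₀, fun τ x hnoise hunif u hu => ?_⟩
  have hcs : (s : ℝ) ^ 2 * (k : ℝ) ^ 2 / β ^ 2 = (s / g) ^ 2 := by rw [hg]; field_simp
  rw [hcs] at hr
  have hsg : (s : ℝ) ≤ s / g := by rw [le_div_iff₀ hg0]; nlinarith only [hs', hg1]
  have hs2 : (s : ℝ) ≤ (s / g) ^ 2 := by nlinarith only [hs', hsg]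
  have hsr : s < r := by
    have : (s : ℝ) < r := by linarith
    exact_mod_cast this
  have hss : √(s : ℝ) ^ 2 = s := Real.sq_sqrt (by linarith)
  have hss0 : 0 < √(s : ℝ) := Real.sqrt_pos.2 (by linarith)
  -- ω = g/(32√s) is the largest loss that the contraction tolerates. Then s ≤ ω²(r - s) asks for r
  -- - s ≥ 1024(s/g)², and r ≥ 1025(s/g)² suffices because s ≤ (s/g)².
  have hconv := truncated_power_converges hVS hmod.one_le_s hmod.support hsr hrd τ
    (ω := g / (32 * √(s : ℝ))) hlam0 hg0 hg1 hε0 hε1.le hη0 (by positivity)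
    (fun y hy => upperSpace_mul hlam0.le hy)
    (fun z hz => upperSpace_orthogonal_mul (hM := hM) (mul_nonneg (by linarith) hlam0.le)
      (fun j hj => (eigenvalues_le_of_lt (hM := hM) hi1 (hik.trans hkd) j hj).trans hgap) hz)
    (by
      have h1 : 1024 * (s / g) ^ 2 ≤ (r : ℝ) - s := by linarith
      have h2 : (g / (32 * √(s : ℝ))) ^ 2 * (1024 * (s / g) ^ 2) = s := by
        rw [div_pow, mul_pow, hss]; field_simp; ring
      calc (s : ℝ) = (g / (32 * √(s : ℝ))) ^ 2 * (1024 * (s / g) ^ 2) := h2.symm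
        _ ≤ _ := mul_le_mul_of_nonneg_left h1 (sq_nonneg _))
    (le_of_eq (by field_simp))
    (hη.trans (mul_le_mul_of_nonneg_left hlk (by positivity)))
    (fun t => batchCov x (n / T) t) (fun t => iterate τ x (n / T) i₀ t)
    (by simp [iterate]) hi₀ (fun t => rfl) T hnoise
  have hgT : 4 * Real.log (s / ε) ≤ g * T := by
    have : g * (4 * ((k : ℝ) * Real.log (s / ε) / β)) ≤ g * T :=
      mul_le_mul_of_nonneg_left hT hg0.le
    have h2 : g * (4 * ((k : ℝ) * Real.log (s / ε) / β)) = 4 * Real.log (s / ε) := by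
      rw [hg]; field_simp
    linarith
  rw [max_eq_right (pow_mul_sqrt_le hmod.one_le_s hg1 hε0 hε1 hgT)] at hconv
  obtain ⟨hn1, hq⟩ := hconv
  set w := iterate τ x (n / T) i₀ T with hw
  have hpq := norm_sq_starProjection_add V w
  rw [hn1, one_pow] at hpq
  have hq2 : ‖w - V.starProjection w‖ ^ 2 ≤ ε / 4 * ‖V.starProjection w‖ ^ 2 := by
    have := pow_le_pow_left₀ (norm_nonneg _) hq 2
    rwa [mul_pow, div_pow, Real.sq_sqrt hε0.le, show (2 : ℝ) ^ 2 = 4 by norm_num] at this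
  have hp : 1 - ε / 4 ≤ ‖V.starProjection w‖ ^ 2 := by
    have hP1 : ‖V.starProjection w‖ ^ 2 ≤ 1 := by linarith [sq_nonneg ‖w - V.starProjection w‖]
    linarith [mul_le_mul_of_nonneg_left hP1 (by positivity : 0 ≤ ε / 4)]
  have hwM : lam * (1 - ε / 4) ≤ quadForm M w :=
    (mul_le_mul_of_nonneg_left hp hlam0.le).trans (quadForm_ge_of_upperSpace hM w)
  have hsp : ∀ j, nnz (iterate τ x (n / T) j T) ≤ r := by
    obtain ⟨t, rfl⟩ := Nat.exists_eq_succ_of_ne_zero hT0.ne'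
    exact fun j => nnz_tpmStep_le _ _ _
  -- The winner depends on all the samples and may come from another restart, so the uniform bound
  -- is used for it and for w. Each use costs (ε/4)λ_k, on top of the (ε/4)λ_i that w loses by not
  -- lying in V.
  have hw2 := (abs_le.1 (hunif w (hsp i₀) hn1.le)).1
  obtain ⟨i, hmax, rfl⟩ := hu
  have hu2 := (abs_le.1 (hunif _ (hsp i) (norm_iterate_le τ x (n / T) i T))).2
  have hmax' := hmax i₀
  have hlow : (1 - 3 * ε / 4) * lam ≤ quadForm M (iterate τ x (n / T) i T) := by
    have := mul_le_mul_of_nonneg_left hlk (by linarith : 0 ≤ ε / 2)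
    linarith
  have hfin : (1 - ε - β) * e 1 ≤ (1 - 3 * ε / 4) * lam := by
    have h1 : (1 - 3 * ε / 4) * ((1 - β) * e 1) ≤ (1 - 3 * ε / 4) * lam :=
      mul_le_mul_of_nonneg_left hlam1 (by linarith)
    have he1 : 0 < e 1 := hlam0.trans_le hl1
    refine le_trans ?_ h1
    rw [← mul_assoc]
    refine mul_le_mul_of_nonneg_right ?_ he1.le
    nlinarith only [mul_pos hε0 hβ0, hε0]
  refine ⟨?_, hfin.trans hlow⟩
  -- An iterate after the start is a unit vector or 0; the positive lower bound on its quadratic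
  -- form excludes 0.
  have hne : iterate τ x (n / T) i T ≠ 0 := by
    intro h0
    rw [h0] at hlow
    have : quadForm M (0 : Vec d) = 0 := by simp [quadForm]
    rw [this] at hlow
    have : 0 < (1 - 3 * ε / 4) * lam := mul_pos (by linarith) hlam0
    linarith
  obtain ⟨t, rfl⟩ := Nat.exists_eq_succ_of_ne_zero hT0.ne'
  exact norm_tpmStep_eq_one hne

/-- A union bound over the two kinds of bad events. -/
lemma measure_good_ge {s k T : ℕ} {γ σ δ ε β ζ ζ' : ℝ} {M : Mat d}
    {hM : M.PosSemidef} {v : Fin k → Vec d} {D : Measure (Vec d)} [IsProbabilityMeasure D]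
    (hmod : GeneralSparseKPCA s k γ σ M hM v D) (hε0 : 0 < ε) (hε1 : ε < 1 / 2) (hβ0 : 0 < β)
    (hβγ : β ≤ γ) (hrd : r ≤ d) (hr : 1025 * ((s : ℝ) ^ 2 * (k : ℝ) ^ 2 / β ^ 2) ≤ r)
    (hr0 : 0 < r) (hT : 4 * ((k : ℝ) * Real.log (s / ε) / β) ≤ T) (hT0 : 0 < T) (hTn : T ≤ n)
    (hδ : 0 < δ) (hζ0 : 0 < ζ) (hζ1 : ζ ≤ 1) (hζ0' : 0 < ζ') (hζ1' : ζ' ≤ 1)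
    (hη : √(2 * r) * (2 * ζ * σ ^ 2) ≤ β / k * √ε / 32 * eigval hM.isHermitian k)
    (hη' : 2 * (ζ' * σ ^ 2) ≤ ε / 4 * eigval hM.isHermitian k)
    (hp : (d : ℝ) * T * (4 * Real.exp (-((n / T : ℕ) * ζ ^ 2 / 1024))) ≤ δ / 2)
    (hp' : (3 * d : ℝ) ^ (4 * r) * (2 * Real.exp (-(n * ζ' ^ 2 / 1024))) ≤ δ / 2)
    (τ : TopRule d r) :
    ENNReal.ofReal (1 - δ) ≤ (Measure.pi (fun _ : Fin n => D))
      {x | ∀ u : Vec d, IsRTPMOutput τ T x u →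
        ‖u‖ = 1 ∧ (1 - ε - β) * eigval hM.isHermitian 1 ≤ quadForm M u} := by
  set μ := Measure.pi (fun _ : Fin n => D) with hμ
  set G := {x : Fin n → Vec d | ∀ u : Vec d, IsRTPMOutput τ T x u →
        ‖u‖ = 1 ∧ (1 - ε - β) * eigval hM.isHermitian 1 ≤ quadForm M u} with hG
  obtain ⟨i₀, hgood⟩ := exists_start_forall_output_good (n := n) hmod hε0 hε1 hβ0 hβγ hrd hr hT hT0
    (by positivity) hη hη'
  have hB : 0 < n / T := Nat.div_pos hTn hT0
  set bad : Fin d × Fin T → Set (Fin n → Vec d) := fun q => {x | 2 * ζ * σ ^ 2 <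
    |Matrix.toEuclideanLin (batchCov x (n / T) q.2) (iterate τ x (n / T) i₀ q.2) q.1 -
      Matrix.toEuclideanLin M (iterate τ x (n / T) i₀ q.2) q.1|} with hbad
  set bad' := {x : Fin n → Vec d | ∃ u : Vec d, nnz u ≤ r ∧ ‖u‖ ≤ 1 ∧
    2 * (ζ' * σ ^ 2) < |quadForm (empCov x) u - quadForm M u|} with hbad'
  have h1 : ∀ q, μ (bad q) ≤ ENNReal.ofReal (4 * Real.exp (-((n / T : ℕ) * ζ ^ 2 / 1024))) :=
    fun q => hmod.subGaussian.measure_iterate_deviation_le hmod.sigma_pos hmod.covariance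
      hM.isHermitian τ i₀ q.1 hB
      ((Nat.mul_le_mul_left _ q.2.isLt).trans (Nat.div_mul_le_self n T)) hζ0 hζ1
  have h2 : μ bad' ≤ ENNReal.ofReal (δ / 2) :=
    (hmod.subGaussian.measure_exists_sparse_deviation_le hmod.sigma_pos hmod.covariance
      hM.isHermitian (hr0.trans_le hrd) hr0 (hT0.trans_le hTn) hζ0' hζ1').trans
      (ENNReal.ofReal_le_ofReal hp')
  have h3 : μ (⋃ q, bad q) ≤ ENNReal.ofReal (δ / 2) := by
    refine (measure_iUnion_fintype_le _ _).trans ((Finset.sum_le_sum fun q _ => h1 q).trans ?_)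
    rw [Finset.sum_const, nsmul_eq_mul, Finset.card_univ, Fintype.card_prod, Fintype.card_fin,
      Fintype.card_fin, ← ENNReal.ofReal_natCast, ← ENNReal.ofReal_mul (Nat.cast_nonneg _)]
    exact ENNReal.ofReal_le_ofReal (by push_cast; exact hp)
  -- Measurability of G is never needed: a cover of the whole space and subadditivity of the outer
  -- measure give the lower bound.
  have hcover : (Set.univ : Set (Fin n → Vec d)) ⊆ G ∪ ((⋃ q, bad q) ∪ bad') := by
    intro x _
    by_cases hx : x ∈ (⋃ q, bad q) ∪ bad'
    · exact Or.inr hx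
    · left
      simp only [Set.mem_union, Set.mem_iUnion, not_or, not_exists, hbad, hbad',
        Set.mem_ofPred_eq, not_and, not_lt] at hx
      exact hgood τ x (fun t ht j => hx.1 (j, ⟨t, ht⟩)) hx.2
  have h4 : (1 : ENNReal) ≤ μ G + ENNReal.ofReal δ := by
    calc (1 : ENNReal) = μ Set.univ := measure_univ.symm
      _ ≤ μ (G ∪ ((⋃ q, bad q) ∪ bad')) := measure_mono hcover
      _ ≤ μ G + (μ (⋃ q, bad q) + μ bad') :=
        (measure_union_le _ _).trans (add_le_add le_rfl (measure_union_le _ _))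
      _ ≤ μ G + (ENNReal.ofReal (δ / 2) + ENNReal.ofReal (δ / 2)) :=
        add_le_add le_rfl (add_le_add h3 h2)
      _ = μ G + ENNReal.ofReal δ := by
        rw [← ENNReal.ofReal_add (by positivity) (by positivity), add_halves]
  rw [ENNReal.ofReal_sub _ hδ.le, ENNReal.ofReal_one]
  exact tsub_le_iff_right.2 h4

end Output

/-! ### Numerical consequences of the sample size. -/

section Numerics

variable {d n r s T : ℕ} {K X κ ε δ : ℝ}

lemma half_le_log_div (hs : 1 ≤ s) (hε0 : 0 < ε) (hε1 : ε < 1 / 2) :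
    1 / 2 ≤ Real.log (s / ε) := by
  have hs' : (1 : ℝ) ≤ s := by exact_mod_cast hs
  have h1 : (2 : ℝ) ≤ s / ε := by rw [le_div_iff₀ hε0]; linarith
  have h2 := Real.log_le_log two_pos h1
  linarith [Real.log_two_gt_d9]

/-- The lower bound on r and r ≤ d force d ≥ 1025, so dT/δ is large and its logarithm is at least 1.
-/
lemma one_le_log_div (hd : 1025 ≤ d) (hT : 1 ≤ T) (hδ0 : 0 < δ) (hδ1 : δ < 1) :
    1025 ≤ (d : ℝ) * T / δ ∧ 1 ≤ Real.log ((d : ℝ) * T / δ) := by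
  have hd' : (1025 : ℝ) ≤ d := by exact_mod_cast hd
  have hT' : (1 : ℝ) ≤ T := by exact_mod_cast hT
  have h1 : 1025 ≤ (d : ℝ) * T / δ := by rw [le_div_iff₀ hδ0]; nlinarith
  refine ⟨h1, ?_⟩
  rw [Real.le_log_iff_exp_le (by linarith)]
  linarith [Real.exp_one_lt_d9]

lemma four_mul_exp_le {N : ℝ} (hd : 1025 ≤ d) (hT : 1 ≤ T) (hδ0 : 0 < δ) (hδ1 : δ < 1)
    (hN : 2 * Real.log ((d : ℝ) * T / δ) ≤ N) : (d : ℝ) * T * (4 * Real.exp (-N)) ≤ δ / 2 := by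
  obtain ⟨hY, -⟩ := one_le_log_div hd hT hδ0 hδ1
  set Y := (d : ℝ) * T / δ with hYd
  have hY0 : 0 < Y := by linarith
  have h1 : Real.exp (-N) ≤ (Y ^ 2)⁻¹ := by
    rw [Real.exp_neg]
    refine inv_anti₀ (by positivity) ?_
    calc Y ^ 2 = Real.exp ((2 : ℕ) * Real.log Y) := by rw [Real.exp_nat_mul, Real.exp_log hY0]
      _ ≤ Real.exp N := Real.exp_le_exp.2 (by push_cast; exact hN)
  have h2 : (d : ℝ) * T = δ * Y := by rw [hYd]; field_simp
  rw [h2]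
  calc δ * Y * (4 * Real.exp (-N)) ≤ δ * Y * (4 * (Y ^ 2)⁻¹) := by gcongr
    _ = 4 * δ / Y := by field_simp
    _ ≤ δ / 2 := by rw [div_le_iff₀ hY0]; nlinarith

/-- With Y = dT/δ, 3d ≤ Y² bounds the size of the net by Y^(8r). The exponent 10 r log Y leaves
Y^(-2r), which beats δ because δY ≥ 1. -/
lemma pow_mul_exp_le {N : ℝ} (hd : 1025 ≤ d) (hT : 1 ≤ T) (hr : 1 ≤ r) (hδ0 : 0 < δ) (hδ1 : δ < 1)
    (hN : 10 * r * Real.log ((d : ℝ) * T / δ) ≤ N) :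
    (3 * d : ℝ) ^ (4 * r) * (2 * Real.exp (-N)) ≤ δ / 2 := by
  obtain ⟨hY, -⟩ := one_le_log_div hd hT hδ0 hδ1
  have hT' : (1 : ℝ) ≤ T := by exact_mod_cast hT
  have hd' : (1025 : ℝ) ≤ d := by exact_mod_cast hd
  set Y := (d : ℝ) * T / δ with hYd
  have hY0 : 0 < Y := by linarith
  have hdY : (d : ℝ) ≤ Y := by rw [hYd, le_div_iff₀ hδ0]; nlinarith
  have hδY : 1 ≤ δ * Y := by
    have : δ * Y = d * T := by rw [hYd]; field_simp
    rw [this]; nlinarith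
  have h1 : Real.exp (-N) ≤ (Y ^ (10 * r))⁻¹ := by
    rw [Real.exp_neg]
    refine inv_anti₀ (by positivity) ?_
    calc Y ^ (10 * r) = Real.exp ((10 * r : ℕ) * Real.log Y) := by
          rw [Real.exp_nat_mul, Real.exp_log hY0]
      _ ≤ Real.exp N := Real.exp_le_exp.2 (by push_cast; exact hN)
  have h2 : (3 * d : ℝ) ^ (4 * r) ≤ Y ^ (8 * r) := by
    calc (3 * d : ℝ) ^ (4 * r) ≤ (Y ^ 2) ^ (4 * r) :=
          pow_le_pow_left₀ (by positivity) (by nlinarith) _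
      _ = Y ^ (8 * r) := by rw [← pow_mul]; congr 1; ring
  calc (3 * d : ℝ) ^ (4 * r) * (2 * Real.exp (-N)) ≤ Y ^ (8 * r) * (2 * (Y ^ (10 * r))⁻¹) := by
        gcongr
    _ = 2 / Y ^ (2 * r) := by
        have : Y ^ (10 * r) = Y ^ (8 * r) * Y ^ (2 * r) := by rw [← pow_add]; congr 1; ring
        rw [this]; field_simp
    _ ≤ 2 / Y ^ 2 := by
        gcongr
        · linarith
        · omega
    _ ≤ δ / 2 := by
        rw [div_le_iff₀ (by positivity)]; nlinarith

/-- X is k/β and κ is σ²/λ_k. A batch of size n/T must exceed a multiple of K²s²κ²X⁴L/ε; multiplying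
by T, at most of order K X log(s/ε), gives the X⁵/ε term and K³. The uniform bound requires n(ε/κ)²
of order rL, with r at most of order K s²X²; this is the X²/ε² term. The bounds κ ≥ 1/8 and log(s/ε)
≥ 1/2 serve to absorb the factors that a requirement lacks. -/
lemma sample_size_consequences (hs : 1 ≤ s) (hK : 1 ≤ K) (hX : 1 ≤ X) (hκ : 1 / 8 ≤ κ)
    (hε0 : 0 < ε) (hε1 : ε < 1 / 2) {L : ℝ} (hL : 1 ≤ L)
    (hr : (r : ℝ) ≤ K * (1025 * ((s : ℝ) ^ 2 * X ^ 2)))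
    (hT0 : 1 ≤ T) (hT : (T : ℝ) ≤ K * (4 * (X * Real.log (s / ε))))
    (hn : 200000000000 * K ^ 3 * (κ ^ 2 * (s : ℝ) ^ 2 * (X ^ 5 / ε + X ^ 2 / ε ^ 2) * L *
      Real.log (s / ε)) ≤ n) :
    T * r ≤ n ∧ T ≤ n ∧
      2 * L ≤ (n / T : ℕ) * (√ε / (2944 * K * s * κ * X ^ 2)) ^ 2 / 1024 ∧
      10 * r * L ≤ n * (ε / (8 * κ)) ^ 2 / 1024 := by
  have hs' : (1 : ℝ) ≤ s := by exact_mod_cast hs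
  have hl := half_le_log_div hs hε0 hε1
  set l := Real.log (s / ε) with hl'
  have hK0 : 0 < K := by linarith
  have hX0 : 0 < X := by linarith
  have hκ0 : 0 < κ := by linarith
  have hl0 : 0 < l := by linarith
  have hL0 : 0 < L := by linarith
  have hTp : (0 : ℝ) < T := by exact_mod_cast hT0
  have hK3 : K ≤ K ^ 3 ∧ K ^ 2 ≤ K ^ 3 :=
    ⟨le_self_pow₀ hK (by norm_num), pow_le_pow_right₀ hK (by norm_num)⟩
  have hn1 : 200000000000 * K ^ 3 * (κ ^ 2 * (s : ℝ) ^ 2 * (X ^ 5 / ε) * L * l) ≤ n := by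
    refine le_trans ?_ hn
    gcongr
    exact le_add_of_nonneg_right (by positivity)
  have hn2 : 200000000000 * K ^ 3 * (κ ^ 2 * (s : ℝ) ^ 2 * (X ^ 2 / ε ^ 2) * L * l) ≤ n := by
    refine le_trans ?_ hn
    gcongr
    exact le_add_of_nonneg_left (by positivity)
  have hκ2 : 1 / 64 ≤ κ ^ 2 := by nlinarith
  have hX3 : X ^ 3 ≤ X ^ 5 / ε := by
    rw [le_div_iff₀ hε0]
    calc X ^ 3 * ε ≤ X ^ 3 * 1 := by gcongr; linarith
      _ = X ^ 3 := mul_one _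
      _ ≤ X ^ 5 := pow_le_pow_right₀ hX (by norm_num)
  have hX1 : X ≤ X ^ 3 := le_self_pow₀ hX (by norm_num)
  have hbase : 3125000000 * K ^ 3 * ((s : ℝ) ^ 2 * X ^ 3 * l) ≤ n := by
    refine le_trans ?_ hn1
    calc 3125000000 * K ^ 3 * ((s : ℝ) ^ 2 * X ^ 3 * l)
        = 200000000000 * K ^ 3 * (1 / 64 * (s : ℝ) ^ 2 * X ^ 3 * 1 * l) := by ring
      _ ≤ _ := by gcongr
  have hTr : (T : ℝ) * r ≤ n := by
    refine le_trans ?_ hbase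
    calc (T : ℝ) * r ≤ K * (4 * (X * l)) * (K * (1025 * ((s : ℝ) ^ 2 * X ^ 2))) := by gcongr
      _ = 4100 * K ^ 2 * ((s : ℝ) ^ 2 * X ^ 3 * l) := by ring
      _ ≤ 3125000000 * K ^ 3 * ((s : ℝ) ^ 2 * X ^ 3 * l) := by
        have := hK3.2
        gcongr ?_ * _
        nlinarith
  have hTn : (T : ℝ) ≤ n := by
    refine le_trans (hT.trans ?_) hbase
    have hs2 : 1 ≤ (s : ℝ) ^ 2 := one_le_pow₀ hs'
    calc K * (4 * (X * l)) = 4 * K * (1 * X * l) := by ring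
      _ ≤ 4 * K ^ 3 * ((s : ℝ) ^ 2 * X ^ 3 * l) := by
        have := hK3.1
        gcongr
      _ ≤ 3125000000 * K ^ 3 * ((s : ℝ) ^ 2 * X ^ 3 * l) := by gcongr; norm_num
  have hTn' : T ≤ n := by exact_mod_cast hTn
  refine ⟨by exact_mod_cast hTr, hTn', ?_, ?_⟩
  -- Rounding n/T down loses at most a factor 2, since the quotient is at least 1.
  · have hB : (n : ℝ) ≤ 2 * (n / T : ℕ) * T := by
      have h1 : n < T * (n / T) + T := by
        have := Nat.div_add_mod n T; have := Nat.mod_lt n hT0; omega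
      have h2 : 1 ≤ n / T := Nat.div_pos hTn' hT0
      have h3 : n ≤ 2 * (n / T) * T := by nlinarith
      exact_mod_cast h3
    set B : ℝ := ((n / T : ℕ) : ℝ) with hBd
    have hB0 : 0 ≤ B := Nat.cast_nonneg _
    have h4 : 200000000000 * K ^ 3 * (κ ^ 2 * (s : ℝ) ^ 2 * (X ^ 5 / ε) * L * l) ≤
        B * (8 * K * X * l) := by
      refine hn1.trans (hB.trans ?_)
      calc 2 * B * T ≤ 2 * B * (K * (4 * (X * l))) := by gcongr
        _ = _ := by ring
    have h5 : 25000000000 * K ^ 2 * κ ^ 2 * (s : ℝ) ^ 2 * X ^ 4 * L / ε ≤ B := by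
      have h6 : 0 < 8 * K * X * l := by positivity
      refine le_of_mul_le_mul_right (le_trans (le_of_eq ?_) h4) h6
      field_simp; ring
    have h7 : B * (√ε / (2944 * K * s * κ * X ^ 2)) ^ 2 / 1024 =
        B * (ε / (1024 * 2944 ^ 2 * K ^ 2 * s ^ 2 * κ ^ 2 * X ^ 4)) := by
      rw [div_pow, Real.sq_sqrt hε0.le]; field_simp
    rw [h7]
    calc 2 * L ≤ 25000000000 / (1024 * 2944 ^ 2) * L := by
          gcongr; norm_num
      _ = 25000000000 * K ^ 2 * κ ^ 2 * (s : ℝ) ^ 2 * X ^ 4 * L / ε *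
          (ε / (1024 * 2944 ^ 2 * K ^ 2 * s ^ 2 * κ ^ 2 * X ^ 4)) := by field_simp
      _ ≤ _ := by gcongr
  · have h8 : 200000000000 * K ^ 3 * (κ ^ 2 * (s : ℝ) ^ 2 * (X ^ 2 / ε ^ 2) * L * l) *
        (ε / (8 * κ)) ^ 2 / 1024 ≤ n * (ε / (8 * κ)) ^ 2 / 1024 := by gcongr
    refine le_trans ?_ h8
    calc 10 * (r : ℝ) * L ≤ 10 * (K * (1025 * ((s : ℝ) ^ 2 * X ^ 2))) * L := by gcongr
      _ = 10250 * K * ((s : ℝ) ^ 2 * X ^ 2 * L) := by ring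
      _ ≤ 3051757 * K ^ 3 * l * ((s : ℝ) ^ 2 * X ^ 2 * L) := by
        have h9 : 10250 * K ≤ 3051757 * K ^ 3 * l := by
          have : K ^ 3 * (1 / 2) ≤ K ^ 3 * l := by gcongr
          linarith [hK3.1]
        gcongr
      _ ≤ 200000000000 / 65536 * K ^ 3 * l * ((s : ℝ) ^ 2 * X ^ 2 * L) := by
        gcongr; norm_num
      _ = _ := by field_simp; ring

end Numerics

/-! ### The statistical guarantee with explicit constants. -/

section Guarantee

variable {d n : ℕ}

/-- λ_k is the variance in some unit direction. This bounds σ²/λ_k below by 1/8, so the sample size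
cannot be made trivial by a small ratio. -/
lemma GeneralSparseKPCA.eigval_le {s k : ℕ} {γ σ : ℝ} {M : Mat d} {hM : M.PosSemidef}
    {v : Fin k → Vec d} {D : Measure (Vec d)} [IsProbabilityMeasure D]
    (hmod : GeneralSparseKPCA s k γ σ M hM v D) : eigval hM.isHermitian k ≤ 8 * σ ^ 2 := by
  obtain ⟨j, hj⟩ := exists_eigenvalues_eq_eigval (hM := hM.isHermitian) hmod.one_le_k hmod.k_le_d
  have hb := hM.isHermitian.eigenvectorBasis.orthonormal.1 j
  have h1 := hmod.subGaussian.quadForm_le hmod.sigma_pos hmod.covariance hb.le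
  rw [quadForm_eq_inner, toEuclideanLin_eigenvectorBasis, inner_smul_right,
    real_inner_self_eq_norm_sq, hb, hj] at h1
  simpa using h1

/-- The parameters of the theorem, with the constants chosen. -/
lemma GeneralSparseKPCA.sample_size {s k r T : ℕ} {γ σ δ ε β K : ℝ} {M : Mat d}
    {hM : M.PosSemidef} {v : Fin k → Vec d} {D : Measure (Vec d)} [IsProbabilityMeasure D]
    (hmod : GeneralSparseKPCA s k γ σ M hM v D) (hK : 1 ≤ K) (hδ0 : 0 < δ) (hδ1 : δ < 1)
    (hε0 : 0 < ε) (hε1 : ε < 1 / 2) (hβ0 : 0 < β) (hβγ : β ≤ γ) (hrd : r ≤ d)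
    (hr : 1025 * ((s : ℝ) ^ 2 * (k : ℝ) ^ 2 / β ^ 2) ≤ r)
    (hr' : (r : ℝ) ≤ K * (1025 * ((s : ℝ) ^ 2 * (k : ℝ) ^ 2 / β ^ 2)))
    (hT : 4 * ((k : ℝ) * Real.log (s / ε) / β) ≤ T)
    (hT' : (T : ℝ) ≤ K * (4 * ((k : ℝ) * Real.log (s / ε) / β)))
    (hn : 200000000000 * K ^ 3 * ((σ ^ 2 / eigval hM.isHermitian k) ^ 2 * (s : ℝ) ^ 2 *
        ((k : ℝ) ^ 5 / (ε * β ^ 5) + (k : ℝ) ^ 2 / (ε ^ 2 * β ^ 2)) *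
        Real.log ((d : ℝ) * (T : ℝ) / δ) * Real.log ((s : ℝ) / ε)) ≤ (n : ℝ)) :
    (1 ≤ T ∧ 1 ≤ r ∧ T * r ≤ n ∧ T ≤ n) ∧ ∀ τ : TopRule d r,
      ENNReal.ofReal (1 - δ) ≤ (Measure.pi (fun _ : Fin n => D))
        {x | ∀ u : Vec d, IsRTPMOutput τ T x u →
          ‖u‖ = 1 ∧ (1 - ε - β) * eigval hM.isHermitian 1 ≤ quadForm M u} := by
  have hs := hmod.one_le_s
  have hs' : (1 : ℝ) ≤ s := by exact_mod_cast hs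
  have hk' : (1 : ℝ) ≤ k := by exact_mod_cast hmod.one_le_k
  have hβ1 : β ≤ 1 := by linarith [hmod.gamma_lt]
  have hl := half_le_log_div hs hε0 hε1
  have he0 := hmod.eigval_pos
  have he8 := hmod.eigval_le
  have hσ := hmod.sigma_pos
  set e := eigval hM.isHermitian k with he
  set l := Real.log (s / ε) with hld
  set X := (k : ℝ) / β with hX
  have hX1 : 1 ≤ X := by rw [hX, le_div_iff₀ hβ0]; linarith
  have hX0 : 0 < X := by linarith
  set κ := σ ^ 2 / e with hκ
  have hκ8 : 1 / 8 ≤ κ := by rw [hκ, le_div_iff₀ he0]; linarith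
  have hκ0 : 0 < κ := by linarith
  have e1 : (s : ℝ) ^ 2 * (k : ℝ) ^ 2 / β ^ 2 = (s : ℝ) ^ 2 * X ^ 2 := by
    rw [hX, div_pow]; ring
  have e2 : (k : ℝ) * l / β = X * l := by rw [hX]; ring
  have e3 : (k : ℝ) ^ 5 / (ε * β ^ 5) + (k : ℝ) ^ 2 / (ε ^ 2 * β ^ 2) =
      X ^ 5 / ε + X ^ 2 / ε ^ 2 := by rw [hX]; field_simp
  have hr1 := hr
  rw [e1] at hr1 hr'
  have hT1 := hT
  rw [e2] at hT1 hT'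
  rw [e3] at hn
  have hT0 : 1 ≤ T := by
    have h : (0 : ℝ) < T := lt_of_lt_of_le (by positivity) hT1
    exact_mod_cast h
  have hsX : 1 ≤ (s : ℝ) ^ 2 * X ^ 2 :=
    one_le_mul_of_one_le_of_one_le (one_le_pow₀ hs') (one_le_pow₀ hX1)
  have hr1025 : 1025 ≤ r := by
    have h : (1025 : ℝ) ≤ r := by linarith
    exact_mod_cast h
  have hd := hr1025.trans hrd
  obtain ⟨-, hL⟩ := one_le_log_div hd hT0 hδ0 hδ1
  obtain ⟨c1, c2, c3, c4⟩ := sample_size_consequences hs hK hX1 hκ8 hε0 hε1 hL hr' hT0 hT' hn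
  refine ⟨⟨hT0, by omega, c1, c2⟩, fun τ => ?_⟩
  have hsε0 : 0 < √ε := Real.sqrt_pos.2 hε0
  have hsε1 : √ε ≤ 1 := by rw [Real.sqrt_le_one]; linarith
  have hden : 1 ≤ 2944 * K * s * κ * X ^ 2 := by
    have h1 : 1 ≤ 2944 * κ := by linarith
    have h2 : 1 ≤ K * s := one_le_mul_of_one_le_of_one_le hK hs'
    have h3 : 1 ≤ X ^ 2 := one_le_pow₀ hX1
    have := one_le_mul_of_one_le_of_one_le (one_le_mul_of_one_le_of_one_le h1 h2) h3
    linarith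
  -- From √(2r) ≤ 46KsX (as 2050K ≤ 46²K²) and 2944 = 32 · 2 · 46, the noise term is at most √ε
  -- λ_k/(32X), the allowed level. The choice of ζ' makes 2ζ'σ² equal to (ε/4)λ_k.
  refine measure_good_ge hmod hε0 hε1 hβ0 hβγ hrd hr (by omega) hT hT0 c2 hδ0
    (ζ := √ε / (2944 * K * s * κ * X ^ 2)) (ζ' := ε / (8 * κ)) (by positivity) ?_ (by positivity)
    ?_ ?_ ?_ (four_mul_exp_le hd hT0 hδ0 hδ1 c3) (pow_mul_exp_le hd hT0 (by omega) hδ0 hδ1 c4) τ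
  · rw [div_le_one (by linarith)]; linarith
  · rw [div_le_one (by positivity)]; linarith
  · have h1 : √(2 * (r : ℝ)) ≤ 46 * K * s * X := by
      rw [Real.sqrt_le_left (by positivity)]
      calc 2 * (r : ℝ) ≤ 2 * (K * (1025 * ((s : ℝ) ^ 2 * X ^ 2))) := by linarith
        _ = 2050 * K * ((s : ℝ) ^ 2 * X ^ 2) := by ring
        _ ≤ 2116 * K ^ 2 * ((s : ℝ) ^ 2 * X ^ 2) := by
          gcongr ?_ * _
          nlinarith
        _ = _ := by ring
    have h2 : σ ^ 2 = κ * e := by rw [hκ]; field_simp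
    calc √(2 * (r : ℝ)) * (2 * (√ε / (2944 * K * s * κ * X ^ 2)) * σ ^ 2)
        ≤ 46 * K * s * X * (2 * (√ε / (2944 * K * s * κ * X ^ 2)) * σ ^ 2) := by gcongr
      _ = √ε / (32 * X) * e := by rw [h2]; field_simp; norm_num
      _ = β / k * √ε / 32 * e := by rw [hX]; field_simp
      _ ≤ _ := le_rfl
  · have h2 : σ ^ 2 = κ * e := by rw [hκ]; field_simp
    rw [h2]
    rw [← he]
    apply le_of_eq
    field_simp; norm_num

end Guarantee

/-! ### Frame property and invariant rule for programs. -/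

section ProgramLogic

/-- The registers that a program may write. -/
def Cmd.regs : Cmd → Finset ℕ
  | .skip => ∅
  | .setNat x _ => {x}
  | .setReal _ _ _ _ => ∅
  | .seq c₁ c₂ => c₁.regs ∪ c₂.regs
  | .ifNatLt _ _ c₁ c₂ => c₁.regs ∪ c₂.regs
  | .ifRealLt _ _ c₁ c₂ => c₁.regs ∪ c₂.regs
  | .loop x _ c => {x} ∪ c.regs

/-- The arrays that a program may write. -/
def Cmd.arrs : Cmd → Finset ℕ
  | .skip => ∅
  | .setNat _ _ => ∅
  | .setReal a _ _ _ => {a}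
  | .seq c₁ c₂ => c₁.arrs ∪ c₂.arrs
  | .ifNatLt _ _ c₁ c₂ => c₁.arrs ∪ c₂.arrs
  | .ifRealLt _ _ c₁ c₂ => c₁.arrs ∪ c₂.arrs
  | .loop _ _ c => c.arrs

lemma foldl_range_succ {α : Type*} (f : α → ℕ → α) (a : α) (n : ℕ) :
    (List.range (n + 1)).foldl f a = f ((List.range n).foldl f a) n := by
  rw [List.range_succ, List.foldl_append]; rfl

/-- The write sets are syntactic, so that a concrete block leaves a register or an array alone can
be settled by computation. -/
lemma Cmd.exec_frame (c : Cmd) (m : Machine) :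
    (∀ y ∉ c.regs, (c.exec m).reg y = m.reg y) ∧ (∀ a ∉ c.arrs, (c.exec m).mem a = m.mem a) := by
  induction c generalizing m with
  | skip => exact ⟨fun _ _ => rfl, fun _ _ => rfl⟩
  | setNat x e =>
    refine ⟨fun y hy => ?_, fun _ _ => rfl⟩
    have : y ≠ x := by simpa [Cmd.regs] using hy
    simp [Cmd.exec, Machine.tick, Machine.setReg, this]
  | setReal a i j e =>
    refine ⟨fun _ _ => rfl, fun b hb => ?_⟩
    have : b ≠ a := by simpa [Cmd.arrs] using hb
    funext i' j'
    simp [Cmd.exec, Machine.tick, Machine.setMem, this]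
  | seq c₁ c₂ h₁ h₂ =>
    simp only [Cmd.regs, Cmd.arrs, Finset.mem_union, not_or, Cmd.exec]
    exact ⟨fun y hy => ((h₂ _).1 y hy.2).trans ((h₁ _).1 y hy.1),
      fun a ha => ((h₂ _).2 a ha.2).trans ((h₁ _).2 a ha.1)⟩
  | ifNatLt e f c₁ c₂ h₁ h₂ =>
    simp only [Cmd.regs, Cmd.arrs, Finset.mem_union, not_or, Cmd.exec]
    split_ifs
    · exact ⟨fun y hy => (h₁ _).1 y hy.1, fun a ha => (h₁ _).2 a ha.1⟩
    · exact ⟨fun y hy => (h₂ _).1 y hy.2, fun a ha => (h₂ _).2 a ha.2⟩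
  | ifRealLt e f c₁ c₂ h₁ h₂ =>
    simp only [Cmd.regs, Cmd.arrs, Finset.mem_union, not_or, Cmd.exec]
    split_ifs
    · exact ⟨fun y hy => (h₁ _).1 y hy.1, fun a ha => (h₁ _).2 a ha.1⟩
    · exact ⟨fun y hy => (h₂ _).1 y hy.2, fun a ha => (h₂ _).2 a ha.2⟩
  | loop x e c h =>
    simp only [Cmd.regs, Cmd.arrs, Finset.mem_union, Finset.mem_singleton, not_or, Cmd.exec]
    generalize e.eval m = N
    induction N with
    | zero => exact ⟨fun _ _ => rfl, fun _ _ => rfl⟩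
    | succ N ih =>
      rw [foldl_range_succ]
      refine ⟨fun y hy => ?_, fun a ha => ?_⟩
      · rw [(h _).1 y hy.2, ← ih.1 y hy]
        simp [Machine.tick, Machine.setReg, hy.1]
      · rw [(h _).2 a ha, ← ih.2 a ha]
        rfl

/-- The invariant rule for loops, with the frame and the running time. -/
lemma Cmd.loop_rule {x N t : ℕ} {e : NatExp} {c : Cmd} {m : Machine} (hN : e.eval m = N)
    (I : ℕ → (ℕ → ℕ) → (ℕ → ℕ → ℕ → ℝ) → Prop)
    (hI : ∀ i R A v, I i R A → I i (fun y => if y = x then v else R y) A)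
    (h0 : I 0 m.reg m.mem)
    (hs : ∀ i < N, ∀ m' : Machine, m'.reg x = i →
      (∀ y ∉ {x} ∪ c.regs, m'.reg y = m.reg y) → (∀ a ∉ c.arrs, m'.mem a = m.mem a) →
      I i m'.reg m'.mem → I (i + 1) (c.exec m').reg (c.exec m').mem ∧
        (c.exec m').steps ≤ m'.steps + t) :
    I N ((Cmd.loop x e c).exec m).reg ((Cmd.loop x e c).exec m).mem ∧
      ((Cmd.loop x e c).exec m).steps ≤ m.steps + (e.cost + 1 + N * (t + 1)) := by
  simp only [Cmd.exec, hN]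
  -- The counter is reset before every pass, whatever the body did to it; `hI` lets the invariant
  -- survive this. The frame is carried along so that the body may use all the values it never
  -- writes.
  have key : ∀ i ≤ N, ∀ m₁, m₁ = (List.range i).foldl
        (fun m' i => c.exec ((m'.setReg x i).tick 1)) (m.tick (e.cost + 1)) →
      I i m₁.reg m₁.mem ∧ m₁.steps ≤ m.steps + (e.cost + 1 + i * (t + 1)) ∧
      (∀ y ∉ {x} ∪ c.regs, m₁.reg y = m.reg y) ∧ (∀ a ∉ c.arrs, m₁.mem a = m.mem a) := by
    intro i
    induction i with
    | zero =>
      rintro - m₁ rfl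
      exact ⟨h0, by simp [Machine.tick], fun _ _ => rfl, fun _ _ => rfl⟩
    | succ i ih =>
      intro hi m₁ hm₁
      rw [foldl_range_succ] at hm₁
      obtain ⟨h1, h2, h3, h4⟩ := ih (by omega) _ rfl
      set m₀ := (List.range i).foldl
        (fun m' i => c.exec ((m'.setReg x i).tick 1)) (m.tick (e.cost + 1))
      have hreg : ∀ y ∉ {x} ∪ c.regs, ((m₀.setReg x i).tick 1).reg y = m.reg y := by
        intro y hy
        rw [← h3 y hy]
        have : y ≠ x := fun h => hy (by simp [h])
        simp [Machine.tick, Machine.setReg, this]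
      obtain ⟨h5, h6⟩ := hs i (by omega) ((m₀.setReg x i).tick 1)
        (by simp [Machine.tick, Machine.setReg]) hreg h4 (hI _ _ _ _ h1)
      obtain ⟨f1, f2⟩ := c.exec_frame ((m₀.setReg x i).tick 1)
      rw [← hm₁] at h5 h6 f1 f2
      refine ⟨h5, ?_, fun y hy => ?_, fun a ha => (f2 a ha).trans (h4 a ha)⟩
      · have : ((m₀.setReg x i).tick 1).steps = m₀.steps + 1 := rfl
        rw [this] at h6
        have e : (i + 1) * (t + 1) = i * (t + 1) + (t + 1) := by ring
        omega
      · rw [f1 y fun h => hy (Finset.mem_union_right _ h)]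
        exact hreg y hy
  obtain ⟨h1, h2, -, -⟩ := key N le_rfl _ rfl
  exact ⟨h1, h2⟩

end ProgramLogic

/-! ### Program blocks: inner products with data rows. -/

section Blocks

/-- The row `reg 9 + reg 11` of the data. -/
def rowExp : NatExp := .add (.reg 9) (.reg 11)

/-- `⟨x_row, u⟩` into the cell `(0, 0)` of array `6`. -/
def dotCmd : Cmd :=
  .seq (.setReal 6 (.const 0) (.const 0) (.const 0))
    (.loop 8 (.reg 1) (.setReal 6 (.const 0) (.const 0)
      (.add (.read 6 (.const 0) (.const 0))
        (.mul (.read 0 rowExp (.reg 8)) (.read 2 (.const 0) (.reg 8))))))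

/-- Conventions shared by the blocks. Registers: 4 batch size, 5 and 6 scratch for its computation,
7 restart, 8 coordinate, 9 first row of the batch, 10 iteration, 11 row within the batch, 12
selection round, 13 selected index. Arrays: 1 best iterate, 2 iterate u, 3 product w, 4 selection
flags, 6 a scalar (inner product or norm), 7 best square, 8 score, 9 best score. -/
lemma dotCmd_exec (m : Machine) :
    (dotCmd.exec m).mem 6 0 0 =
        ∑ j ∈ Finset.range (m.reg 1), m.mem 0 (m.reg 9 + m.reg 11) j * m.mem 2 0 j ∧
      (dotCmd.exec m).steps ≤ m.steps + 30 * (m.reg 1 + 1) := by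
  unfold dotCmd
  set m₁ := (Cmd.setReal 6 (.const 0) (.const 0) (.const 0)).exec m with hm₁
  have hst : m₁.steps = m.steps + 4 := rfl
  have hreg : m₁.reg = m.reg := rfl
  have hmem : ∀ a ≠ 6, m₁.mem a = m.mem a := fun a ha => by
    funext i j; simp [hm₁, Cmd.exec, Machine.tick, Machine.setMem, ha]
  have h6 : m₁.mem 6 0 0 = 0 := by
    simp [hm₁, Cmd.exec, Machine.tick, Machine.setMem, NatExp.eval, RealExp.eval]
  obtain ⟨h1, h2⟩ := Cmd.loop_rule (x := 8) (N := m.reg 1) (t := 20) (e := .reg 1)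
    (c := .setReal 6 (.const 0) (.const 0)
      (.add (.read 6 (.const 0) (.const 0))
        (.mul (.read 0 rowExp (.reg 8)) (.read 2 (.const 0) (.reg 8))))) (m := m₁) rfl
    (fun i _ A => A 6 0 0 =
      ∑ j ∈ Finset.range i, m.mem 0 (m.reg 9 + m.reg 11) j * m.mem 2 0 j)
    (fun _ _ _ _ h => h) (by simpa using h6)
    (by
      intro i hi m' hx hr ha hI
      constructor
      · rw [Finset.sum_range_succ, ← hI, ← hmem 0 (by decide), ← hmem 2 (by decide),
          ← ha 0 (by decide), ← ha 2 (by decide), ← hreg, ← hr 9 (by decide), ← hr 11 (by decide)]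
        simp [Cmd.exec, Machine.tick, Machine.setMem, NatExp.eval, RealExp.eval, rowExp, hx]
      · simp [Cmd.exec, Machine.tick, Machine.setMem, NatExp.cost, RealExp.cost, rowExp])
  refine ⟨h1, ?_⟩
  simp only [NatExp.cost] at h2
  simp only [Cmd.exec] at h2 ⊢
  refine h2.trans ?_
  rw [hst]; omega

end Blocks

/-! ### Program blocks: matrix-vector products and selection of the largest entries. -/

section Blocks

lemma Cmd.exec_reg_of_notMem {c : Cmd} {y : ℕ} (h : y ∉ c.regs) (m : Machine) :
    (c.exec m).reg y = m.reg y := (c.exec_frame m).1 y h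

lemma Cmd.exec_mem_of_notMem {c : Cmd} {a : ℕ} (h : a ∉ c.arrs) (m : Machine) :
    (c.exec m).mem a = m.mem a := (c.exec_frame m).2 a h

/-- Set `a[0, j]` for all `j` below `reg 1`. -/
def mapCmd (a : ℕ) (E : RealExp) : Cmd :=
  .loop 8 (.reg 1) (.setReal a (.const 0) (.reg 8) E)

/-- The expression may read the cell that is about to be overwritten, so its old value is made
available; nothing is promised about the other cells of the array. -/
lemma mapCmd_exec {a : ℕ} {E : RealExp} (m : Machine) (V : ℕ → ℝ)
    (hE : ∀ m' : Machine, m'.reg 8 < m.reg 1 → (∀ y ≠ 8, m'.reg y = m.reg y) →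
      (∀ b ≠ a, m'.mem b = m.mem b) → m'.mem a 0 (m'.reg 8) = m.mem a 0 (m'.reg 8) →
      E.eval m' = V (m'.reg 8)) :
    (∀ j < m.reg 1, ((mapCmd a E).exec m).mem a 0 j = V j) ∧
      ((mapCmd a E).exec m).steps ≤ m.steps + (E.cost + 6) * (m.reg 1 + 1) := by
  obtain ⟨h1, h2⟩ := Cmd.loop_rule (x := 8) (N := m.reg 1) (t := E.cost + 3) (e := .reg 1)
    (c := .setReal a (.const 0) (.reg 8) E) (m := m) rfl
    (fun i _ A => ∀ j, A a 0 j = if j < i then V j else m.mem a 0 j)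
    (fun _ _ _ _ h => h) (by simp)
    (by
      intro i hi m' hx hr ha hI
      constructor
      · intro j
        have hev : E.eval m' = V i := by
          rw [← hx]
          refine hE m' (by omega) (fun y hy => hr y (by simp [Cmd.regs, hy]))
            (fun b hb => ha b (by simp [Cmd.arrs, hb])) ?_
          rw [hI, if_neg (by omega)]
        simp only [Cmd.exec, Machine.tick, Machine.setMem, NatExp.eval, hx, true_and, hev]
        by_cases hj : j = i
        · simp [hj]
        · rw [if_neg hj, hI]
          by_cases h : j < i
          · rw [if_pos h, if_pos (by omega)]
          · rw [if_neg h, if_neg (by omega)]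
      · simp only [Cmd.exec, Machine.tick, Machine.setMem, NatExp.cost]; omega)
  refine ⟨fun j hj => ?_, ?_⟩
  · have := h1 j
    rwa [if_pos hj] at this
  · refine h2.trans ?_
    simp only [NatExp.cost]
    have : (E.cost + 6) * (m.reg 1 + 1) = m.reg 1 * (E.cost + 3 + 1) + 2 * m.reg 1 + E.cost + 6 := by
      ring
    omega

/-- Add a multiple of the data row to `w`. -/
def axpyCmd : Cmd :=
  mapCmd 3 (.add (.read 3 (.const 0) (.reg 8))
    (.mul (.read 6 (.const 0) (.const 0)) (.read 0 rowExp (.reg 8))))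

lemma axpyCmd_exec (m : Machine) :
    (∀ j < m.reg 1, (axpyCmd.exec m).mem 3 0 j =
        m.mem 3 0 j + m.mem 6 0 0 * m.mem 0 (m.reg 9 + m.reg 11) j) ∧
      (axpyCmd.exec m).steps ≤ m.steps + 30 * (m.reg 1 + 1) := by
  obtain ⟨h1, h2⟩ := mapCmd_exec (a := 3) (E := .add (.read 3 (.const 0) (.reg 8))
    (.mul (.read 6 (.const 0) (.const 0)) (.read 0 rowExp (.reg 8)))) m
    (fun j => m.mem 3 0 j + m.mem 6 0 0 * m.mem 0 (m.reg 9 + m.reg 11) j)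
    (fun m' _ hr ha h3 => by
      simp only [RealExp.eval, NatExp.eval, rowExp, h3, ha 6 (by decide), ha 0 (by decide),
        hr 9 (by decide), hr 11 (by decide)])
  refine ⟨h1, h2.trans ?_⟩
  simp only [RealExp.cost, NatExp.cost, rowExp]; omega

/-- Reset `w` and the flags, and compute `w = ∑ ⟨x_b, u⟩ x_b` over the current batch. -/
def matvecCmd : Cmd :=
  .seq (mapCmd 3 (.const 0)) (.seq (mapCmd 4 (.const 0))
    (.loop 11 (.reg 4) (.seq dotCmd axpyCmd)))

/-- Summing inner products times rows costs O(Bd), without any d × d matrix. The factor 1/B is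
omitted; it disappears in the normalization. -/
lemma matvecCmd_exec (m : Machine) :
    (∀ j < m.reg 1, (matvecCmd.exec m).mem 3 0 j = ∑ b ∈ Finset.range (m.reg 4),
        (∑ l ∈ Finset.range (m.reg 1), m.mem 0 (m.reg 9 + b) l * m.mem 2 0 l) *
          m.mem 0 (m.reg 9 + b) j) ∧
      (∀ j < m.reg 1, (matvecCmd.exec m).mem 4 0 j = 0) ∧
      (matvecCmd.exec m).steps ≤ m.steps + 100 * ((m.reg 4 + 1) * (m.reg 1 + 1)) := by
  set m₁ := (mapCmd 3 (.const 0)).exec m with hm₁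
  set m₂ := (mapCmd 4 (.const 0)).exec m₁ with hm₂
  obtain ⟨a1, a2⟩ := mapCmd_exec (a := 3) (E := .const 0) m (fun _ => 0)
    (fun _ _ _ _ _ => by simp [RealExp.eval])
  obtain ⟨b1, b2⟩ := mapCmd_exec (a := 4) (E := .const 0) m₁ (fun _ => 0)
    (fun _ _ _ _ _ => by simp [RealExp.eval])
  rw [← hm₁] at a1 a2
  rw [← hm₂] at b1 b2
  have hr1 : ∀ y ≠ 8, m₁.reg y = m.reg y := fun y hy =>
    Cmd.exec_reg_of_notMem (by simp [mapCmd, Cmd.regs, hy]) m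
  have hr2 : ∀ y ≠ 8, m₂.reg y = m.reg y := fun y hy =>
    (Cmd.exec_reg_of_notMem (by simp [mapCmd, Cmd.regs, hy]) m₁).trans (hr1 y hy)
  have hm1 : ∀ a ≠ 3, m₁.mem a = m.mem a := fun a ha =>
    Cmd.exec_mem_of_notMem (by simp [mapCmd, Cmd.arrs, ha]) m
  have hm2 : ∀ a ≠ 4, m₂.mem a = m₁.mem a := fun a ha =>
    Cmd.exec_mem_of_notMem (by simp [mapCmd, Cmd.arrs, ha]) m₁
  have hd1 : m₁.reg 1 = m.reg 1 := hr1 1 (by decide)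
  have hd2 : m₂.reg 1 = m.reg 1 := hr2 1 (by decide)
  have hX : m₂.mem 0 = m.mem 0 := (hm2 0 (by decide)).trans (hm1 0 (by decide))
  have hU : m₂.mem 2 = m.mem 2 := (hm2 2 (by decide)).trans (hm1 2 (by decide))
  have hexec : matvecCmd.exec m = (Cmd.loop 11 (.reg 4) (.seq dotCmd axpyCmd)).exec m₂ := rfl
  obtain ⟨h1, h2⟩ := Cmd.loop_rule (x := 11) (N := m.reg 4) (t := 60 * (m.reg 1 + 1)) (e := .reg 4)
    (c := .seq dotCmd axpyCmd) (m := m₂) (hr2 4 (by decide))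
    (fun i _ A => ∀ j < m.reg 1, A 3 0 j = ∑ b ∈ Finset.range i,
        (∑ l ∈ Finset.range (m.reg 1), m.mem 0 (m.reg 9 + b) l * m.mem 2 0 l) *
          m.mem 0 (m.reg 9 + b) j)
    (fun _ _ _ _ h => h)
    (fun j hj => by
      rw [hm2 3 (by decide), a1 j hj]; simp)
    (by
      intro i hi m' hx hr ha hI
      have e1 : m'.reg 1 = m.reg 1 := (hr 1 (by decide)).trans hd2
      have e9 : m'.reg 9 = m.reg 9 := (hr 9 (by decide)).trans (hr2 9 (by decide))
      have eX : m'.mem 0 = m.mem 0 := (ha 0 (by decide)).trans hX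
      have eU : m'.mem 2 = m.mem 2 := (ha 2 (by decide)).trans hU
      obtain ⟨c1, c2⟩ := dotCmd_exec m'
      set m₃ := dotCmd.exec m' with hm₃
      obtain ⟨d1, d2⟩ := axpyCmd_exec m₃
      have f : ∀ y ≠ 8, m₃.reg y = m'.reg y := fun y hy =>
        Cmd.exec_reg_of_notMem (by simp [dotCmd, Cmd.regs, hy]) m'
      have g : ∀ a ≠ 6, m₃.mem a = m'.mem a := fun a ha =>
        Cmd.exec_mem_of_notMem (by simp [dotCmd, Cmd.arrs, ha]) m'
      rw [f 1 (by decide), f 9 (by decide), f 11 (by decide), g 3 (by decide), g 0 (by decide),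
        e1, e9, eX, hx] at d1
      rw [f 1 (by decide), e1] at d2
      rw [e1, e9, eX, eU, hx] at c1
      rw [e1] at c2
      refine ⟨fun j hj => ?_, ?_⟩
      · rw [Finset.sum_range_succ, ← hI j hj, ← c1]
        exact d1 j hj
      · change (axpyCmd.exec m₃).steps ≤ _
        omega)
  refine ⟨h1, fun j hj => ?_, ?_⟩
  · rw [hexec, Cmd.exec_mem_of_notMem (by decide)]
    exact b1 j (by omega)
  · rw [hexec]
    refine h2.trans ?_
    simp only [RealExp.cost, NatExp.cost] at a2 b2 ⊢
    rw [hd1] at b2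
    have : 100 * ((m.reg 4 + 1) * (m.reg 1 + 1)) = m.reg 4 * (60 * (m.reg 1 + 1) + 1) +
      40 * (m.reg 4 * m.reg 1) + 39 * m.reg 4 + 100 * (m.reg 1 + 1) := by ring
    omega

/-- The order in which entries are selected. -/
def Beats (w : ℕ → ℝ) (a b : ℕ) : Prop := w b ^ 2 < w a ^ 2 ∨ (w b ^ 2 = w a ^ 2 ∧ a < b)

/-- Find the first unflagged entry of largest magnitude. -/
def scanCmd : Cmd :=
  .loop 8 (.reg 1) (.ifRealLt (.read 4 (.const 0) (.reg 8)) (.const 1)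
    (.ifRealLt (.read 7 (.const 0) (.const 0))
      (.mul (.read 3 (.const 0) (.reg 8)) (.read 3 (.const 0) (.reg 8)))
      (.seq (.setReal 7 (.const 0) (.const 0)
        (.mul (.read 3 (.const 0) (.reg 8)) (.read 3 (.const 0) (.reg 8))))
        (.setNat 13 (.reg 8))) .skip) .skip)

/-- The initial record -1 is below every square, so the first unflagged entry is always taken.
Afterwards the strict comparison keeps the smaller index among equal magnitudes, as in `Beats`. -/
lemma scanCmd_exec (m : Machine) (S : Finset ℕ) (hS : ∃ j < m.reg 1, j ∉ S)
    (hflag : ∀ j < m.reg 1, m.mem 4 0 j = if j ∈ S then 1 else 0) (h7 : m.mem 7 0 0 = -1) :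
    ((scanCmd.exec m).reg 13 < m.reg 1 ∧ (scanCmd.exec m).reg 13 ∉ S ∧
      ∀ l < m.reg 1, l ∉ S → l ≠ (scanCmd.exec m).reg 13 →
        Beats (m.mem 3 0) ((scanCmd.exec m).reg 13) l) ∧
      (scanCmd.exec m).steps ≤ m.steps + 50 * (m.reg 1 + 1) := by
  set w := m.mem 3 0 with hw
  obtain ⟨h1, h2⟩ := Cmd.loop_rule (x := 8) (N := m.reg 1) (t := 40) (e := .reg 1)
    (c := .ifRealLt (.read 4 (.const 0) (.reg 8)) (.const 1)
    (.ifRealLt (.read 7 (.const 0) (.const 0))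
      (.mul (.read 3 (.const 0) (.reg 8)) (.read 3 (.const 0) (.reg 8)))
      (.seq (.setReal 7 (.const 0) (.const 0)
        (.mul (.read 3 (.const 0) (.reg 8)) (.read 3 (.const 0) (.reg 8))))
        (.setNat 13 (.reg 8))) .skip) .skip) (m := m) rfl
    (fun i R A => ((∀ l < i, l ∈ S) ∧ A 7 0 0 = -1) ∨ (R 13 < i ∧ R 13 ∉ S ∧
      A 7 0 0 = w (R 13) ^ 2 ∧ ∀ l < i, l ∉ S → l ≠ R 13 → Beats w (R 13) l))
    (fun _ _ _ _ h => by simpa using h) (by simp [h7])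
    (by
      intro i hi m' hx hr ha hI
      have h4 : m'.mem 4 = m.mem 4 := ha 4 (by decide)
      have h3 : m'.mem 3 = m.mem 3 := ha 3 (by decide)
      by_cases hiS : i ∈ S
      · have hc : ¬ (RealExp.read 4 (.const 0) (.reg 8)).eval m' < (RealExp.const 1).eval m' := by
          simp [RealExp.eval, NatExp.eval, hx, h4, hflag i hi, hiS]
        simp only [Cmd.exec, if_neg hc]
        refine ⟨?_, by simp [Machine.tick, RealExp.cost, NatExp.cost]⟩
        simp only [Machine.tick]
        rcases hI with ⟨p1, p2⟩ | ⟨p1, p2, p3, p4⟩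
        · refine Or.inl ⟨fun l hl => ?_, p2⟩
          rcases Nat.lt_succ_iff_lt_or_eq.1 hl with h | h
          · exact p1 l h
          · exact h ▸ hiS
        · refine Or.inr ⟨by omega, p2, p3, fun l hl hlS => ?_⟩
          rcases Nat.lt_succ_iff_lt_or_eq.1 hl with h | h
          · exact p4 l h hlS
          · exact absurd (h ▸ hiS) hlS
      · have hc : (RealExp.read 4 (.const 0) (.reg 8)).eval m' < (RealExp.const 1).eval m' := by
          simp [RealExp.eval, NatExp.eval, hx, h4, hflag i hi, hiS]
        simp only [Cmd.exec, if_pos hc]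
        set m₁ := m'.tick ((RealExp.read 4 (.const 0) (.reg 8)).cost + (RealExp.const 1).cost + 1)
        by_cases hb : m'.mem 7 0 0 < w i ^ 2
        · have hc2 : (RealExp.read 7 (.const 0) (.const 0)).eval m₁ <
              (RealExp.mul (.read 3 (.const 0) (.reg 8)) (.read 3 (.const 0) (.reg 8))).eval m₁ := by
            simp only [RealExp.eval, NatExp.eval, m₁, Machine.tick, hx, h3, ← hw, ← sq]
            exact hb
          simp only [if_pos hc2]
          refine ⟨Or.inr ?_, by
            simp [m₁, Machine.tick, Machine.setMem, Machine.setReg, RealExp.cost, NatExp.cost]⟩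
          simp only [m₁, Machine.tick, Machine.setMem, Machine.setReg, NatExp.eval, RealExp.eval, hx,
            h3, ← hw, ← sq, if_true, and_self]
          refine ⟨by omega, hiS, trivial, fun l hl hlS hne => Or.inl ?_⟩
          have hli : l < i := by omega
          rcases hI with ⟨p1, -⟩ | ⟨-, -, p3, p4⟩
          · exact absurd (p1 l hli) hlS
          · rw [p3] at hb
            by_cases hlr : l = m'.reg 13
            · rw [hlr]; exact hb
            · rcases p4 l hli hlS hlr with h | h
              · exact h.trans hb
              · rw [h.1]; exact hb
        · have hc2 : ¬ (RealExp.read 7 (.const 0) (.const 0)).eval m₁ <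
              (RealExp.mul (.read 3 (.const 0) (.reg 8)) (.read 3 (.const 0) (.reg 8))).eval m₁ := by
            simp only [RealExp.eval, NatExp.eval, m₁, Machine.tick, hx, h3, ← hw, ← sq]
            exact hb
          simp only [if_neg hc2]
          refine ⟨Or.inr ?_, by
            simp [m₁, Machine.tick, RealExp.cost, NatExp.cost]⟩
          simp only [m₁, Machine.tick]
          rcases hI with ⟨-, p2⟩ | ⟨p1, p2, p3, p4⟩
          · exfalso; rw [p2] at hb; linarith [sq_nonneg (w i)]
          · refine ⟨by omega, p2, p3, fun l hl hlS hne => ?_⟩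
            rcases Nat.lt_succ_iff_lt_or_eq.1 hl with h | h
            · exact p4 l h hlS hne
            · rw [p3, not_lt] at hb
              rw [h]
              rcases hb.lt_or_eq with h' | h'
              · exact Or.inl h'
              · exact Or.inr ⟨h', p1⟩)
  refine ⟨?_, ?_⟩
  · rcases h1 with ⟨p1, -⟩ | ⟨p1, p2, -, p4⟩
    · obtain ⟨j, hj, hjS⟩ := hS
      exact absurd (p1 j hj) hjS
    · exact ⟨p1, p2, p4⟩
  · refine h2.trans ?_
    simp only [NatExp.cost]; omega

/-- Flag the first unflagged entry of largest magnitude. -/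
def roundCmd : Cmd :=
  .seq (.setReal 7 (.const 0) (.const 0) (.const (-1)))
    (.seq scanCmd (.setReal 4 (.const 0) (.reg 13) (.const 1)))

lemma roundCmd_exec (m : Machine) (S : Finset ℕ) (hS : ∃ j < m.reg 1, j ∉ S)
    (hflag : ∀ j < m.reg 1, m.mem 4 0 j = if j ∈ S then 1 else 0) :
    (∃ a < m.reg 1, a ∉ S ∧ (∀ l < m.reg 1, l ∉ S → l ≠ a → Beats (m.mem 3 0) a l) ∧
      ∀ j < m.reg 1, (roundCmd.exec m).mem 4 0 j = if j ∈ insert a S then 1 else 0) ∧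
      (roundCmd.exec m).steps ≤ m.steps + 60 * (m.reg 1 + 1) := by
  set m₁ := (Cmd.setReal 7 (.const 0) (.const 0) (.const (-1))).exec m with hm₁
  have hreg : m₁.reg = m.reg := rfl
  have hst : m₁.steps = m.steps + 4 := rfl
  have hmem : ∀ a ≠ 7, m₁.mem a = m.mem a := fun a ha =>
    Cmd.exec_mem_of_notMem (by simp [Cmd.arrs, ha]) m
  have h7 : m₁.mem 7 0 0 = -1 := by
    simp [hm₁, Cmd.exec, Machine.tick, Machine.setMem, NatExp.eval, RealExp.eval]
  obtain ⟨⟨h1, h2, h3⟩, h4⟩ := scanCmd_exec m₁ S hS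
    (by rw [hmem 4 (by decide)]; exact hflag) h7
  set m₂ := scanCmd.exec m₁ with hm₂
  have hmem2 : m₂.mem 4 = m.mem 4 :=
    (Cmd.exec_mem_of_notMem (by decide) m₁).trans (hmem 4 (by decide))
  rw [hreg, hmem 3 (by decide)] at h3
  have hexec : roundCmd.exec m = (Cmd.setReal 4 (.const 0) (.reg 13) (.const 1)).exec m₂ := rfl
  refine ⟨⟨m₂.reg 13, h1, h2, h3, fun j hj => ?_⟩, ?_⟩
  · rw [hexec]
    simp only [Cmd.exec, Machine.tick, Machine.setMem, NatExp.eval, RealExp.eval, hmem2, true_and,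
      Finset.mem_insert, hflag j hj]
    by_cases h : j = m₂.reg 13 <;> simp [h]
  · have : (roundCmd.exec m).steps = m₂.steps + 4 := rfl
    rw [hreg] at h4
    omega

/-- Flag the `reg 2` entries of largest magnitude. -/
def selectCmd : Cmd := .loop 12 (.reg 2) roundCmd

/-- Every winner beats all entries still unflagged, so the flagged set is at each round an initial
segment of the order. Repeated scans cost O(rd), which the sample size allows. -/
lemma selectCmd_exec (m : Machine) (hr : m.reg 2 ≤ m.reg 1)
    (hflag : ∀ j < m.reg 1, m.mem 4 0 j = 0) :
    (∃ S ⊆ Finset.range (m.reg 1), S.card = m.reg 2 ∧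
      (∀ j < m.reg 1, (selectCmd.exec m).mem 4 0 j = if j ∈ S then 1 else 0) ∧
      ∀ a ∈ S, ∀ b < m.reg 1, b ∉ S → Beats (m.mem 3 0) a b) ∧
      (selectCmd.exec m).steps ≤ m.steps + 70 * ((m.reg 2 + 1) * (m.reg 1 + 1)) := by
  obtain ⟨h1, h2⟩ := Cmd.loop_rule (x := 12) (N := m.reg 2) (t := 60 * (m.reg 1 + 1)) (e := .reg 2)
    (c := roundCmd) (m := m) rfl
    (fun i _ A => ∃ S ⊆ Finset.range (m.reg 1), S.card = i ∧
      (∀ j < m.reg 1, A 4 0 j = if j ∈ S then 1 else 0) ∧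
      ∀ a ∈ S, ∀ b < m.reg 1, b ∉ S → Beats (m.mem 3 0) a b)
    (fun _ _ _ _ h => h) ⟨∅, by simp, rfl, by simpa using hflag, by simp⟩
    (by
      rintro i hi m' hx hreg ha ⟨S, hSd, hSc, hSf, hSb⟩
      have e1 : m'.reg 1 = m.reg 1 := hreg 1 (by decide)
      have e3 : m'.mem 3 = m.mem 3 := ha 3 (by decide)
      have hex : ∃ j < m'.reg 1, j ∉ S := by
        by_contra hcon
        push Not at hcon
        have : (Finset.range (m.reg 1)).card ≤ S.card :=
          Finset.card_le_card fun j hj => hcon j (by rw [e1]; exact Finset.mem_range.1 hj)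
        rw [Finset.card_range] at this
        omega
      obtain ⟨⟨a, ha1, ha2, ha3, ha4⟩, hst⟩ := roundCmd_exec m' S hex (by rw [e1]; exact hSf)
      rw [e1] at ha1 ha3 ha4 hst
      rw [e3] at ha3
      refine ⟨⟨insert a S, ?_, ?_, ha4, ?_⟩, hst⟩
      · exact Finset.insert_subset (Finset.mem_range.2 ha1) hSd
      · rw [Finset.card_insert_of_notMem ha2, hSc]
      · intro c hc b hb hbS
        rw [Finset.mem_insert, not_or] at hbS
        rcases Finset.mem_insert.1 hc with rfl | hc
        · exact ha3 b hb hbS.2 hbS.1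
        · exact hSb c hc b hb hbS.2)
  refine ⟨h1, h2.trans ?_⟩
  simp only [NatExp.cost]
  have : 70 * ((m.reg 2 + 1) * (m.reg 1 + 1)) = m.reg 2 * (60 * (m.reg 1 + 1) + 1) +
      10 * (m.reg 2 * m.reg 1) + 9 * m.reg 2 + 70 * (m.reg 1 + 1) := by ring
  omega

end Blocks

/-! ### The tie-breaking rule realized by the program. -/

section CanonicalRule

variable {d r : ℕ}

/-- `S` consists of the first entries in the order by decreasing magnitude, then by index. -/
def IsUpper (v : Vec d) (S : Finset (Fin d)) : Prop :=
  ∀ a ∈ S, ∀ b ∉ S, v b ^ 2 < v a ^ 2 ∨ (v b ^ 2 = v a ^ 2 ∧ a < b)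

/-- If two such sets of equal size differed, each would have an element outside the other, and these
two elements would beat each other. This uniqueness identifies the set found by the program. -/
lemma IsUpper.eq_of_card_eq {v : Vec d} {S S' : Finset (Fin d)} (h : IsUpper v S)
    (h' : IsUpper v S') (hc : S.card = S'.card) : S = S' := by
  by_contra hne
  have h1 : ¬ S ⊆ S' := fun hs => hne (Finset.eq_of_subset_of_card_le hs hc.ge)
  have h2 : ¬ S' ⊆ S := fun hs => hne (Finset.eq_of_subset_of_card_le hs hc.le).symm
  obtain ⟨a, ha, ha'⟩ := Finset.not_subset.1 h1
  obtain ⟨b, hb, hb'⟩ := Finset.not_subset.1 h2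
  rcases h a ha b hb' with p | ⟨p, q⟩ <;> rcases h' b hb a ha' with p' | ⟨p', q'⟩
  · exact lt_asymm p p'
  · exact p.ne p'.symm
  · exact p'.ne p.symm
  · exact lt_asymm q q'

/-- Greedy: adjoin the maximum of the complement for the lexicographic order on (square, reversed
index). -/
lemma exists_isUpper (v : Vec d) (c : ℕ) (hc : c ≤ d) :
    ∃ S : Finset (Fin d), S.card = c ∧ IsUpper v S := by
  induction c with
  | zero => exact ⟨∅, rfl, by simp [IsUpper]⟩
  | succ c ih =>
    obtain ⟨S, hS, hU⟩ := ih (by omega)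
    have hne : Sᶜ.Nonempty := by
      rw [← Finset.card_pos, Finset.card_compl, Fintype.card_fin]; omega
    obtain ⟨a, ha, hmax⟩ := Finset.exists_max_image Sᶜ
      (fun i => toLex (v i ^ 2, OrderDual.toDual i)) hne
    rw [Finset.mem_compl] at ha
    refine ⟨insert a S, by rw [Finset.card_insert_of_notMem ha, hS], fun e he b hb => ?_⟩
    rw [Finset.mem_insert, not_or] at hb
    rcases Finset.mem_insert.1 he with rfl | he
    · have h := hmax b (Finset.mem_compl.2 hb.2)
      rw [Prod.Lex.toLex_le_toLex] at h
      rcases h with h | ⟨h1, h2⟩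
      · exact Or.inl h
      · exact Or.inr ⟨h1, lt_of_le_of_ne (OrderDual.toDual_le_toDual.1 h2) (Ne.symm hb.1)⟩
    · exact hU e he b hb.2

/-- The rule that breaks ties in favour of smaller indices. -/
noncomputable def canonicalRule (d r : ℕ) : TopRule d r where
  select v := (exists_isUpper v (min r d) (min_le_right _ _)).choose
  card_select v := (exists_isUpper v (min r d) (min_le_right _ _)).choose_spec.1
  le_of_mem v i hi j hj := by
    rcases (exists_isUpper v (min r d) (min_le_right _ _)).choose_spec.2 i hi j hj with h | h
    · exact (sq_lt_sq.1 h).le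
    · exact sq_le_sq.1 h.1.le
  measurable_select S := by
    by_cases hS : S.card = min r d
    -- By uniqueness, selecting S is the same as S being upper, a finite combination of comparisons
    -- of coordinates.
    · have : {v : Vec d | (exists_isUpper v (min r d) (min_le_right _ _)).choose = S} =
          {v | IsUpper v S} := by
        ext v
        have hs := (exists_isUpper v (min r d) (min_le_right _ _)).choose_spec
        constructor
        · rintro h
          rw [Set.mem_ofPred_eq] at h
          rw [h] at hs
          exact hs.2
        · exact fun h => hs.2.eq_of_card_eq h (hs.1.trans hS.symm)
      rw [this]
      simp only [IsUpper, Set.ofPred_forall, Set.ofPred_or, Set.ofPred_and]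
      have hm : ∀ i : Fin d, Measurable fun v : Vec d => v i ^ 2 :=
        fun i => (measurable_vec_coord i).pow_const 2
      refine MeasurableSet.iInter fun a => MeasurableSet.iInter fun _ =>
        MeasurableSet.iInter fun b => MeasurableSet.iInter fun _ =>
        (measurableSet_lt (hm b) (hm a)).union
          ((measurableSet_eq_fun (hm b) (hm a)).inter (MeasurableSet.const _))
    · have : {v : Vec d | (exists_isUpper v (min r d) (min_le_right _ _)).choose = S} = ∅ := by
        ext v
        simp only [Set.mem_ofPred_eq, Set.mem_empty_iff_false, iff_false]
        rintro rfl
        exact hS (exists_isUpper v (min r d) (min_le_right _ _)).choose_spec.1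
      rw [this]; exact MeasurableSet.empty

lemma canonicalRule_select_eq {v : Vec d} {S : Finset (Fin d)} (hc : S.card = min r d)
    (hS : IsUpper v S) : (canonicalRule d r).select v = S :=
  have h := (exists_isUpper v (min r d) (min_le_right _ _)).choose_spec
  h.2.eq_of_card_eq hS (h.1.trans hc.symm)

/-- This rule sees only the order of the squares, which a positive factor preserves; so the program
may work with unnormalized sums. -/
lemma canonicalRule_top_smul (v : Vec d) {c : ℝ} (hc : 0 < c) :
    (canonicalRule d r).top (c • v) = c • (canonicalRule d r).top v := by
  have h : (canonicalRule d r).select (c • v) = (canonicalRule d r).select v := by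
    refine canonicalRule_select_eq ((canonicalRule d r).card_select v) fun a ha b hb => ?_
    have h := (exists_isUpper v (min r d) (min_le_right _ _)).choose_spec.2 a ha b hb
    have hc2 : 0 < c ^ 2 := by positivity
    simpa [mul_pow, mul_lt_mul_iff_right₀ hc2, hc.ne'] using h
  ext j
  simp only [TopRule.top_apply, PiLp.smul_apply, h]
  split_ifs <;> simp

end CanonicalRule

/-! ### Program blocks: normalization, iteration, scoring and the whole algorithm. -/

section Blocks

/-- Copy the flagged entries of `w` into `u`, and compute their sum of squares. -/
def gatherCmd : Cmd :=
  .loop 8 (.reg 1) (.ifRealLt (.read 4 (.const 0) (.reg 8)) (.const 1)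
    (.setReal 2 (.const 0) (.reg 8) (.const 0))
    (.seq (.setReal 2 (.const 0) (.reg 8) (.read 3 (.const 0) (.reg 8)))
      (.setReal 6 (.const 0) (.const 0) (.add (.read 6 (.const 0) (.const 0))
        (.mul (.read 3 (.const 0) (.reg 8)) (.read 3 (.const 0) (.reg 8)))))))

lemma gatherCmd_exec (m : Machine) (S : Finset ℕ)
    (hflag : ∀ j < m.reg 1, m.mem 4 0 j = if j ∈ S then 1 else 0) (h6 : m.mem 6 0 0 = 0) :
    (∀ j < m.reg 1, (gatherCmd.exec m).mem 2 0 j = if j ∈ S then m.mem 3 0 j else 0) ∧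
      (gatherCmd.exec m).mem 6 0 0 =
        ∑ j ∈ Finset.range (m.reg 1), (if j ∈ S then m.mem 3 0 j else 0) ^ 2 ∧
      (gatherCmd.exec m).steps ≤ m.steps + 40 * (m.reg 1 + 1) := by
  obtain ⟨⟨h1, h2⟩, h3⟩ := Cmd.loop_rule (x := 8) (N := m.reg 1) (t := 35) (e := .reg 1)
    (c := .ifRealLt (.read 4 (.const 0) (.reg 8)) (.const 1)
    (.setReal 2 (.const 0) (.reg 8) (.const 0))
    (.seq (.setReal 2 (.const 0) (.reg 8) (.read 3 (.const 0) (.reg 8)))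
      (.setReal 6 (.const 0) (.const 0) (.add (.read 6 (.const 0) (.const 0))
        (.mul (.read 3 (.const 0) (.reg 8)) (.read 3 (.const 0) (.reg 8))))))) (m := m) rfl
    (fun i _ A => (∀ j < i, A 2 0 j = if j ∈ S then m.mem 3 0 j else 0) ∧
      A 6 0 0 = ∑ j ∈ Finset.range i, (if j ∈ S then m.mem 3 0 j else 0) ^ 2)
    (fun _ _ _ _ h => h) (by simp [h6])
    (by
      rintro i hi m' hx hr ha ⟨hI1, hI2⟩
      have h4 : m'.mem 4 = m.mem 4 := ha 4 (by decide)
      have h3 : m'.mem 3 = m.mem 3 := ha 3 (by decide)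
      by_cases hiS : i ∈ S
      · have hc : ¬ (RealExp.read 4 (.const 0) (.reg 8)).eval m' < (RealExp.const 1).eval m' := by
          simp [RealExp.eval, NatExp.eval, hx, h4, hflag i hi, hiS]
        simp only [Cmd.exec, if_neg hc]
        refine ⟨⟨fun j hj => ?_, ?_⟩, by
          simp [Machine.tick, Machine.setMem, RealExp.cost, NatExp.cost]⟩
        · simp only [Machine.tick, Machine.setMem, NatExp.eval, RealExp.eval, hx, h3]
          by_cases hji : j = i
          · simp [hji, hiS]
          · simp [hji, hI1 j (by omega)]
        · rw [Finset.sum_range_succ, if_pos hiS]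
          simp [Machine.tick, Machine.setMem, NatExp.eval, RealExp.eval, hx, h3, hI2, sq]
      · have hc : (RealExp.read 4 (.const 0) (.reg 8)).eval m' < (RealExp.const 1).eval m' := by
          simp [RealExp.eval, NatExp.eval, hx, h4, hflag i hi, hiS]
        simp only [Cmd.exec, if_pos hc]
        refine ⟨⟨fun j hj => ?_, ?_⟩, by
          simp [Machine.tick, Machine.setMem, RealExp.cost, NatExp.cost]⟩
        · simp only [Machine.tick, Machine.setMem, NatExp.eval, RealExp.eval, hx]
          by_cases hji : j = i
          · simp [hji, hiS]
          · simp [hji, hI1 j (by omega)]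
        · rw [Finset.sum_range_succ, if_neg hiS]
          simp [Machine.tick, Machine.setMem, NatExp.eval, RealExp.eval, hI2])
  refine ⟨h1, h2, h3.trans ?_⟩
  simp only [NatExp.cost]; omega

/-- `u` becomes the normalized restriction of `w` to the flagged entries. -/
def buildCmd : Cmd :=
  .seq (.setReal 6 (.const 0) (.const 0) (.const 0)) (.seq gatherCmd
    (.seq (.setReal 6 (.const 0) (.const 0) (.sqrt (.read 6 (.const 0) (.const 0))))
      (mapCmd 2 (.div (.read 2 (.const 0) (.reg 8)) (.read 6 (.const 0) (.const 0))))))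

/-- If all selected entries vanish, the division is by √0 = 0 and returns 0, in agreement with the
convention 0/0 = 0. -/
lemma buildCmd_exec (m : Machine) (S : Finset ℕ)
    (hflag : ∀ j < m.reg 1, m.mem 4 0 j = if j ∈ S then 1 else 0) :
    (∀ j < m.reg 1, (buildCmd.exec m).mem 2 0 j = (if j ∈ S then m.mem 3 0 j else 0) /
        √(∑ l ∈ Finset.range (m.reg 1), (if l ∈ S then m.mem 3 0 l else 0) ^ 2)) ∧
      (buildCmd.exec m).steps ≤ m.steps + 100 * (m.reg 1 + 1) := by
  set m₁ := (Cmd.setReal 6 (.const 0) (.const 0) (.const 0)).exec m with hm₁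
  have hreg1 : m₁.reg = m.reg := rfl
  have hst1 : m₁.steps = m.steps + 4 := rfl
  have hmem1 : ∀ a ≠ 6, m₁.mem a = m.mem a := fun a ha =>
    Cmd.exec_mem_of_notMem (by simp [Cmd.arrs, ha]) m
  have h6 : m₁.mem 6 0 0 = 0 := by
    simp [hm₁, Cmd.exec, Machine.tick, Machine.setMem, NatExp.eval, RealExp.eval]
  obtain ⟨g1, g2, g3⟩ := gatherCmd_exec m₁ S (by rw [hmem1 4 (by decide)]; exact hflag) h6
  rw [hmem1 3 (by decide), hreg1] at g1 g2
  set m₂ := gatherCmd.exec m₁ with hm₂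
  have hd2 : m₂.reg 1 = m.reg 1 := Cmd.exec_reg_of_notMem (by decide) m₁
  set m₃ := (Cmd.setReal 6 (.const 0) (.const 0)
    (.sqrt (.read 6 (.const 0) (.const 0)))).exec m₂ with hm₃
  have hd3 : m₃.reg 1 = m.reg 1 := hd2
  have hst3 : m₃.steps = m₂.steps + 7 := rfl
  have hu3 : m₃.mem 2 = m₂.mem 2 := Cmd.exec_mem_of_notMem (by decide) m₂
  have h63 : m₃.mem 6 0 0 = √(m₂.mem 6 0 0) := by
    simp [hm₃, Cmd.exec, Machine.tick, Machine.setMem, NatExp.eval, RealExp.eval]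
  obtain ⟨p1, p2⟩ := mapCmd_exec (a := 2)
    (E := .div (.read 2 (.const 0) (.reg 8)) (.read 6 (.const 0) (.const 0))) m₃
    (fun j => m₃.mem 2 0 j / m₃.mem 6 0 0)
    (fun m' _ hr ha h2 => by
      simp only [RealExp.eval, NatExp.eval, h2, ha 6 (by decide)])
  refine ⟨fun j hj => ?_, ?_⟩
  · refine (p1 j (by omega)).trans ?_
    rw [hu3, h63, g1 j hj, g2]
  · refine (show (buildCmd.exec m).steps = _ from rfl).le.trans (p2.trans ?_)
    rw [hd3, hst3]
    rw [hreg1] at g3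
    simp only [RealExp.cost, NatExp.cost]
    omega

/-- One iteration of the truncated power method. -/
def stepCmd : Cmd :=
  .seq matvecCmd (.seq selectCmd (.seq buildCmd (.setNat 9 (.add (.reg 9) (.reg 4)))))

variable {d n r : ℕ}

/-- The current iterate. -/
def current (d : ℕ) (m : Machine) : Vec d := WithLp.toLp 2 fun j : Fin d => m.mem 2 0 j.val

lemma current_apply (m : Machine) (j : Fin d) : current d m j = m.mem 2 0 j := rfl

lemma current_mk (m : Machine) (s : ℕ) : current d ⟨m.reg, m.mem, s⟩ = current d m := rfl

lemma sum_row_eq_inner {x : Fin n → Vec d} {A : ℕ → ℕ → ℝ}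
    (hA : ∀ (i : Fin n) (j : Fin d), A i j = x i j) (i : Fin n) (m : Machine) :
    ∑ l ∈ Finset.range d, A i l * m.mem 2 0 l = inner ℝ (current d m) (x i) := by
  rw [Finset.sum_range, inner_vec_eq_sum]
  exact Finset.sum_congr rfl fun l _ => by rw [hA, current_apply, mul_comm]

lemma stepCmd_exec {x : Fin n → Vec d} {B t : ℕ} (hB : 0 < B) (hBt : B * (t + 1) ≤ n) (hrd : r ≤ d)
    (m : Machine) (h1 : m.reg 1 = d) (h2 : m.reg 2 = r) (h4 : m.reg 4 = B) (h9 : m.reg 9 = B * t)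
    (hx : ∀ (i : Fin n) (j : Fin d), m.mem 0 i j = x i j) :
    current d (stepCmd.exec m) = tpmStep (canonicalRule d r) (batchCov x B t) (current d m) ∧
      (stepCmd.exec m).reg 9 = B * (t + 1) ∧
      (stepCmd.exec m).steps ≤ m.steps + 280 * ((B + r + 1) * (d + 1)) := by
  obtain ⟨a1, a2, a3⟩ := matvecCmd_exec m
  set m₁ := matvecCmd.exec m with hm₁
  rw [h1, h4, h9] at a1
  rw [h1] at a2
  rw [h1, h4] at a3
  have r1 : m₁.reg 1 = d := (Cmd.exec_reg_of_notMem (by decide) m).trans h1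
  have r2 : m₁.reg 2 = r := (Cmd.exec_reg_of_notMem (by decide) m).trans h2
  obtain ⟨⟨S, b1, b2, b3, b4⟩, b5⟩ := selectCmd_exec m₁ (by omega) (by rw [r1]; exact a2)
  set m₂ := selectCmd.exec m₁ with hm₂
  rw [r1] at b1 b3 b4
  rw [r2] at b2
  rw [r1, r2] at b5
  have s1 : m₂.reg 1 = d := (Cmd.exec_reg_of_notMem (by decide) m₁).trans r1
  have s3 : m₂.mem 3 = m₁.mem 3 := Cmd.exec_mem_of_notMem (by decide) m₁
  obtain ⟨c1, c2⟩ := buildCmd_exec m₂ S (by rw [s1]; exact b3)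
  set m₃ := buildCmd.exec m₂ with hm₃
  rw [s1, s3] at c1
  rw [s1] at c2
  have hexec : stepCmd.exec m = (Cmd.setNat 9 (.add (.reg 9) (.reg 4))).exec m₃ := rfl
  have hmem : (stepCmd.exec m).mem 2 = m₃.mem 2 := by
    rw [hexec]; exact Cmd.exec_mem_of_notMem (by decide) m₃
  have e9 : m₃.reg 9 = B * t := by
    rw [hm₃, Cmd.exec_reg_of_notMem (by decide), hm₂, Cmd.exec_reg_of_notMem (by decide), hm₁,
      Cmd.exec_reg_of_notMem (by decide), h9]
  have e4 : m₃.reg 4 = B := by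
    rw [hm₃, Cmd.exec_reg_of_notMem (by decide), hm₂, Cmd.exec_reg_of_notMem (by decide), hm₁,
      Cmd.exec_reg_of_notMem (by decide), h4]
  clear_value m₁ m₂ m₃
  have hsteps : (stepCmd.exec m).steps = m₃.steps + 4 := by rw [hexec]; rfl
  refine ⟨?_, ?_, ?_⟩
  · have hB' : (0 : ℝ) < B := by exact_mod_cast hB
    set y : Vec d := Matrix.toEuclideanLin (batchCov x B t) (current d m) with hy
    set w : Vec d := WithLp.toLp 2 fun j : Fin d => m₁.mem 3 0 j.val with hw
    have hwj : ∀ j : Fin d, w j = m₁.mem 3 0 j.val := fun j => rfl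
    -- The program's product is B times the product with the batch covariance; homogeneity of the
    -- rule and normalization cancel B.
    have hwy : w = (B : ℝ) • y := by
      ext j
      rw [PiLp.smul_apply, smul_eq_mul, hy, toEuclideanLin_batchCov, hwj, a1 j j.isLt]
      rw [← sum_batch (n := n) hBt (fun b => (∑ l ∈ Finset.range d, m.mem 0 b l * m.mem 2 0 l) *
          m.mem 0 b j), one_div, mul_inv_cancel_left₀ hB'.ne']
      exact Finset.sum_congr rfl fun i _ => by rw [sum_row_eq_inner hx, hx]
    have hsel : (canonicalRule d r).select w = Finset.univ.filter fun j : Fin d => j.val ∈ S := by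
      refine canonicalRule_select_eq ?_ ?_
      · rw [min_eq_left hrd, ← b2]
        refine Finset.card_bij (fun j _ => j.val) (fun j hj => (Finset.mem_filter.1 hj).2)
          (fun _ _ _ _ h => Fin.ext h) fun a ha => ?_
        exact ⟨⟨a, Finset.mem_range.1 (b1 ha)⟩, by simpa using ha, rfl⟩
      · intro a ha b hb
        simp only [Finset.mem_filter, Finset.mem_univ, true_and] at ha hb
        exact b4 a ha b b.isLt hb
    have htop : ∀ j : Fin d, (canonicalRule d r).top w j =
        if j.val ∈ S then m₁.mem 3 0 j.val else 0 := fun j => by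
      rw [TopRule.top_apply, hsel]; simp [hwj]
    have hnorm : √(∑ l ∈ Finset.range d, (if l ∈ S then m₁.mem 3 0 l else 0) ^ 2) =
        ‖(canonicalRule d r).top w‖ := by
      rw [Finset.sum_range, EuclideanSpace.norm_eq]
      refine congrArg Real.sqrt ?_
      exact Finset.sum_congr rfl fun l _ => by rw [htop l, Real.norm_eq_abs, sq_abs]
    have hres : current d (stepCmd.exec m) =
        ‖(canonicalRule d r).top w‖⁻¹ • (canonicalRule d r).top w := by
      ext j
      rw [PiLp.smul_apply, smul_eq_mul, htop j, ← hnorm, inv_mul_eq_div, current_apply, hmem,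
        c1 j j.isLt]
    rw [hres, tpmStep, ← hy, hwy, canonicalRule_top_smul y hB', norm_smul, smul_smul, mul_inv,
      Real.norm_of_nonneg hB'.le, mul_right_comm, inv_mul_cancel₀ hB'.ne', one_mul]
  · rw [hexec]
    simp [Cmd.exec, Machine.tick, Machine.setReg, NatExp.eval, e9, e4]
    ring
  · rw [hsteps]
    have : 280 * ((B + r + 1) * (d + 1)) = 100 * ((B + 1) * (d + 1)) + 70 * ((r + 1) * (d + 1)) +
      180 * (B * (d + 1)) + 210 * (r * (d + 1)) + 110 * (d + 1) := by ring
    omega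

/-- The truncated power method from the basis vector `e_i`, where `i = reg 7`. -/
def iterateCmd : Cmd :=
  .seq (mapCmd 2 (.const 0)) (.seq (.setReal 2 (.const 0) (.reg 7) (.const 1))
    (.seq (.setNat 9 (.const 0)) (.loop 10 (.reg 3) stepCmd)))

lemma iterateCmd_exec {x : Fin n → Vec d} {B T : ℕ} (hB : 0 < B) (hBT : B * T ≤ n) (hrd : r ≤ d)
    (m : Machine) (i : Fin d) (h1 : m.reg 1 = d) (h2 : m.reg 2 = r) (h3 : m.reg 3 = T)
    (h4 : m.reg 4 = B) (h7 : m.reg 7 = i) (hx : ∀ (i : Fin n) (j : Fin d), m.mem 0 i j = x i j) :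
    current d (iterateCmd.exec m) = iterate (canonicalRule d r) x B i T ∧
      (iterateCmd.exec m).steps ≤ m.steps + 300 * ((T * (B + r + 1) + 1) * (d + 1)) := by
  obtain ⟨a1, a2⟩ := mapCmd_exec (a := 2) (E := .const 0) m (fun _ => 0)
    (fun _ _ _ _ _ => by simp [RealExp.eval])
  set m₁ := (mapCmd 2 (.const 0)).exec m with hm₁
  rw [h1] at a1 a2
  have r1 : ∀ y ≠ 8, m₁.reg y = m.reg y := fun y hy =>
    Cmd.exec_reg_of_notMem (by simp [mapCmd, Cmd.regs, hy]) m
  have x1 : m₁.mem 0 = m.mem 0 := Cmd.exec_mem_of_notMem (by decide) m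
  set m₂ := (Cmd.setReal 2 (.const 0) (.reg 7) (.const 1)).exec m₁ with hm₂
  have r2 : m₂.reg = m₁.reg := rfl
  have x2 : m₂.mem 0 = m₁.mem 0 := Cmd.exec_mem_of_notMem (by decide) m₁
  set m₃ := (Cmd.setNat 9 (.const 0)).exec m₂ with hm₃
  have r3 : ∀ y ≠ 9, y ≠ 8 → m₃.reg y = m.reg y := fun y hy hy' => by
    rw [hm₃, Cmd.exec_reg_of_notMem (by simp [Cmd.regs, hy]), r2, r1 y hy']
  have x3 : m₃.mem 0 = m.mem 0 := x2.trans x1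
  have st3 : m₃.steps = m₁.steps + 6 := rfl
  have hstart : current d m₃ = EuclideanSpace.single i 1 := by
    ext j
    change m₂.mem 2 0 j = _
    simp only [hm₂, Cmd.exec, Machine.tick, Machine.setMem, NatExp.eval, RealExp.eval,
      r1 7 (by decide), h7, true_and, a1 j j.isLt]
    by_cases h : j = i
    · simp [h]
    · have : (j : ℕ) ≠ i := fun h' => h (Fin.ext h')
      simp [h, this]
  have hexec : iterateCmd.exec m = (Cmd.loop 10 (.reg 3) stepCmd).exec m₃ := rfl
  have h93 : m₃.reg 9 = B * 0 := rfl
  rw [hexec]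
  clear_value m₁ m₂ m₃
  obtain ⟨⟨p1, -⟩, p2⟩ := Cmd.loop_rule (x := 10) (N := T) (t := 280 * ((B + r + 1) * (d + 1)))
    (e := .reg 3) (c := stepCmd) (m := m₃) ((r3 3 (by decide) (by decide)).trans h3)
    -- Invariants see only registers and arrays, so the state is rebuilt with an arbitrary step
    -- count.
    (fun t R A => current d ⟨R, A, 0⟩ = iterate (canonicalRule d r) x B i t ∧ R 9 = B * t)
    (fun _ _ _ _ h => ⟨h.1, by simpa using h.2⟩) ⟨hstart, h93⟩
    (by
      rintro t ht m' hx' hr ha ⟨hI1, hI2⟩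
      have hle : B * (t + 1) ≤ n := (Nat.mul_le_mul_left _ ht).trans hBT
      have q : ∀ y ∉ ({10} ∪ stepCmd.regs : Finset ℕ), y ≠ 9 → y ≠ 8 → m'.reg y = m.reg y :=
        fun y hy h9 h8 => (hr y hy).trans (r3 y h9 h8)
      obtain ⟨c1, c2, c3⟩ := stepCmd_exec (x := x) hB hle hrd m'
        ((q 1 (by decide) (by decide) (by decide)).trans h1)
        ((q 2 (by decide) (by decide) (by decide)).trans h2)
        ((q 4 (by decide) (by decide) (by decide)).trans h4) hI2
        (fun a j => by rw [ha 0 (by decide), x3]; exact hx a j)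
      rw [current_mk] at hI1 ⊢
      rw [hI1] at c1
      exact ⟨⟨c1, c2⟩, c3⟩)
  refine ⟨p1, ?_⟩
  refine p2.trans ?_
  simp only [NatExp.cost, RealExp.cost] at a2 ⊢
  have e : 300 * ((T * (B + r + 1) + 1) * (d + 1)) = T * (280 * ((B + r + 1) * (d + 1)) + 1) +
      20 * (T * (B + r + 1) * d) + 20 * (T * (B + r)) + 19 * T + 300 * (d + 1) := by ring
  omega

/-- The unnormalized quadratic form of the sample covariance at the current iterate. -/
def scoreCmd : Cmd :=
  .seq (.setNat 9 (.const 0)) (.seq (.setReal 8 (.const 0) (.const 0) (.const 0))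
    (.loop 11 (.reg 0) (.seq dotCmd (.setReal 8 (.const 0) (.const 0)
      (.add (.read 8 (.const 0) (.const 0))
        (.mul (.read 6 (.const 0) (.const 0)) (.read 6 (.const 0) (.const 0))))))))

/-- With row offset 0 the inner product block runs over all the samples. The missing factor 1/n does
not change the maximizer. -/
lemma scoreCmd_exec {x : Fin n → Vec d} (m : Machine) (h0 : m.reg 0 = n) (h1 : m.reg 1 = d)
    (hx : ∀ (i : Fin n) (j : Fin d), m.mem 0 i j = x i j) :
    (scoreCmd.exec m).mem 8 0 0 = ∑ i, (inner ℝ (current d m) (x i) : ℝ) ^ 2 ∧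
      (scoreCmd.exec m).steps ≤ m.steps + 50 * ((n + 1) * (d + 1)) := by
  set m₁ := (Cmd.setNat 9 (.const 0)).exec m with hm₁
  set m₂ := (Cmd.setReal 8 (.const 0) (.const 0) (.const 0)).exec m₁ with hm₂
  have st2 : m₂.steps = m.steps + 6 := rfl
  have r2 : ∀ y ≠ 9, m₂.reg y = m.reg y := fun y hy =>
    Cmd.exec_reg_of_notMem (c := .setNat 9 (.const 0)) (by simp [Cmd.regs, hy]) m
  have x2 : ∀ a ≠ 8, m₂.mem a = m.mem a := fun a ha =>
    Cmd.exec_mem_of_notMem (by simp [Cmd.arrs, ha]) m₁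
  have h92 : m₂.reg 9 = 0 := rfl
  have h82 : m₂.mem 8 0 0 = 0 := by
    simp [hm₂, Cmd.exec, Machine.tick, Machine.setMem, NatExp.eval, RealExp.eval]
  obtain ⟨p1, p2⟩ := Cmd.loop_rule (x := 11) (N := n) (t := 45 * (d + 1)) (e := .reg 0)
    (c := .seq dotCmd (.setReal 8 (.const 0) (.const 0)
      (.add (.read 8 (.const 0) (.const 0))
        (.mul (.read 6 (.const 0) (.const 0)) (.read 6 (.const 0) (.const 0)))))) (m := m₂)
    ((r2 0 (by decide)).trans h0)
    (fun i _ A => A 8 0 0 = ∑ b ∈ Finset.range i,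
      (∑ l ∈ Finset.range d, m.mem 0 b l * m.mem 2 0 l) ^ 2)
    (fun _ _ _ _ h => h) (by simpa using h82)
    (by
      intro i hi m' hx' hr ha hI
      obtain ⟨c1, c2⟩ := dotCmd_exec m'
      have e1 : m'.reg 1 = d := (hr 1 (by decide)).trans ((r2 1 (by decide)).trans h1)
      have e9 : m'.reg 9 = 0 := (hr 9 (by decide)).trans h92
      have eX : m'.mem 0 = m.mem 0 := (ha 0 (by decide)).trans (x2 0 (by decide))
      have eU : m'.mem 2 = m.mem 2 := (ha 2 (by decide)).trans (x2 2 (by decide))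
      rw [e1, e9, hx', eX, eU, zero_add] at c1
      rw [e1] at c2
      have e8 : (dotCmd.exec m').mem 8 = m'.mem 8 := Cmd.exec_mem_of_notMem (by decide) m'
      constructor
      · rw [Finset.sum_range_succ, ← hI, ← c1, ← e8, sq]
        simp [Cmd.exec, Machine.tick, Machine.setMem, NatExp.eval, RealExp.eval]
      · simp only [Cmd.exec, Machine.tick, Machine.setMem, NatExp.cost, RealExp.cost] at c2 ⊢
        omega)
  constructor
  · refine p1.trans ?_
    rw [Finset.sum_range]
    exact Finset.sum_congr rfl fun i _ => by rw [sum_row_eq_inner hx]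
  · refine (show (scoreCmd.exec m).steps = _ from rfl).le.trans (p2.trans ?_)
    simp only [NatExp.cost]
    have e : 50 * ((n + 1) * (d + 1)) = n * (45 * (d + 1) + 1) + 5 * (n * d) + 4 * n +
      50 * (d + 1) := by ring
    omega

/-- Keep the current iterate if it is better than those before. -/
def updateCmd : Cmd :=
  .ifRealLt (.read 9 (.const 0) (.const 0)) (.read 8 (.const 0) (.const 0))
    (.seq (.setReal 9 (.const 0) (.const 0) (.read 8 (.const 0) (.const 0)))
      (mapCmd 1 (.read 2 (.const 0) (.reg 8)))) .skip

lemma updateCmd_exec (m : Machine) (h1 : m.reg 1 = d) :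
    ((m.mem 9 0 0 < m.mem 8 0 0 ∧ (updateCmd.exec m).mem 9 0 0 = m.mem 8 0 0 ∧
        output d (updateCmd.exec m) = current d m) ∨
      (m.mem 8 0 0 ≤ m.mem 9 0 0 ∧ (updateCmd.exec m).mem 9 0 0 = m.mem 9 0 0 ∧
        output d (updateCmd.exec m) = output d m)) ∧
      (updateCmd.exec m).steps ≤ m.steps + 40 * (d + 1) := by
  by_cases h : m.mem 9 0 0 < m.mem 8 0 0
  · have hc : (RealExp.read 9 (.const 0) (.const 0)).eval m <
        (RealExp.read 8 (.const 0) (.const 0)).eval m := h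
    set m₁ := (Cmd.setReal 9 (.const 0) (.const 0) (.read 8 (.const 0) (.const 0))).exec
      (m.tick ((RealExp.read 9 (.const 0) (.const 0)).cost +
        (RealExp.read 8 (.const 0) (.const 0)).cost + 1)) with hm₁
    have st1 : m₁.steps = m.steps + 13 := rfl
    have hexec : updateCmd.exec m = (mapCmd 1 (.read 2 (.const 0) (.reg 8))).exec m₁ := by
      rw [updateCmd, Cmd.exec, if_pos hc]; rfl
    obtain ⟨p1, p2⟩ := mapCmd_exec (a := 1) (E := .read 2 (.const 0) (.reg 8)) m₁
      (fun j => m₁.mem 2 0 j) (fun m' _ _ ha _ => by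
        simp only [RealExp.eval, NatExp.eval, ha 2 (by decide)])
    rw [← hexec] at p1 p2
    have d1 : m₁.reg 1 = d := h1
    rw [d1] at p1 p2
    refine ⟨Or.inl ⟨h, ?_, ?_⟩, ?_⟩
    · rw [hexec, Cmd.exec_mem_of_notMem (by decide)]
      simp [hm₁, Cmd.exec, Machine.tick, Machine.setMem, NatExp.eval, RealExp.eval]
    · have e2 : m₁.mem 2 = m.mem 2 := Cmd.exec_mem_of_notMem
        (c := .setReal 9 (.const 0) (.const 0) (.read 8 (.const 0) (.const 0))) (by decide) _
      ext j
      change (updateCmd.exec m).mem 1 0 j = m.mem 2 0 j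
      rw [p1 j j.isLt, e2]
    · rw [st1] at p2
      simp only [RealExp.cost, NatExp.cost] at p2
      omega
  · have hc : ¬ (RealExp.read 9 (.const 0) (.const 0)).eval m <
        (RealExp.read 8 (.const 0) (.const 0)).eval m := h
    have hexec : updateCmd.exec m = m.tick 8 := by
      rw [updateCmd, Cmd.exec, if_neg hc]; rfl
    rw [hexec]
    refine ⟨Or.inr ⟨not_lt.1 h, rfl, rfl⟩, ?_⟩
    change m.steps + 8 ≤ _
    omega

/-- One restart. -/
def restartCmd : Cmd := .seq iterateCmd (.seq scoreCmd updateCmd)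

/-- `reg 4 := n / T`. -/
def batchSizeCmd : Cmd :=
  .loop 6 (.reg 0) (.ifNatLt (.add (.reg 5) (.reg 3)) (.add (.reg 0) (.const 1))
    (.seq (.setNat 5 (.add (.reg 5) (.reg 3))) (.setNat 4 (.add (.reg 4) (.const 1)))) .skip)

/-- The machine has no integer division, so multiples of T are added while they stay at most n; n
passes suffice since n/T ≤ n. -/
lemma batchSizeCmd_exec {T : ℕ} (hT : 0 < T) (m : Machine) (h0 : m.reg 0 = n) (h3 : m.reg 3 = T)
    (h4 : m.reg 4 = 0) (h5 : m.reg 5 = 0) : (batchSizeCmd.exec m).reg 4 = n / T ∧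
      (batchSizeCmd.exec m).steps ≤ m.steps + 30 * (n + 1) := by
  obtain ⟨⟨p1, -⟩, p2⟩ := Cmd.loop_rule (x := 6) (N := n) (t := 20) (e := .reg 0)
    (c := .ifNatLt (.add (.reg 5) (.reg 3)) (.add (.reg 0) (.const 1))
    (.seq (.setNat 5 (.add (.reg 5) (.reg 3))) (.setNat 4 (.add (.reg 4) (.const 1)))) .skip)
    (m := m) h0
    (fun i R _ => R 4 = min i (n / T) ∧ R 5 = R 4 * T)
    (fun _ _ _ _ h => by simpa using h) (by simp [h4, h5])
    (by
      rintro i hi m' hx hr ha ⟨hI1, hI2⟩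
      have e0 : m'.reg 0 = n := (hr 0 (by decide)).trans h0
      have e3 : m'.reg 3 = T := (hr 3 (by decide)).trans h3
      have hle : (m'.reg 4 + 1) * T ≤ n ↔ m'.reg 4 + 1 ≤ n / T := (Nat.le_div_iff_mul_le hT).symm
      have hexp : (m'.reg 4 + 1) * T = m'.reg 4 * T + T := by ring
      by_cases hc : m'.reg 4 + 1 ≤ n / T
      · have hc' : (NatExp.add (.reg 5) (.reg 3)).eval m' <
            (NatExp.add (.reg 0) (.const 1)).eval m' := by
          simp only [NatExp.eval, e0, e3, hI2]
          have := hle.2 hc; omega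
        simp only [Cmd.exec, if_pos hc']
        refine ⟨?_, by simp [Machine.tick, Machine.setReg, NatExp.cost]⟩
        simp only [Machine.tick, Machine.setReg, NatExp.eval]
        refine ⟨?_, ?_⟩
        · simp; omega
        · simp [hI2, e3]; ring
      · have hc' : ¬ (NatExp.add (.reg 5) (.reg 3)).eval m' <
            (NatExp.add (.reg 0) (.const 1)).eval m' := by
          simp only [NatExp.eval, e0, e3, hI2]
          have := fun h => hc (hle.1 h); omega
        simp only [Cmd.exec, if_neg hc']
        refine ⟨?_, by simp [Machine.tick, NatExp.cost]⟩
        simp only [Machine.tick]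
        exact ⟨by omega, hI2⟩)
  refine ⟨p1.trans (min_eq_right (Nat.div_le_self n T)), p2.trans ?_⟩
  simp only [NatExp.cost]; omega

/-- The restarted truncated power method. -/
def rtpmCmd : Cmd :=
  .seq batchSizeCmd (.seq (.setReal 9 (.const 0) (.const 0) (.const (-1)))
    (.loop 7 (.reg 1) restartCmd))

lemma rtpmCmd_exec {T : ℕ} (hd : 0 < d) (hT : 1 ≤ T) (hrd : r ≤ d) (hTr : T * r ≤ n)
    (hTn : T ≤ n) (x : Fin n → Vec d) :
    IsRTPMOutput (canonicalRule d r) T x (output d (rtpmCmd.exec (initial r T x))) ∧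
      (rtpmCmd.exec (initial r T x)).steps ≤ 10000 * (n * d ^ 2) := by
  set m := initial r T x with hm
  have hmx : ∀ (i : Fin n) (j : Fin d), m.mem 0 i j = x i j := by
    intro i j
    simp [hm, initial]
  have hB : 0 < n / T := Nat.div_pos hTn hT
  have hBT : n / T * T ≤ n := Nat.div_mul_le_self n T
  obtain ⟨a1, a2⟩ := batchSizeCmd_exec (n := n) hT m rfl rfl rfl rfl
  set m₁ := batchSizeCmd.exec m with hm₁
  set m₂ := (Cmd.setReal 9 (.const 0) (.const 0) (.const (-1))).exec m₁ with hm₂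
  have r2 : ∀ y ∉ batchSizeCmd.regs, m₂.reg y = m.reg y := fun y hy =>
    Cmd.exec_reg_of_notMem hy m
  have x2 : m₂.mem 0 = m.mem 0 := (Cmd.exec_mem_of_notMem (by decide) m₁).trans
    (Cmd.exec_mem_of_notMem (by decide) m)
  have h92 : m₂.mem 9 0 0 = -1 := by
    simp [hm₂, Cmd.exec, Machine.tick, Machine.setMem, NatExp.eval, RealExp.eval]
  have st2 : m₂.steps = m₁.steps + 4 := rfl
  set u : Fin d → Vec d := fun i => iterate (canonicalRule d r) x (n / T) i T with hu
  set f : Fin d → ℝ := fun i => ∑ l, (inner ℝ (u i) (x l) : ℝ) ^ 2 with hf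
  have hf0 : ∀ i, 0 ≤ f i := fun i => Finset.sum_nonneg fun _ _ => sq_nonneg _
  set C := 400 * ((T * (n / T + r + 1) + n + 1) * (d + 1)) with hC
  obtain ⟨p1, p2⟩ := Cmd.loop_rule (x := 7) (N := d) (t := C) (e := .reg 1)
    (c := restartCmd) (m := m₂) (r2 1 (by decide))
    -- Scores are sums of squares, so the first restart always replaces the record -1; as d > 0, the
    -- first alternative cannot hold at the end.
    (fun i R A => (i = 0 ∧ A 9 0 0 = -1) ∨ ∃ l : Fin d, l.val < i ∧ A 9 0 0 = f l ∧
      output d ⟨R, A, 0⟩ = u l ∧ ∀ l' : Fin d, l'.val < i → f l' ≤ f l)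
    (fun _ _ _ _ h => h) (Or.inl ⟨rfl, h92⟩)
    (by
      intro i hi m' hx' hr ha hI
      have q : ∀ y ∉ ({7} ∪ restartCmd.regs : Finset ℕ) ∪ batchSizeCmd.regs,
          m'.reg y = m.reg y := fun y hy => by
        rw [Finset.notMem_union] at hy
        exact (hr y hy.1).trans (r2 y hy.2)
      have e0 : m'.reg 0 = n := q 0 (by decide)
      have e1 : m'.reg 1 = d := q 1 (by decide)
      have eX : m'.mem 0 = m.mem 0 := (ha 0 (by decide)).trans x2
      obtain ⟨b1, b2⟩ := iterateCmd_exec (x := x) hB hBT hrd m' ⟨i, hi⟩ e1 (q 2 (by decide))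
        (q 3 (by decide)) ((hr 4 (by decide)).trans a1) hx' (by rw [eX]; exact hmx)
      set m₃ := iterateCmd.exec m' with hm₃
      have s0 : m₃.reg 0 = n := (Cmd.exec_reg_of_notMem (by decide) m').trans e0
      have s1 : m₃.reg 1 = d := (Cmd.exec_reg_of_notMem (by decide) m').trans e1
      have sX : m₃.mem 0 = m.mem 0 := (Cmd.exec_mem_of_notMem (by decide) m').trans eX
      have s9 : m₃.mem 9 = m'.mem 9 := Cmd.exec_mem_of_notMem (by decide) m'
      have sO : m₃.mem 1 = m'.mem 1 := Cmd.exec_mem_of_notMem (by decide) m'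
      obtain ⟨c1, c2⟩ := scoreCmd_exec (x := x) m₃ s0 s1 (by rw [sX]; exact hmx)
      set m₄ := scoreCmd.exec m₃ with hm₄
      have t1 : m₄.reg 1 = d := (Cmd.exec_reg_of_notMem (by decide) m₃).trans s1
      have t2 : m₄.mem 2 = m₃.mem 2 := Cmd.exec_mem_of_notMem (by decide) m₃
      have t9 : m₄.mem 9 = m'.mem 9 := (Cmd.exec_mem_of_notMem (by decide) m₃).trans s9
      have tO : m₄.mem 1 = m'.mem 1 := (Cmd.exec_mem_of_notMem (by decide) m₃).trans sO
      rw [b1] at c1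
      have c1' : m₄.mem 8 0 0 = f ⟨i, hi⟩ := c1
      have tcur : current d m₄ = u ⟨i, hi⟩ := by
        rw [← show current d m₃ = u ⟨i, hi⟩ from b1]
        ext j
        rw [current_apply, current_apply, t2]
      have tout : output d m₄ = output d m' := by
        ext j
        change m₄.mem 1 0 j = m'.mem 1 0 j
        rw [tO]
      obtain ⟨d1, d2⟩ := updateCmd_exec m₄ t1
      have hexec : restartCmd.exec m' = updateCmd.exec m₄ := rfl
      rw [t9, c1', tcur, tout] at d1
      rw [hexec]
      constructor
      · right
        rcases d1 with ⟨g1, g2, g3⟩ | ⟨g1, g2, g3⟩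
        · refine ⟨⟨i, hi⟩, Nat.lt_succ_self i, g2, g3, fun l' hl' => ?_⟩
          rcases Nat.lt_succ_iff_lt_or_eq.1 hl' with h | h
          · rcases hI with ⟨h0, -⟩ | ⟨l, -, k2, -, k4⟩
            · omega
            · rw [k2] at g1
              exact (k4 l' h).trans g1.le
          · exact le_of_eq (congrArg f (Fin.ext h))
        · rcases hI with ⟨-, h0⟩ | ⟨l, k1, k2, k3, k4⟩
          · rw [h0] at g1; linarith [hf0 ⟨i, hi⟩]
          · refine ⟨l, Nat.lt_succ_of_lt k1, g2.trans k2, g3.trans k3, fun l' hl' => ?_⟩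
            rcases Nat.lt_succ_iff_lt_or_eq.1 hl' with h | h
            · exact k4 l' h
            · rw [k2] at g1
              exact (le_of_eq (congrArg f (Fin.ext h))).trans g1
      · have e : C = 300 * ((T * (n / T + r + 1) + 1) * (d + 1)) + 50 * ((n + 1) * (d + 1)) +
            40 * (d + 1) + 100 * (T * (n / T + r + 1) * (d + 1)) + 350 * (n * (d + 1)) +
            10 * (d + 1) := by rw [hC]; ring
        omega)
  have hexec : rtpmCmd.exec m = (Cmd.loop 7 (.reg 1) restartCmd).exec m₂ := rfl
  rw [hexec]
  constructor
  · rcases p1 with ⟨h0, -⟩ | ⟨l, -, -, k3, k4⟩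
    · omega
    · refine ⟨l, fun j => ?_, k3⟩
      rw [quadForm_empCov, quadForm_empCov]
      exact mul_le_mul_of_nonneg_left (k4 j j.isLt) (by positivity)
  · have st0 : m.steps = 0 := rfl
    have hn : 1 ≤ n := hT.trans hTn
    -- Here Tr ≤ n enters: selection costs no more than reading the data, and one restart takes
    -- O(nd) steps.
    have hC1 : T * (n / T + r + 1) + n + 1 ≤ 5 * n := by
      have : T * (n / T + r + 1) = n / T * T + T * r + T := by ring
      omega
    have hC2 : C ≤ 4000 * (n * d) := by
      calc C ≤ 400 * ((5 * n) * (2 * d)) := by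
            rw [hC]; gcongr; omega
        _ = 4000 * (n * d) := by ring
    have hC3 : d * (C + 1) ≤ 4001 * (n * d ^ 2) := by
      have : 1 ≤ n * d := Nat.mul_pos hn hd
      calc d * (C + 1) ≤ d * (4000 * (n * d) + n * d) := by gcongr
        _ = _ := by ring
    have hd2 : 1 ≤ d ^ 2 := Nat.pow_pos hd
    have hnd : n ≤ n * d ^ 2 := Nat.le_mul_of_pos_right n hd2
    refine p2.trans ?_
    simp only [NatExp.cost]
    omega

end Blocks

end SparsePCA

theorem mainTheorem2 :
    ∃ (P : SparsePCA.Cmd) (Ctime : ℕ) (Cr CT : ℝ), 0 < Cr ∧ 0 < CT ∧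
    ∀ K : ℝ, 1 ≤ K → ∃ Cn : ℝ, 0 < Cn ∧
    ∀ (s d n k r T : ℕ) (γ σ δ ε β : ℝ)
      (M : SparsePCA.Mat d) (hM : M.PosSemidef) (v : Fin k → SparsePCA.Vec d)
      (D : Measure (SparsePCA.Vec d)) [IsProbabilityMeasure D],
      SparsePCA.GeneralSparseKPCA s k γ σ M hM v D →
      0 < δ → δ < 1 → 0 < ε → ε < 1 / 2 → 0 < β → β ≤ γ →
      r ≤ d →
      Cr * ((s : ℝ) ^ 2 * (k : ℝ) ^ 2 / β ^ 2) ≤ (r : ℝ) →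
      (r : ℝ) ≤ K * (Cr * ((s : ℝ) ^ 2 * (k : ℝ) ^ 2 / β ^ 2)) →
      CT * ((k : ℝ) * Real.log ((s : ℝ) / ε) / β) ≤ (T : ℝ) →
      (T : ℝ) ≤ K * (CT * ((k : ℝ) * Real.log ((s : ℝ) / ε) / β)) →
      Cn * ((σ ^ 2 / SparsePCA.eigval hM.isHermitian k) ^ 2 * (s : ℝ) ^ 2 *
        ((k : ℝ) ^ 5 / (ε * β ^ 5) + (k : ℝ) ^ 2 / (ε ^ 2 * β ^ 2)) *
        Real.log ((d : ℝ) * (T : ℝ) / δ) * Real.log ((s : ℝ) / ε)) ≤ (n : ℝ) →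
      -- the algorithm can be run in time `O(n d ^ 2)`
      (∃ τ : SparsePCA.TopRule d r, ∀ x : Fin n → SparsePCA.Vec d,
        SparsePCA.IsRTPMOutput τ T x
          (SparsePCA.output d (P.exec (SparsePCA.initial r T x))) ∧
        (P.exec (SparsePCA.initial r T x)).steps ≤ Ctime * (n * d ^ 2)) ∧
      -- however ties are broken, the output is `r`-sparse and, with probability at least `1 - δ`
      -- over `n` i.i.d. samples, it is a unit vector with a large quadratic form
      (∀ τ : SparsePCA.TopRule d r,
        (∀ (x : Fin n → SparsePCA.Vec d) (u : SparsePCA.Vec d),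
          SparsePCA.IsRTPMOutput τ T x u → SparsePCA.nnz u ≤ r) ∧
        ENNReal.ofReal (1 - δ) ≤
          (Measure.pi (fun _ : Fin n => D))
            {x | ∀ u : SparsePCA.Vec d, SparsePCA.IsRTPMOutput τ T x u →
              ‖u‖ = 1 ∧
              (1 - ε - β) * SparsePCA.eigval hM.isHermitian 1 ≤ SparsePCA.quadForm M u}) := by
  -- 1025 comes from the truncation loss ω = g/(32√s), and 4 from requiring (1 - g/2)^T ≤ (ε/s)².
  -- Only the sample size constant depends on K: a factor K² from the squared accuracy per batch and
  -- a factor K from T.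
  refine ⟨SparsePCA.rtpmCmd, 10000, 1025, 4, by norm_num, by norm_num, fun K hK =>
    ⟨200000000000 * K ^ 3, by positivity, ?_⟩⟩
  intro s d n k r T γ σ δ ε β M hM v D _ hmod hδ0 hδ1 hε0 hε1 hβ0 hβγ hrd hr hr' hT hT' hn
  obtain ⟨⟨h1, h2, h3, h4⟩, h5⟩ :=
    hmod.sample_size hK hδ0 hδ1 hε0 hε1 hβ0 hβγ hrd hr hr' hT hT' hn
  exact ⟨⟨SparsePCA.canonicalRule d r, fun x =>
      SparsePCA.rtpmCmd_exec (by omega) h1 hrd h3 h4 x⟩,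
    fun τ => ⟨fun x u hu => SparsePCA.nnz_le_of_isRTPMOutput (by omega) hu, h5 τ⟩⟩
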